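/- Let $k$ be a field and let $C$, $D$ be (coassociative, counital) coalgebras over $k$. Let $\pi : C \to D$ be a coalgebra projection, i.e. a surjective homomorphism of coalgebras, and let $V$ be a $C$-bicomodule. Regard $C$ and $V$ as $D$-bicomodules through $\pi$, and suppose that $C$ is coflat both as a left and as a right $D$-comodule, i.e. the cotensor functors $-\,\Box_D\, C$ and $C\,\Box_D\,-$ (on right, respectively left, $D$-comodules) take short exact sequences to short exact sequences. For a coalgebra $B$ over $k$ and a $B$-bicomodule $W$, with coactions $w \mapsto w_{(0)}\otimes w_{(1)}$ and $w\mapsto w_{(-1)}\otimes w_{(0)}$, let $HH^n(B,W)$ denote the $n$-th cohomology of the Hochschild complex $CH^n(B,W) = W\otimes B^{\otimes n}$, $n\ge 0$, with the differential $$b(w\otimes c^1\otimes\cdots\otimes c^n) = w_{(0)}\otimes w_{(1)}\otimes c^1\otimes\cdots\otimes c^n + \sum_{j=1}^n (-1)^j\, w\otimes c^1\otimes\cdots\otimes\Delta(c^j)\otimes\cdots\otimes c^n + (-1)^{n+1}\, w_{(0)}\otimes c^1\otimes\cdots\otimes c^n\otimes w_{(-1)}.$$ Let $C^{\Box_D i}$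 be the $i$-fold cotensor power of the $D$-bicomodule $C$, with $C^{\Box_D 0}=D$; the cotensor product of two $D$-bicomodules carries the left coaction of the first and the right coaction of the second factor. Then there is a first quadrant cohomological spectral sequence of $k$-vector spaces $(E_r^{i,j}, d_r)_{r\ge 1}$, with $d_r : E_r^{i,j}\to E_r^{i+r,\,j-r+1}$, such that $$E_1^{i,j} \cong HH^j\bigl(D,\; C^{\Box_D i}\,\Box_D\, V\bigr)\qquad (i,j\ge 0),$$ and which converges to $HH^{i+j}(C,V)$: for every $n\ge 0$ there is a decreasing filtration $HH^n(C,V) = F^0\supseteq F^1\supseteq\cdots\supseteq F^{n+1}=0$ with $E_\infty^{i,j}\cong F^i/F^{i+1}$ for all $i,j\ge 0$ with $i+j=n$. -/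

import Mathlib

open scoped TensorProduct
open CategoryTheory

universe u v

noncomputable section

namespace Coalg

/-! ### Comodules and bicomodules over a coalgebra over a field -/

section Comodules

variable (k : Type u) [Field k] (C : Type v) [AddCommGroup C] [Module k C] [Coalgebra k C]

/-- A (coassociative, counital) left comodule `m ↦ m₍₋₁₎ ⊗ m₍₀₎` over the coalgebra `C`. -/
structure LeftComodule where
  /-- the underlying vector space -/
  carrier : Type v
  [addCommGroup : AddCommGroup carrier]
  [module : Module k carrier]
  /-- the left coaction -/
  left : carrier →ₗ[k] C ⊗[k] carrier
  left_coassoc : (TensorProduct.assoc k C C carrier).toLinearMap ∘ₗ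
    (Coalgebra.comul (R := k) (A := C)).rTensor carrier ∘ₗ left = left.lTensor C ∘ₗ left
  left_counit : (Coalgebra.counit (R := k) (A := C)).rTensor carrier ∘ₗ left =
    TensorProduct.mk k k carrier 1

/-- A (coassociative, counital) right comodule `m ↦ m₍₀₎ ⊗ m₍₁₎` over the coalgebra `C`. -/
structure RightComodule where
  /-- the underlying vector space -/
  carrier : Type v
  [addCommGroup : AddCommGroup carrier]
  [module : Module k carrier]
  /-- the right coaction -/
  right : carrier →ₗ[k] carrier ⊗[k] C
  right_coassoc : (TensorProduct.assoc k carrier C C).toLinearMap ∘ₗ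
    right.rTensor C ∘ₗ right = (Coalgebra.comul (R := k) (A := C)).lTensor carrier ∘ₗ right
  right_counit : (Coalgebra.counit (R := k) (A := C)).lTensor carrier ∘ₗ right =
    (TensorProduct.mk k carrier k).flip 1

/-- A `C`-bicomodule: a left and a right `C`-comodule structure on the same vector space which
commute with each other. -/
structure Bicomodule extends LeftComodule k C, RightComodule k C where
  comm : (TensorProduct.assoc k C carrier C).toLinearMap ∘ₗ left.rTensor C ∘ₗ right =
    right.lTensor C ∘ₗ left

end Comodules

attribute [instance] LeftComodule.addCommGroup LeftComodule.module
  RightComodule.addCommGroup RightComodule.module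

variable {k : Type u} [Field k]
variable {C : Type v} [AddCommGroup C] [Module k C] [Coalgebra k C]
variable {D : Type v} [AddCommGroup D] [Module k D] [Coalgebra k D]

variable (k C) in
/-- The coalgebra `C` as a bicomodule over itself through its comultiplication. -/
abbrev Bicomodule.regular : Bicomodule k C where
  carrier := C
  left := Coalgebra.comul
  right := Coalgebra.comul
  left_coassoc := Coalgebra.coassoc
  left_counit := Coalgebra.rTensor_counit_comp_comul
  right_coassoc := Coalgebra.coassoc
  right_counit := Coalgebra.lTensor_counit_comp_comul
  comm := Coalgebra.coassoc

/-- A `C`-bicomodule viewed as a `D`-bicomodule through a coalgebra homomorphism `π : C → D`. -/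
abbrev Bicomodule.corestrict (π : C →ₗc[k] D) (M : Bicomodule k C) : Bicomodule k D where
  carrier := M.carrier
  left := π.toLinearMap.rTensor M.carrier ∘ₗ M.left
  right := π.toLinearMap.lTensor M.carrier ∘ₗ M.right
  left_coassoc := by
    have h1 : (TensorProduct.assoc k D D M.carrier).toLinearMap ∘ₗ
        (Coalgebra.comul (R := k) (A := D) ∘ₗ π.toLinearMap).rTensor M.carrier =
        TensorProduct.map π.toLinearMap (π.toLinearMap.rTensor M.carrier) ∘ₗ
          (TensorProduct.assoc k C C M.carrier).toLinearMap ∘ₗ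
          (Coalgebra.comul (R := k) (A := C)).rTensor M.carrier := by
      rw [← π.map_comp_comul, LinearMap.rTensor_comp, ← LinearMap.comp_assoc,
        ← LinearMap.comp_assoc]
      congr 1
      ext; rfl
    rw [← LinearMap.comp_assoc M.left, ← LinearMap.rTensor_comp, ← LinearMap.comp_assoc, h1]
    simp only [LinearMap.comp_assoc]
    rw [M.left_coassoc]
    simp only [← LinearMap.comp_assoc]
    congr 1
    ext; rfl
  left_counit := by
    rw [← LinearMap.comp_assoc, ← LinearMap.rTensor_comp, π.counit_comp, M.left_counit]
  right_coassoc := by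
    have h1 : (Coalgebra.comul (R := k) (A := D) ∘ₗ π.toLinearMap).lTensor M.carrier =
        TensorProduct.map LinearMap.id (TensorProduct.map π.toLinearMap π.toLinearMap) ∘ₗ
          (Coalgebra.comul (R := k) (A := C)).lTensor M.carrier := by
      rw [← π.map_comp_comul, LinearMap.lTensor_comp]
      rfl
    rw [← LinearMap.comp_assoc M.right _ (Coalgebra.comul.lTensor _), ← LinearMap.lTensor_comp, h1,
      LinearMap.comp_assoc,
      ← M.right_coassoc, LinearMap.rTensor_comp]
    simp only [← LinearMap.comp_assoc]
    congr 1
    simp only [LinearMap.comp_assoc, LinearMap.rTensor_comp_lTensor]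
    simp only [← LinearMap.lTensor_comp_rTensor, ← LinearMap.comp_assoc]
    congr 1
    ext; rfl
  right_counit := by
    rw [← LinearMap.comp_assoc, ← LinearMap.lTensor_comp, π.counit_comp, M.right_counit]
  comm := by
    have h : (TensorProduct.assoc k D M.carrier D).toLinearMap ∘ₗ
        TensorProduct.map (π.toLinearMap.rTensor M.carrier ∘ₗ M.left) π.toLinearMap =
        TensorProduct.map π.toLinearMap (π.toLinearMap.lTensor M.carrier) ∘ₗ
          (TensorProduct.assoc k C M.carrier C).toLinearMap ∘ₗ M.left.rTensor C := by
      have e : TensorProduct.map (π.toLinearMap.rTensor M.carrier ∘ₗ M.left) π.toLinearMap =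
          TensorProduct.map (π.toLinearMap.rTensor M.carrier) π.toLinearMap ∘ₗ
            M.left.rTensor C := by
        ext; rfl
      rw [e]
      simp only [← LinearMap.comp_assoc]
      congr 1
      ext; rfl
    rw [← LinearMap.comp_assoc (M.right) (π.toLinearMap.lTensor M.carrier),
      LinearMap.rTensor_comp_lTensor, ← LinearMap.comp_assoc, h]
    simp only [LinearMap.comp_assoc]
    rw [M.comm]
    simp only [← LinearMap.comp_assoc]
    congr 1
    ext; rfl

/-- The tensor product `M ⊗ N` of two bicomodules, with the left coaction of `M` and the right
coaction of `N`. -/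
abbrev Bicomodule.tensor (M N : Bicomodule k D) : Bicomodule k D where
  carrier := M.carrier ⊗[k] N.carrier
  left := (TensorProduct.assoc k D M.carrier N.carrier).toLinearMap ∘ₗ M.left.rTensor N.carrier
  right := (TensorProduct.assoc k M.carrier N.carrier D).symm.toLinearMap ∘ₗ
    N.right.lTensor M.carrier
  left_coassoc := by
    let F : (D ⊗[k] (D ⊗[k] M.carrier)) ⊗[k] N.carrier →ₗ[k]
        D ⊗[k] (D ⊗[k] (M.carrier ⊗[k] N.carrier)) :=
      (TensorProduct.assoc k D M.carrier N.carrier).toLinearMap.lTensor D ∘ₗ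
        (TensorProduct.assoc k D (D ⊗[k] M.carrier) N.carrier).toLinearMap
    refine TensorProduct.ext' fun m n => ?_
    have h1 : ∀ t : D ⊗[k] M.carrier,
        TensorProduct.assoc k D D (M.carrier ⊗[k] N.carrier)
          ((Coalgebra.comul (R := k) (A := D)).rTensor (M.carrier ⊗[k] N.carrier)
            (TensorProduct.assoc k D M.carrier N.carrier (t ⊗ₜ n))) =
        F (TensorProduct.assoc k D D M.carrier
          ((Coalgebra.comul (R := k) (A := D)).rTensor M.carrier t) ⊗ₜ n) := by
      intro t
      induction t with
      | zero => simp
      | add x y hx hy => simp only [TensorProduct.add_tmul, map_add, hx, hy]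
      | tmul d m =>
        simp only [TensorProduct.assoc_tmul, LinearMap.rTensor_tmul]
        induction Coalgebra.comul (R := k) d with
        | zero => simp
        | add x y hx hy => simp only [TensorProduct.add_tmul, map_add, hx, hy]
        | tmul a b => rfl
    have h2 : ∀ t : D ⊗[k] M.carrier,
        ((TensorProduct.assoc k D M.carrier N.carrier).toLinearMap ∘ₗ
          M.left.rTensor N.carrier).lTensor D (TensorProduct.assoc k D M.carrier N.carrier
            (t ⊗ₜ n)) = F (M.left.lTensor D t ⊗ₜ n) := by
      intro t
      induction t with
      | zero => simp
      | add x y hx hy => simp only [TensorProduct.add_tmul, map_add, hx, hy]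
      | tmul d m => rfl
    exact (h1 _).trans ((congrArg (fun t => F (t ⊗ₜ n))
      (LinearMap.congr_fun M.left_coassoc m)).trans (h2 _).symm)
  left_counit := by
    refine TensorProduct.ext' fun m n => ?_
    have h1 : ∀ t : D ⊗[k] M.carrier,
        (Coalgebra.counit (R := k) (A := D)).rTensor (M.carrier ⊗[k] N.carrier)
          (TensorProduct.assoc k D M.carrier N.carrier (t ⊗ₜ n)) =
        TensorProduct.assoc k k M.carrier N.carrier
          ((Coalgebra.counit (R := k) (A := D)).rTensor M.carrier t ⊗ₜ n) := by
      intro t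
      induction t with
      | zero => simp
      | add x y hx hy => simp only [TensorProduct.add_tmul, map_add, hx, hy]
      | tmul d m => rfl
    exact (h1 _).trans (congrArg (fun t => TensorProduct.assoc k k M.carrier N.carrier (t ⊗ₜ n))
      (LinearMap.congr_fun M.left_counit m))
  right_coassoc := by
    let F : M.carrier ⊗[k] (N.carrier ⊗[k] (D ⊗[k] D)) →ₗ[k]
        (M.carrier ⊗[k] N.carrier) ⊗[k] (D ⊗[k] D) :=
      (TensorProduct.assoc k M.carrier N.carrier (D ⊗[k] D)).symm.toLinearMap
    refine TensorProduct.ext' fun m n => ?_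
    have h1 : ∀ t : N.carrier ⊗[k] D,
        TensorProduct.assoc k (M.carrier ⊗[k] N.carrier) D D
          (((TensorProduct.assoc k M.carrier N.carrier D).symm.toLinearMap ∘ₗ
            N.right.lTensor M.carrier).rTensor D
              ((TensorProduct.assoc k M.carrier N.carrier D).symm (m ⊗ₜ t))) =
        F (m ⊗ₜ TensorProduct.assoc k N.carrier D D (N.right.rTensor D t)) := by
      intro t
      induction t with
      | zero => simp
      | add x y hx hy => simp only [TensorProduct.tmul_add, map_add, hx, hy]
      | tmul n d =>
        simp only [TensorProduct.assoc_symm_tmul, LinearMap.rTensor_tmul, LinearMap.comp_apply,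
          LinearMap.lTensor_tmul]
        induction N.right n with
        | zero => simp
        | add x y hx hy => simp only [TensorProduct.add_tmul, TensorProduct.tmul_add, map_add, hx, hy]
        | tmul a b => rfl
    have h2 : ∀ t : N.carrier ⊗[k] D,
        (Coalgebra.comul (R := k) (A := D)).lTensor (M.carrier ⊗[k] N.carrier)
          ((TensorProduct.assoc k M.carrier N.carrier D).symm (m ⊗ₜ t)) =
        F (m ⊗ₜ (Coalgebra.comul (R := k) (A := D)).lTensor N.carrier t) := by
      intro t
      induction t with
      | zero => simp
      | add x y hx hy => simp only [TensorProduct.tmul_add, map_add, hx, hy]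
      | tmul n d => rfl
    exact (h1 _).trans ((congrArg (fun t => F (m ⊗ₜ t))
      (LinearMap.congr_fun N.right_coassoc n)).trans (h2 _).symm)
  right_counit := by
    refine TensorProduct.ext' fun m n => ?_
    have h1 : ∀ t : N.carrier ⊗[k] D,
        (Coalgebra.counit (R := k) (A := D)).lTensor (M.carrier ⊗[k] N.carrier)
          ((TensorProduct.assoc k M.carrier N.carrier D).symm (m ⊗ₜ t)) =
        (TensorProduct.assoc k M.carrier N.carrier k).symm
          (m ⊗ₜ (Coalgebra.counit (R := k) (A := D)).lTensor N.carrier t) := by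
      intro t
      induction t with
      | zero => simp
      | add x y hx hy => simp only [TensorProduct.tmul_add, map_add, hx, hy]
      | tmul n d => rfl
    exact (h1 _).trans (congrArg
      (fun t => (TensorProduct.assoc k M.carrier N.carrier k).symm (m ⊗ₜ t))
      (LinearMap.congr_fun N.right_counit n))
  comm := by
    refine TensorProduct.ext' fun m n => ?_
    have h : ∀ (s : D ⊗[k] M.carrier) (t : N.carrier ⊗[k] D), M.left m = s → N.right n = t →
        TensorProduct.assoc k D (M.carrier ⊗[k] N.carrier) D
          (((TensorProduct.assoc k D M.carrier N.carrier).toLinearMap ∘ₗ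
            M.left.rTensor N.carrier).rTensor D
              ((TensorProduct.assoc k M.carrier N.carrier D).symm (m ⊗ₜ t))) =
        ((TensorProduct.assoc k M.carrier N.carrier D).symm.toLinearMap ∘ₗ
          N.right.lTensor M.carrier).lTensor D
            (TensorProduct.assoc k D M.carrier N.carrier (s ⊗ₜ n)) := by
      intro s t hs ht
      have h1 : TensorProduct.assoc k D (M.carrier ⊗[k] N.carrier) D
          (((TensorProduct.assoc k D M.carrier N.carrier).toLinearMap ∘ₗ
            M.left.rTensor N.carrier).rTensor D
              ((TensorProduct.assoc k M.carrier N.carrier D).symm (m ⊗ₜ t))) =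
          (TensorProduct.assoc k M.carrier N.carrier D).symm.toLinearMap.lTensor D
            (TensorProduct.assoc k D M.carrier (N.carrier ⊗[k] D) (s ⊗ₜ t)) := by
        clear ht
        induction t with
        | zero => simp
        | add x y hx hy => simp only [TensorProduct.tmul_add, map_add, hx, hy]
        | tmul n d =>
          simp only [TensorProduct.assoc_symm_tmul, LinearMap.rTensor_tmul, LinearMap.comp_apply,
            hs]
          clear hs
          induction s with
          | zero => simp
          | add x y hx hy => simp only [TensorProduct.add_tmul, map_add, hx, hy]
          | tmul a b => rfl
      rw [h1]
      clear h1 hs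
      induction s with
      | zero => simp
      | add x y hx hy => simp only [TensorProduct.add_tmul, map_add, hx, hy]
      | tmul a b => simp [ht]
    exact h _ _ rfl rfl

/-- The factorization through an injective linear map `i` of a linear map `f` whose values lie in
the range of `i`. -/
def factorThru {X Y Z : Type*} [AddCommGroup X] [Module k X] [AddCommGroup Y] [Module k Y]
    [AddCommGroup Z] [Module k Z] (i : X →ₗ[k] Y) (hi : Function.Injective i) (f : Z →ₗ[k] Y)
    (hf : ∀ z, f z ∈ LinearMap.range i) : Z →ₗ[k] X :=
  (LinearEquiv.ofInjective i hi).symm.toLinearMap ∘ₗ f.codRestrict _ hf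

theorem factorThru_apply {X Y Z : Type*} [AddCommGroup X] [Module k X] [AddCommGroup Y] [Module k Y]
    [AddCommGroup Z] [Module k Z] (i : X →ₗ[k] Y) (hi : Function.Injective i) (f : Z →ₗ[k] Y)
    (hf : ∀ z, f z ∈ LinearMap.range i) (z : Z) : i (factorThru i hi f hf z) = f z := by
  have h := (LinearEquiv.ofInjective i hi).apply_symm_apply (f.codRestrict _ hf z)
  exact congrArg Subtype.val h

theorem lTensor_subtype_injective {X Y : Type*} [AddCommGroup X] [Module k X] [AddCommGroup Y]
    [Module k Y] (K : Submodule k X) :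
    Function.Injective (K.subtype.lTensor Y) :=
  Module.Flat.lTensor_preserves_injective_linearMap _ K.injective_subtype

theorem rTensor_subtype_injective {X Y : Type*} [AddCommGroup X] [Module k X] [AddCommGroup Y]
    [Module k Y] (K : Submodule k X) :
    Function.Injective (K.subtype.rTensor Y) :=
  Module.Flat.rTensor_preserves_injective_linearMap _ K.injective_subtype

section Restrict

variable (M : Bicomodule k D) (K : Submodule k M.carrier)

/-- The left coaction of a bicomodule restricted to a subspace `K` which it maps into the image of
`D ⊗ K`. -/
def Bicomodule.restrictLeft
    (hl : ∀ x : K, (M.left ∘ₗ K.subtype) x ∈ LinearMap.range (K.subtype.lTensor D)) :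
    K →ₗ[k] D ⊗[k] K :=
  factorThru _ (lTensor_subtype_injective K) (M.left ∘ₗ K.subtype) hl

/-- The right coaction of a bicomodule restricted to a subspace `K` which it maps into the image of
`K ⊗ D`. -/
def Bicomodule.restrictRight
    (hr : ∀ x : K, (M.right ∘ₗ K.subtype) x ∈ LinearMap.range (K.subtype.rTensor D)) :
    K →ₗ[k] K ⊗[k] D :=
  factorThru _ (rTensor_subtype_injective K) (M.right ∘ₗ K.subtype) hr

theorem Bicomodule.lTensor_restrictLeft
    (hl : ∀ x : K, (M.left ∘ₗ K.subtype) x ∈ LinearMap.range (K.subtype.lTensor D)) :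
    K.subtype.lTensor D ∘ₗ M.restrictLeft K hl = M.left ∘ₗ K.subtype :=
  LinearMap.ext fun x => factorThru_apply _ _ _ hl x

theorem Bicomodule.rTensor_restrictRight
    (hr : ∀ x : K, (M.right ∘ₗ K.subtype) x ∈ LinearMap.range (K.subtype.rTensor D)) :
    K.subtype.rTensor D ∘ₗ M.restrictRight K hr = M.right ∘ₗ K.subtype :=
  LinearMap.ext fun x => factorThru_apply _ _ _ hr x

/-- A subspace `K` of a bicomodule `M` which is stable under both coactions is a bicomodule. -/
abbrev Bicomodule.restrict
    (hl : ∀ x : K, (M.left ∘ₗ K.subtype) x ∈ LinearMap.range (K.subtype.lTensor D))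
    (hr : ∀ x : K, (M.right ∘ₗ K.subtype) x ∈ LinearMap.range (K.subtype.rTensor D)) :
    Bicomodule k D where
  carrier := K
  left := M.restrictLeft K hl
  right := M.restrictRight K hr
  left_coassoc := by
    have hi : Function.Injective ((K.subtype.lTensor D).lTensor D) :=
      Module.Flat.lTensor_preserves_injective_linearMap _ (lTensor_subtype_injective K)
    rw [← LinearMap.cancel_left hi]
    have e := M.lTensor_restrictLeft K hl
    have h1 : (K.subtype.lTensor D).lTensor D ∘ₗ (TensorProduct.assoc k D D K).toLinearMap ∘ₗ
        (Coalgebra.comul (R := k) (A := D)).rTensor K =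
        ((TensorProduct.assoc k D D M.carrier).toLinearMap ∘ₗ
          (Coalgebra.comul (R := k) (A := D)).rTensor M.carrier) ∘ₗ K.subtype.lTensor D := by
      refine TensorProduct.ext' fun d x => ?_
      simp only [LinearMap.comp_apply, LinearMap.rTensor_tmul, LinearMap.lTensor_tmul]
      induction Coalgebra.comul (R := k) d with
      | zero => simp
      | add x y hx hy => simp only [TensorProduct.add_tmul, map_add, hx, hy]
      | tmul a b => rfl
    calc _ = ((K.subtype.lTensor D).lTensor D ∘ₗ (TensorProduct.assoc k D D K).toLinearMap ∘ₗ
        (Coalgebra.comul (R := k) (A := D)).rTensor K) ∘ₗ M.restrictLeft K hl := rfl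
      _ = (M.left.lTensor D ∘ₗ M.left) ∘ₗ K.subtype := by
        rw [h1, LinearMap.comp_assoc, e, ← M.left_coassoc]; rfl
      _ = (K.subtype.lTensor D ∘ₗ M.restrictLeft K hl).lTensor D ∘ₗ M.restrictLeft K hl := by
        rw [LinearMap.comp_assoc, ← e, ← LinearMap.comp_assoc, ← LinearMap.lTensor_comp, ← e]
      _ = _ := by rw [LinearMap.lTensor_comp]; rfl
  left_counit := by
    have hi : Function.Injective (K.subtype.lTensor k) :=
      Module.Flat.lTensor_preserves_injective_linearMap _ K.injective_subtype
    rw [← LinearMap.cancel_left hi]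
    calc _ = (Coalgebra.counit (R := k) (A := D)).rTensor M.carrier ∘ₗ
          (K.subtype.lTensor D ∘ₗ M.restrictLeft K hl) := by
          rw [← LinearMap.comp_assoc, ← LinearMap.comp_assoc, LinearMap.rTensor_comp_lTensor,
            LinearMap.lTensor_comp_rTensor]
      _ = TensorProduct.mk k k M.carrier 1 ∘ₗ K.subtype := by
          rw [M.lTensor_restrictLeft, ← LinearMap.comp_assoc, M.left_counit]
      _ = _ := rfl
  right_coassoc := by
    have hi : Function.Injective (K.subtype.rTensor (D ⊗[k] D)) :=
      Module.Flat.rTensor_preserves_injective_linearMap _ K.injective_subtype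
    rw [← LinearMap.cancel_left hi]
    have e := M.rTensor_restrictRight K hr
    have h1 : K.subtype.rTensor (D ⊗[k] D) ∘ₗ (TensorProduct.assoc k K D D).toLinearMap =
        (TensorProduct.assoc k M.carrier D D).toLinearMap ∘ₗ
          (K.subtype.rTensor D).rTensor D := by
      ext; rfl
    calc _ = (K.subtype.rTensor (D ⊗[k] D) ∘ₗ (TensorProduct.assoc k K D D).toLinearMap) ∘ₗ
        (M.restrictRight K hr).rTensor D ∘ₗ M.restrictRight K hr := rfl
      _ = (TensorProduct.assoc k M.carrier D D).toLinearMap ∘ₗ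
          (K.subtype.rTensor D ∘ₗ M.restrictRight K hr).rTensor D ∘ₗ M.restrictRight K hr := by
        rw [h1, LinearMap.rTensor_comp]; rfl
      _ = (TensorProduct.assoc k M.carrier D D).toLinearMap ∘ₗ M.right.rTensor D ∘ₗ
          (K.subtype.rTensor D ∘ₗ M.restrictRight K hr) := by
        rw [e, LinearMap.rTensor_comp, LinearMap.comp_assoc, e]
      _ = ((Coalgebra.comul (R := k) (A := D)).lTensor M.carrier ∘ₗ M.right) ∘ₗ K.subtype := by
        rw [e, ← M.right_coassoc]; rfl
      _ = (Coalgebra.comul (R := k) (A := D)).lTensor M.carrier ∘ₗ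
          K.subtype.rTensor D ∘ₗ M.restrictRight K hr := by
        rw [e]; rfl
      _ = _ := by
        rw [← LinearMap.comp_assoc, ← LinearMap.comp_assoc, LinearMap.rTensor_comp_lTensor,
            LinearMap.lTensor_comp_rTensor]
  right_counit := by
    have hi : Function.Injective (K.subtype.rTensor k) :=
      Module.Flat.rTensor_preserves_injective_linearMap _ K.injective_subtype
    rw [← LinearMap.cancel_left hi]
    calc _ = (Coalgebra.counit (R := k) (A := D)).lTensor M.carrier ∘ₗ
          (K.subtype.rTensor D ∘ₗ M.restrictRight K hr) := by
          rw [← LinearMap.comp_assoc, ← LinearMap.comp_assoc, LinearMap.rTensor_comp_lTensor,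
            LinearMap.lTensor_comp_rTensor]
      _ = (TensorProduct.mk k M.carrier k).flip 1 ∘ₗ K.subtype := by
          rw [M.rTensor_restrictRight, ← LinearMap.comp_assoc, M.right_counit]
      _ = _ := rfl
  comm := by
    have hi : Function.Injective ((K.subtype.rTensor D).lTensor D) :=
      Module.Flat.lTensor_preserves_injective_linearMap _ (rTensor_subtype_injective K)
    rw [← LinearMap.cancel_left hi]
    have el := M.lTensor_restrictLeft K hl
    have er := M.rTensor_restrictRight K hr
    have h1 : (K.subtype.rTensor D).lTensor D ∘ₗ (TensorProduct.assoc k D K D).toLinearMap =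
        (TensorProduct.assoc k D M.carrier D).toLinearMap ∘ₗ
          (K.subtype.lTensor D).rTensor D := by
      ext; rfl
    calc _ = ((K.subtype.rTensor D).lTensor D ∘ₗ (TensorProduct.assoc k D K D).toLinearMap) ∘ₗ
        (M.restrictLeft K hl).rTensor D ∘ₗ M.restrictRight K hr := rfl
      _ = (TensorProduct.assoc k D M.carrier D).toLinearMap ∘ₗ
          (K.subtype.lTensor D ∘ₗ M.restrictLeft K hl).rTensor D ∘ₗ M.restrictRight K hr := by
        rw [h1, LinearMap.rTensor_comp]; rfl
      _ = (TensorProduct.assoc k D M.carrier D).toLinearMap ∘ₗ M.left.rTensor D ∘ₗ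
          (K.subtype.rTensor D ∘ₗ M.restrictRight K hr) := by
        rw [el, LinearMap.rTensor_comp, LinearMap.comp_assoc]
      _ = (M.right.lTensor D ∘ₗ M.left) ∘ₗ K.subtype := by
        rw [er, ← M.comm]; rfl
      _ = M.right.lTensor D ∘ₗ (K.subtype.lTensor D ∘ₗ M.restrictLeft K hl) := by
        rw [el]; rfl
      _ = (K.subtype.rTensor D ∘ₗ M.restrictRight K hr).lTensor D ∘ₗ M.restrictLeft K hl := by
        rw [er, LinearMap.lTensor_comp]; rfl
      _ = _ := by rw [LinearMap.lTensor_comp]; rfl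

end Restrict

/-! ### The cotensor product -/

section Cotensor

variable {E M N : Type v} [AddCommGroup E] [Module k E] [AddCommGroup M] [Module k M]
  [AddCommGroup N] [Module k N]

/-- The difference `ρ ⊗ id - id ⊗ lam : M ⊗ N → M ⊗ E ⊗ N` whose kernel is the cotensor product. -/
def cotensorDiff (ρ : M →ₗ[k] M ⊗[k] E) (lam : N →ₗ[k] E ⊗[k] N) :
    M ⊗[k] N →ₗ[k] M ⊗[k] (E ⊗[k] N) :=
  (TensorProduct.assoc k M E N).toLinearMap ∘ₗ ρ.rTensor N - lam.lTensor M

/-- The cotensor product `M □_E N` of a right and a left comodule over a coalgebra `E`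
with coactions `ρ`, `lam`: the subspace of `M ⊗ N` on which `ρ ⊗ id` and `id ⊗ lam` agree. -/
def cotensor (ρ : M →ₗ[k] M ⊗[k] E) (lam : N →ₗ[k] E ⊗[k] N) : Submodule k (M ⊗[k] N) :=
  LinearMap.ker (cotensorDiff ρ lam)

theorem exact_cotensorDiff (ρ : M →ₗ[k] M ⊗[k] E) (lam : N →ₗ[k] E ⊗[k] N) :
    Function.Exact (cotensor ρ lam).subtype (cotensorDiff ρ lam) := by
  rw [LinearMap.exact_iff, Submodule.range_subtype, cotensor]

end Cotensor

theorem Bicomodule.left_mem_cotensor (M N : Bicomodule k D) (x : cotensor M.right N.left) :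
    ((M.tensor N).left ∘ₗ (cotensor M.right N.left).subtype) x ∈
      LinearMap.range ((cotensor M.right N.left).subtype.lTensor D) := by
  rw [LinearMap.mem_range]
  refine (Module.Flat.lTensor_exact D (exact_cotensorDiff M.right N.left) _).mp ?_
  have h : (cotensorDiff M.right N.left).lTensor D ∘ₗ
      (TensorProduct.assoc k D M.carrier N.carrier).toLinearMap ∘ₗ M.left.rTensor N.carrier =
      ((TensorProduct.assoc k D M.carrier (D ⊗[k] N.carrier)).toLinearMap ∘ₗ
        M.left.rTensor (D ⊗[k] N.carrier)) ∘ₗ cotensorDiff M.right N.left := by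
    let F : (D ⊗[k] (M.carrier ⊗[k] D)) ⊗[k] N.carrier →ₗ[k]
        D ⊗[k] (M.carrier ⊗[k] (D ⊗[k] N.carrier)) :=
      (TensorProduct.assoc k M.carrier D N.carrier).toLinearMap.lTensor D ∘ₗ
        (TensorProduct.assoc k D (M.carrier ⊗[k] D) N.carrier).toLinearMap
    rw [cotensorDiff, LinearMap.lTensor_sub, LinearMap.comp_sub, LinearMap.sub_comp]
    congr 1
    · refine TensorProduct.ext' fun m n => ?_
      have h1 : ∀ t : D ⊗[k] M.carrier,
          ((TensorProduct.assoc k M.carrier D N.carrier).toLinearMap ∘ₗ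
            M.right.rTensor N.carrier).lTensor D
              (TensorProduct.assoc k D M.carrier N.carrier (t ⊗ₜ n)) =
          F (M.right.lTensor D t ⊗ₜ n) := by
        intro t
        induction t with
        | zero => simp
        | add x y hx hy => simp only [TensorProduct.add_tmul, map_add, hx, hy]
        | tmul d m => rfl
      have h2 : ∀ t : M.carrier ⊗[k] D,
          TensorProduct.assoc k D M.carrier (D ⊗[k] N.carrier)
            (M.left.rTensor (D ⊗[k] N.carrier)
              (TensorProduct.assoc k M.carrier D N.carrier (t ⊗ₜ n))) =
          F (TensorProduct.assoc k D M.carrier D (M.left.rTensor D t) ⊗ₜ n) := by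
        intro t
        induction t with
        | zero => simp
        | add x y hx hy => simp only [TensorProduct.add_tmul, map_add, hx, hy]
        | tmul m d =>
          simp only [TensorProduct.assoc_tmul, LinearMap.rTensor_tmul]
          induction M.left m with
          | zero => simp
          | add x y hx hy => simp only [TensorProduct.add_tmul, map_add, hx, hy]
          | tmul a b => rfl
      exact (h1 _).trans ((congrArg (fun t => F (t ⊗ₜ n))
        (LinearMap.congr_fun M.comm m).symm).trans (h2 _).symm)
    · refine TensorProduct.ext' fun m n => ?_
      simp only [LinearMap.comp_apply, LinearMap.rTensor_tmul, LinearMap.lTensor_tmul]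
      induction M.left m with
      | zero => simp
      | add x y hx hy => simp only [TensorProduct.add_tmul, map_add, hx, hy]
      | tmul a b => rfl
  have hx : cotensorDiff M.right N.left x.1 = 0 := x.2
  refine (LinearMap.congr_fun h x.1).trans ?_
  simp only [LinearMap.comp_apply, hx, map_zero]

theorem Bicomodule.right_mem_cotensor (M N : Bicomodule k D) (x : cotensor M.right N.left) :
    ((M.tensor N).right ∘ₗ (cotensor M.right N.left).subtype) x ∈
      LinearMap.range ((cotensor M.right N.left).subtype.rTensor D) := by
  rw [LinearMap.mem_range]
  refine (Module.Flat.rTensor_exact D (exact_cotensorDiff M.right N.left) _).mp ?_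
  have h : (cotensorDiff M.right N.left).rTensor D ∘ₗ
      (TensorProduct.assoc k M.carrier N.carrier D).symm.toLinearMap ∘ₗ N.right.lTensor M.carrier =
      ((TensorProduct.assoc k M.carrier (D ⊗[k] N.carrier) D).symm.toLinearMap ∘ₗ
        ((TensorProduct.assoc k D N.carrier D).symm.toLinearMap ∘ₗ
          N.right.lTensor D).lTensor M.carrier) ∘ₗ cotensorDiff M.right N.left := by
    let F : M.carrier ⊗[k] (D ⊗[k] (N.carrier ⊗[k] D)) →ₗ[k]
        (M.carrier ⊗[k] (D ⊗[k] N.carrier)) ⊗[k] D :=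
      (TensorProduct.assoc k M.carrier (D ⊗[k] N.carrier) D).symm.toLinearMap ∘ₗ
        (TensorProduct.assoc k D N.carrier D).symm.toLinearMap.lTensor M.carrier
    rw [cotensorDiff, LinearMap.rTensor_sub, LinearMap.comp_sub, LinearMap.sub_comp]
    congr 1
    · refine TensorProduct.ext' fun m n => ?_
      have h1 : ∀ t : N.carrier ⊗[k] D,
          ((TensorProduct.assoc k M.carrier D N.carrier).toLinearMap ∘ₗ
            M.right.rTensor N.carrier).rTensor D
              ((TensorProduct.assoc k M.carrier N.carrier D).symm (m ⊗ₜ t)) =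
          F (TensorProduct.assoc k M.carrier D (N.carrier ⊗[k] D) (M.right m ⊗ₜ t)) := by
        intro t
        induction t with
        | zero => simp
        | add x y hx hy => simp only [TensorProduct.tmul_add, map_add, hx, hy]
        | tmul n d =>
          simp only [TensorProduct.assoc_symm_tmul, LinearMap.rTensor_tmul, LinearMap.comp_apply]
          induction M.right m with
          | zero => simp
          | add x y hx hy => simp only [TensorProduct.add_tmul, map_add, hx, hy]
          | tmul a b => rfl
      refine (h1 _).trans ?_
      simp only [LinearMap.comp_apply, LinearMap.rTensor_tmul]
      induction M.right m with
      | zero => simp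
      | add x y hx hy => simp only [TensorProduct.add_tmul, map_add, hx, hy]
      | tmul a b => rfl
    · refine TensorProduct.ext' fun m n => ?_
      have h1 : ∀ t : N.carrier ⊗[k] D,
          (N.left.lTensor M.carrier).rTensor D
              ((TensorProduct.assoc k M.carrier N.carrier D).symm (m ⊗ₜ t)) =
          F (m ⊗ₜ TensorProduct.assoc k D N.carrier D (N.left.rTensor D t)) := by
        intro t
        induction t with
        | zero => simp
        | add x y hx hy => simp only [TensorProduct.tmul_add, map_add, hx, hy]
        | tmul n d =>
          simp only [TensorProduct.assoc_symm_tmul, LinearMap.rTensor_tmul, LinearMap.lTensor_tmul]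
          induction N.left n with
          | zero => simp
          | add x y hx hy =>
            simp only [TensorProduct.add_tmul, TensorProduct.tmul_add, map_add, hx, hy]
          | tmul a b => rfl
      refine (h1 _).trans ((congrArg (fun t => F (m ⊗ₜ t)) (LinearMap.congr_fun N.comm n)).trans ?_)
      simp only [LinearMap.comp_apply, LinearMap.lTensor_tmul]
      induction N.left n with
      | zero => simp
      | add x y hx hy => simp only [TensorProduct.tmul_add, map_add, hx, hy]
      | tmul a b => rfl
  have hx : cotensorDiff M.right N.left x.1 = 0 := x.2
  refine (LinearMap.congr_fun h x.1).trans ?_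
  simp only [LinearMap.comp_apply, hx, map_zero]

/-- The cotensor product `M □_D N` of two `D`-bicomodules as a `D`-bicomodule: the left coaction
is that of `M`, the right coaction is that of `N`. -/
abbrev Bicomodule.cotensor (M N : Bicomodule k D) : Bicomodule k D :=
  (M.tensor N).restrict (Coalg.cotensor M.right N.left) (M.left_mem_cotensor N)
    (M.right_mem_cotensor N)

/-- The iterated cotensor power `M^{□_D i} = M □_D ⋯ □_D M` (`i` factors) of a `D`-bicomodule, with
the convention `M^{□_D 0} = D`, the unit of the cotensor product. -/
def Bicomodule.cotensorPower (M : Bicomodule k D) : ℕ → Bicomodule k D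
  | 0 => Bicomodule.regular k D
  | i + 1 => (M.cotensorPower i).cotensor M

/-! ### Coflatness -/

section Coflat

variable {M M' N N' : Type v} [AddCommGroup M] [Module k M] [AddCommGroup N] [Module k N]
  [AddCommGroup M'] [Module k M'] [AddCommGroup N'] [Module k N']

/-- The map `f □ id : M □_D N → M' □_D N` induced by a homomorphism `f` of right comodules. -/
def cotensorMapLeft {ρ : M →ₗ[k] M ⊗[k] D} {ρ' : M' →ₗ[k] M' ⊗[k] D} (lam : N →ₗ[k] D ⊗[k] N)
    (f : M →ₗ[k] M') (hf : ρ' ∘ₗ f = f.rTensor D ∘ₗ ρ) :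
    cotensor ρ lam →ₗ[k] cotensor ρ' lam :=
  (f.rTensor N).restrict <| by
    have h : cotensorDiff ρ' lam ∘ₗ f.rTensor N =
        f.rTensor (D ⊗[k] N) ∘ₗ cotensorDiff ρ lam := by
      rw [cotensorDiff, cotensorDiff, LinearMap.comp_sub, LinearMap.sub_comp, LinearMap.comp_assoc,
        ← LinearMap.rTensor_comp, hf, LinearMap.rTensor_comp_lTensor,
        LinearMap.lTensor_comp_rTensor, LinearMap.rTensor_comp]
      congr 1
      rw [← LinearMap.comp_assoc, ← LinearMap.comp_assoc]
      congr 1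
      ext; rfl
    intro x hx
    have hx' : cotensorDiff ρ lam x = 0 := hx
    exact (LinearMap.congr_fun h x).trans (by simp [hx'])

/-- The map `id □ f : M □_D N → M □_D N'` induced by a homomorphism `f` of left comodules. -/
def cotensorMapRight (ρ : M →ₗ[k] M ⊗[k] D) {lam : N →ₗ[k] D ⊗[k] N}
    {lam' : N' →ₗ[k] D ⊗[k] N'} (f : N →ₗ[k] N') (hf : lam' ∘ₗ f = f.lTensor D ∘ₗ lam) :
    cotensor ρ lam →ₗ[k] cotensor ρ lam' :=
  (f.lTensor M).restrict <| by
    have h : cotensorDiff ρ lam' ∘ₗ f.lTensor M =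
        (f.lTensor D).lTensor M ∘ₗ cotensorDiff ρ lam := by
      rw [cotensorDiff, cotensorDiff, LinearMap.comp_sub, LinearMap.sub_comp, LinearMap.comp_assoc,
        ← LinearMap.lTensor_comp, hf, LinearMap.rTensor_comp_lTensor,
        ← LinearMap.lTensor_comp_rTensor, LinearMap.lTensor_comp]
      congr 1
      rw [← LinearMap.comp_assoc, ← LinearMap.comp_assoc]
      congr 1
      ext; rfl
    intro x hx
    have hx' : cotensorDiff ρ lam x = 0 := hx
    exact (LinearMap.congr_fun h x).trans (by simp [hx'])

/-- A left `D`-comodule `N` is coflat if the functor `- □_D N` is exact: it takes every short exact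
sequence of right `D`-comodules to a short exact sequence. -/
def LeftComodule.IsCoflat (N : LeftComodule k D) : Prop :=
  ∀ (M₁ M₂ M₃ : RightComodule k D) (f : M₁.carrier →ₗ[k] M₂.carrier)
    (g : M₂.carrier →ₗ[k] M₃.carrier) (hf : M₂.right ∘ₗ f = f.rTensor D ∘ₗ M₁.right)
    (hg : M₃.right ∘ₗ g = g.rTensor D ∘ₗ M₂.right),
    Function.Injective f → Function.Exact f g → Function.Surjective g →
      Function.Injective (cotensorMapLeft N.left f hf) ∧
      Function.Exact (cotensorMapLeft N.left f hf) (cotensorMapLeft N.left g hg) ∧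
      Function.Surjective (cotensorMapLeft N.left g hg)

/-- A right `D`-comodule `M` is coflat if the functor `M □_D -` is exact: it takes every short exact
sequence of left `D`-comodules to a short exact sequence. -/
def RightComodule.IsCoflat (M : RightComodule k D) : Prop :=
  ∀ (N₁ N₂ N₃ : LeftComodule k D) (f : N₁.carrier →ₗ[k] N₂.carrier)
    (g : N₂.carrier →ₗ[k] N₃.carrier) (hf : N₂.left ∘ₗ f = f.lTensor D ∘ₗ N₁.left)
    (hg : N₃.left ∘ₗ g = g.lTensor D ∘ₗ N₂.left),
    Function.Injective f → Function.Exact f g → Function.Surjective g →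
      Function.Injective (cotensorMapRight M.right f hf) ∧
      Function.Exact (cotensorMapRight M.right f hf) (cotensorMapRight M.right g hg) ∧
      Function.Surjective (cotensorMapRight M.right g hg)

end Coflat

/-! ### Hochschild cohomology of a coalgebra -/

section Hochschild

variable (V : Bicomodule k C)

/-- The Hochschild cochains `CH^n(C, V) = V ⊗ C^{⊗ n}`, bracketed as
`(⋯((V ⊗ C) ⊗ C) ⋯) ⊗ C`. They are themselves a `C`-bicomodule: the left coaction is that of `V`,
`v ⊗ c¹ ⊗ ⋯ ⊗ cⁿ ↦ v₍₋₁₎ ⊗ (v₍₀₎ ⊗ c¹ ⊗ ⋯ ⊗ cⁿ)`, and the right coaction is the one of the last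
tensor factor, that is `v ⊗ c¹ ⊗ ⋯ ⊗ cⁿ ↦ v ⊗ c¹ ⊗ ⋯ ⊗ Δ(cⁿ)` for `n ≥ 1` and `v ↦ v₍₀₎ ⊗ v₍₁₎` for
`n = 0`. -/
def cochains : ℕ → Bicomodule k C
  | 0 => V
  | n + 1 => (cochains n).tensor (Bicomodule.regular k C)

/-- The cofaces `d_i : CH^n(C, V) → CH^{n+1}(C, V)` for `0 ≤ i ≤ n`: `d_0` is the right coaction
`v ⊗ c¹ ⊗ ⋯ ↦ v₍₀₎ ⊗ v₍₁₎ ⊗ c¹ ⊗ ⋯`, and `d_i` is the comultiplication of `cⁱ` for `1 ≤ i ≤ n`.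
(The value for `i > n` is not used.) -/
def coface : (n i : ℕ) → (cochains V n).carrier →ₗ[k] (cochains V n).carrier ⊗[k] C
  | 0, _ => V.right
  | n + 1, i => if i = n + 1 then (cochains V (n + 1)).right else (coface n i).rTensor C

/-- The last coface `v ⊗ c¹ ⊗ ⋯ ⊗ cⁿ ↦ v₍₀₎ ⊗ c¹ ⊗ ⋯ ⊗ cⁿ ⊗ v₍₋₁₎`. -/
def lastCoface (M : Bicomodule k C) : M.carrier →ₗ[k] M.carrier ⊗[k] C :=
  (TensorProduct.comm k C M.carrier).toLinearMap ∘ₗ M.left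

/-- The Hochschild differential `b = ∑_{i = 0}^{n} (-1)^i d_i + (-1)^{n+1} d_{n+1}`. -/
def hochschildD (n : ℕ) : (cochains V n).carrier →ₗ[k] (cochains V (n + 1)).carrier :=
  ∑ i ∈ Finset.range (n + 1), (-1 : k) ^ i • coface V n i +
    (-1 : k) ^ (n + 1) • lastCoface (cochains V n)

/-- The part of the Hochschild differential without the last coface. -/
def partialD (n : ℕ) : (cochains V n).carrier →ₗ[k] (cochains V n).carrier ⊗[k] C :=
  ∑ i ∈ Finset.range (n + 1), (-1 : k) ^ i • coface V n i

theorem partialD_zero : partialD V 0 = V.right := by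
  simp only [partialD, zero_add, Finset.sum_range_one, pow_zero, one_smul]
  rfl

theorem partialD_succ (n : ℕ) : partialD V (n + 1) =
    (partialD V n).rTensor C +
      (-1 : k) ^ (n + 1) • ((cochains V n).tensor (Bicomodule.regular k C)).right := by
  have h1 : ∀ i ∈ Finset.range (n + 1),
      (-1 : k) ^ i • coface V (n + 1) i = ((-1 : k) ^ i • coface V n i).rTensor C := by
    intro i hi
    have h : i ≠ n + 1 := (Finset.mem_range.mp hi).ne
    rw [LinearMap.rTensor_smul]
    exact congrArg _ (if_neg h)
  have h2 : coface V (n + 1) (n + 1) =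
      ((cochains V n).tensor (Bicomodule.regular k C)).right := if_pos rfl
  have h3 : (partialD V n).rTensor C =
      ∑ i ∈ Finset.range (n + 1), ((-1 : k) ^ i • coface V n i).rTensor C := by
    rw [partialD, ← LinearMap.coe_rTensorHom, map_sum]
  rw [h3, ← h2]
  exact (Finset.sum_range_succ _ _).trans
    (congrArg (fun x => x + (-1 : k) ^ (n + 1) • coface V (n + 1) (n + 1))
      (Finset.sum_congr rfl h1))

section Step

variable (M : Bicomodule k C)

/-- The right coaction of `M ⊗ C` through the last factor is natural in `M`. -/
theorem right_tensor_natural {X Y : Bicomodule k C} (f : X.carrier →ₗ[k] Y.carrier) :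
    (Y.tensor (Bicomodule.regular k C)).right ∘ₗ f.rTensor C =
      (f.rTensor C).rTensor C ∘ₗ (X.tensor (Bicomodule.regular k C)).right := by
  refine TensorProduct.ext' fun x c => ?_
  simp only [LinearMap.comp_apply, LinearMap.rTensor_tmul, LinearMap.lTensor_tmul]
  induction Coalgebra.comul (R := k) c with
  | zero => simp
  | add x y hx hy => simp only [TensorProduct.tmul_add, map_add, hx, hy]
  | tmul a b => rfl

theorem right_tensor_right :
    ((M.tensor (Bicomodule.regular k C)).tensor (Bicomodule.regular k C)).right ∘ₗ
      (M.tensor (Bicomodule.regular k C)).right =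
    (M.tensor (Bicomodule.regular k C)).right.rTensor C ∘ₗ
      (M.tensor (Bicomodule.regular k C)).right := by
  have h := (M.tensor (Bicomodule.regular k C)).right_coassoc
  rw [LinearMap.comp_assoc _ _ (TensorProduct.assoc k _ C C).symm.toLinearMap]
  refine (congrArg _ h.symm).trans ?_
  rw [← LinearMap.comp_assoc, LinearEquiv.symm_comp, LinearMap.id_comp]

/-- One step of the induction for `partialD_partialD`. -/
theorem partial_step (p : M.carrier →ₗ[k] M.carrier ⊗[k] C) (s : k)
    (h : (p.rTensor C + s • (M.tensor (Bicomodule.regular k C)).right) ∘ₗ p = 0) :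
    ((p.rTensor C + s • (M.tensor (Bicomodule.regular k C)).right).rTensor C + (-s) •
      ((M.tensor (Bicomodule.regular k C)).tensor (Bicomodule.regular k C)).right) ∘ₗ
      (p.rTensor C + s • (M.tensor (Bicomodule.regular k C)).right) = 0 := by
  have h1 := right_tensor_natural (X := M) (Y := M.tensor (Bicomodule.regular k C)) p
  have h2 := right_tensor_right M
  set q := p.rTensor C + s • (M.tensor (Bicomodule.regular k C)).right with hq
  have h3 : q.rTensor C ∘ₗ p.rTensor C = 0 := by
    rw [← LinearMap.rTensor_comp, h, LinearMap.rTensor_zero]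
  have h4 : q.rTensor C = (p.rTensor C).rTensor C +
      s • (M.tensor (Bicomodule.regular k C)).right.rTensor C := by
    rw [hq, LinearMap.rTensor_add, LinearMap.rTensor_smul]
  have h5 : q.rTensor C ∘ₗ q = s • (q.rTensor C ∘ₗ (M.tensor (Bicomodule.regular k C)).right) := by
    conv_lhs => rw [hq]
    rw [LinearMap.comp_add, ← hq, h3, zero_add, LinearMap.comp_smul]
  rw [LinearMap.add_comp, h5, h4, LinearMap.add_comp, LinearMap.smul_comp, LinearMap.smul_comp, hq,
    LinearMap.comp_add, LinearMap.comp_smul, h1, h2]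
  module

theorem lastCoface_right :
    (M.tensor (Bicomodule.regular k C)).right ∘ₗ lastCoface M =
      lastCoface (M.tensor (Bicomodule.regular k C)) ∘ₗ lastCoface M := by
  let F : C ⊗[k] (C ⊗[k] M.carrier) →ₗ[k] (M.carrier ⊗[k] C) ⊗[k] C :=
    (TensorProduct.comm k C (M.carrier ⊗[k] C)).toLinearMap ∘ₗ
      (TensorProduct.assoc k C M.carrier C).toLinearMap ∘ₗ
        (TensorProduct.comm k C (C ⊗[k] M.carrier)).toLinearMap
  refine LinearMap.ext fun m => ?_
  have h1 : ∀ t : C ⊗[k] M.carrier, (M.tensor (Bicomodule.regular k C)).right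
      (TensorProduct.comm k C M.carrier t) =
      F (TensorProduct.assoc k C C M.carrier
        ((Coalgebra.comul (R := k) (A := C)).rTensor M.carrier t)) := by
    intro t
    induction t with
    | zero => simp
    | add x y hx hy => simp only [map_add, hx, hy]
    | tmul c m =>
      simp only [TensorProduct.comm_tmul, LinearMap.comp_apply, LinearMap.rTensor_tmul,
        LinearMap.lTensor_tmul]
      induction Coalgebra.comul (R := k) c with
      | zero => simp
      | add x y hx hy => simp only [TensorProduct.add_tmul, TensorProduct.tmul_add, map_add, hx, hy]
      | tmul a b => rfl
  have h2 : ∀ t : C ⊗[k] M.carrier, lastCoface (M.tensor (Bicomodule.regular k C))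
      (TensorProduct.comm k C M.carrier t) = F (M.left.lTensor C t) := by
    intro t
    induction t with
    | zero => simp
    | add x y hx hy => simp only [map_add, hx, hy]
    | tmul c m => rfl
  exact (h1 _).trans ((congrArg F (LinearMap.congr_fun M.left_coassoc m)).trans (h2 _).symm)

/-- One step of the induction for `left_partialD`. -/
theorem left_step (p : M.carrier →ₗ[k] M.carrier ⊗[k] C) (s : k)
    (h : (M.tensor (Bicomodule.regular k C)).left ∘ₗ p = p.lTensor C ∘ₗ M.left) :
    ((M.tensor (Bicomodule.regular k C)).tensor (Bicomodule.regular k C)).left ∘ₗ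
      (p.rTensor C + s • (M.tensor (Bicomodule.regular k C)).right) =
    (p.rTensor C + s • (M.tensor (Bicomodule.regular k C)).right).lTensor C ∘ₗ
      (M.tensor (Bicomodule.regular k C)).left := by
  have h1 := (M.tensor (Bicomodule.regular k C)).comm
  have h2 : (TensorProduct.assoc k C (M.carrier ⊗[k] C) C).toLinearMap ∘ₗ
      (p.lTensor C).rTensor C = (p.rTensor C).lTensor C ∘ₗ
        (TensorProduct.assoc k C M.carrier C).toLinearMap :=
    TensorProduct.ext_threefold fun _ _ _ => rfl
  rw [LinearMap.lTensor_add, LinearMap.lTensor_smul, LinearMap.add_comp, LinearMap.comp_add,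
    LinearMap.comp_smul, LinearMap.smul_comp, ← h1, ← LinearMap.comp_assoc _ _ (LinearMap.lTensor _ _),
    ← h2, LinearMap.comp_assoc, ← LinearMap.rTensor_comp, h, LinearMap.rTensor_comp]
  congr 1

theorem lastCoface_natural (p : M.carrier →ₗ[k] M.carrier ⊗[k] C)
    (h : (M.tensor (Bicomodule.regular k C)).left ∘ₗ p = p.lTensor C ∘ₗ M.left) :
    lastCoface (M.tensor (Bicomodule.regular k C)) ∘ₗ p = p.rTensor C ∘ₗ lastCoface M := by
  have h1 : p.rTensor C ∘ₗ (TensorProduct.comm k C M.carrier).toLinearMap =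
      (TensorProduct.comm k C (M.carrier ⊗[k] C)).toLinearMap ∘ₗ p.lTensor C :=
    TensorProduct.ext' fun _ _ => rfl
  rw [lastCoface, lastCoface, LinearMap.comp_assoc, h, ← LinearMap.comp_assoc, ← h1,
    LinearMap.comp_assoc]

/-- The vanishing of the square of the Hochschild differential, in terms of its partial sums. -/
theorem hochschild_step (p : M.carrier →ₗ[k] M.carrier ⊗[k] C) (s : k)
    (h : (M.tensor (Bicomodule.regular k C)).left ∘ₗ p = p.lTensor C ∘ₗ M.left)
    (h0 : (p.rTensor C + s • (M.tensor (Bicomodule.regular k C)).right) ∘ₗ p = 0) :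
    ((p.rTensor C + s • (M.tensor (Bicomodule.regular k C)).right) +
        (-s) • lastCoface (M.tensor (Bicomodule.regular k C))) ∘ₗ (p + s • lastCoface M) = 0 := by
  have h1 := lastCoface_natural M p h
  have h2 := lastCoface_right M
  rw [LinearMap.comp_add, LinearMap.add_comp, h0, LinearMap.smul_comp, h1, LinearMap.comp_smul,
    LinearMap.add_comp, LinearMap.add_comp, LinearMap.smul_comp, LinearMap.smul_comp, h2]
  module

end Step

theorem partialD_partialD (n : ℕ) : partialD V (n + 1) ∘ₗ partialD V n = 0 := by
  induction n with
  | zero =>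
    rw [partialD_succ]
    have h : (V.tensor (Bicomodule.regular k C)).right ∘ₗ V.right =
        V.right.rTensor C ∘ₗ V.right := by
      rw [LinearMap.comp_assoc]
      refine (congrArg _ V.right_coassoc.symm).trans ?_
      rw [← LinearMap.comp_assoc, LinearEquiv.symm_comp, LinearMap.id_comp]
    have e : partialD V 0 = V.right := partialD_zero V
    have h' : (V.right.rTensor C + (-1 : k) ^ (0 + 1) •
        (V.tensor (Bicomodule.regular k C)).right) ∘ₗ V.right = 0 := by
      rw [LinearMap.add_comp, LinearMap.smul_comp, h]
      module
    rw [e]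
    exact h'
  | succ n ih =>
    rw [partialD_succ] at ih
    have h := partial_step (cochains V n) _ _ ih
    rw [partialD_succ V (n + 1), partialD_succ V n]
    have e : (-1 : k) ^ (n + 1 + 1) = -(-1 : k) ^ (n + 1) := by rw [pow_succ (-1 : k) (n + 1)]; ring
    rw [e]
    exact h

theorem left_partialD (n : ℕ) :
    ((cochains V n).tensor (Bicomodule.regular k C)).left ∘ₗ partialD V n =
      (partialD V n).lTensor C ∘ₗ (cochains V n).left := by
  induction n with
  | zero =>
    rw [partialD_zero]
    exact V.comm
  | succ n ih =>
    rw [partialD_succ]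
    exact left_step _ _ _ ih

theorem hochschildD_hochschildD (n : ℕ) : hochschildD V (n + 1) ∘ₗ hochschildD V n = 0 := by
  have h0 := partialD_partialD V n
  rw [partialD_succ] at h0
  have h := hochschild_step (cochains V n) (partialD V n) ((-1 : k) ^ (n + 1))
    (left_partialD V n) h0
  have e : (-1 : k) ^ (n + 1 + 1) = -(-1 : k) ^ (n + 1) := by rw [pow_succ (-1 : k) (n + 1)]; ring
  have h' : hochschildD V (n + 1) =
      partialD V (n + 1) + (-1 : k) ^ (n + 1 + 1) • lastCoface (cochains V (n + 1)) := rfl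
  rw [h', e, partialD_succ]
  exact h

/-- The Hochschild complex `CH^*(C, V)`. -/
def hochschildComplex : CochainComplex (ModuleCat.{v} k) ℕ :=
  CochainComplex.of (fun n => ModuleCat.of k (cochains V n).carrier) (fun n => ModuleCat.ofHom (hochschildD V n)) fun n => by
    rw [← ModuleCat.ofHom_comp, hochschildD_hochschildD]; rfl

/-- The Hochschild cohomology `HH^n(C, V)` of the coalgebra `C` with coefficients in the
`C`-bicomodule `V`. -/
def HH (n : ℕ) : ModuleCat.{v} k := (hochschildComplex V).homology n

end Hochschild

/-! ### Convergence of spectral sequences -/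

/-- The term `E_1^{i,j}` of a first quadrant cohomological spectral sequence starting at `E_1`. -/
def firstPage (E : CohomologicalSpectralSequenceNat (ModuleCat.{v} k) 1) (i j : ℕ) :
    ModuleCat.{v} k :=
  (E.page 1).X (i, j)

/-- A first quadrant cohomological spectral sequence of vector spaces starting at `E_1` converges to
the graded vector space `H`: each `H n` has a decreasing filtration
`H n = F⁰ ⊇ F¹ ⊇ ⋯ ⊇ F^{n+1} = 0` such that `E_∞^{p,q} ≅ F^p / F^{p+1}` for `p + q = n`. At the
position `(p, q)` no differential of `E_r` is nonzero once `r ≥ p + q + 2`, so that `E_∞^{p,q}` is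
`E_r^{p,q}` for any such `r`. -/
def ConvergesTo (E : CohomologicalSpectralSequenceNat (ModuleCat.{v} k) 1)
    (H : ℕ → ModuleCat.{v} k) : Prop :=
  ∀ n : ℕ, ∃ F : ℕ → Submodule k (H n), Antitone F ∧ F 0 = ⊤ ∧ F (n + 1) = ⊥ ∧
    ∀ p q : ℕ, p + q = n → ∀ (r : ℤ) (hr : (p : ℤ) + q + 2 ≤ r),
      Nonempty ((E.page r).X (p, q) ≅
        ModuleCat.of k (F p ⧸ (F (p + 1)).submoduleOf (F p)))

end Coalg

end

noncomputable section

namespace Coalg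

/-! The change of coalgebra is made in the coefficients, by a resolution relative to `π`. For a
`C`-bicomodule `W` let `C □_D W` (`Bicomodule.coind`) carry the left coaction of `C` and the right
coaction of `W`. The left coaction of `V` has values in `C □_D V`, and the complex `0 → V → C □_D V
→ C □_D C □_D V → ⋯` is exact, since the counit on the leftmost factor contracts it
(`coindStage_exact`). Over a field `- ⊗ C^{⊗ n}` is exact, so the Hochschild double complex of this
resolution has exact rows augmented by `CH^*(C, V)`, and its total cohomology is `HH^*(C, V)`
(`DoubleComplex.totEquiv`). The filtration by columns gives a spectral sequence with `E_1^{i,j} =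
HH^j(C, C □_D W_i)`, where `W_i = C^{□_D i} □_D V`.

It remains to prove a Shapiro lemma (`coindEquiv`): `HH^j(C, C □_D W) ≅ HH^j(D, W)`. Both sides are
compared with the double complex `W ⊗ C^{⊗ (a + 1)} ⊗ D^{⊗ b}`. In the direction of `a` it is the
cobar resolution of the right coaction of `W`, so it computes `HH^*(D, W)`. In the direction of `b`
it is the Hochschild complex over `D` of `(W ⊗ C^{⊗ a}) ⊗ C`. In general the degree zero cohomology
of `M ⊗ P` is `P □_D M`, and the higher cohomology vanishes if `P` is a coflat right comodule
(`hochschildD_exact_of_isCoflat`, by dimension shifting along `M → D ⊗ M`). With `P = C` only the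
spaces `C □_D (W ⊗ C^{⊗ a})` remain. Moving the leading factor `C` to the end (`rotation`)
identifies them with the Hochschild cochains of `C □_D W` over `C`.

Unit and associativity isomorphisms of the cotensor product then bring `W_i` to the required form.
The spectral sequence and its convergence come from the classical subspaces `Z_r` and `B_r` of a
bounded filtered complex. -/

variable {k : Type u} [Field k]

/-! ### Subquotients -/

section Subquotient

variable {A : Type*} [AddCommGroup A] [Module k A] {A' : Type*} [AddCommGroup A'] [Module k A']

/-- The subquotient `Z / (B ∩ Z)`. -/
abbrev Subquotient (Z B : Submodule k A) := Z ⧸ B.submoduleOf Z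

/-- The map between subquotients induced by a linear map. -/
def Subquotient.map {Z B : Submodule k A} {Z' B' : Submodule k A'} (f : A →ₗ[k] A')
    (hZ : ∀ x ∈ Z, f x ∈ Z') (hB : ∀ x ∈ B, f x ∈ B') : Subquotient Z B →ₗ[k] Subquotient Z' B' :=
  Submodule.mapQ _ _ (f.restrict hZ) fun x hx => hB x.1 hx

theorem Subquotient.mk_eq_zero {Z B : Submodule k A} (x : Z) :
    (Submodule.Quotient.mk x : Subquotient Z B) = 0 ↔ x.1 ∈ B := by
  rw [Submodule.Quotient.mk_eq_zero]; rfl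

theorem Subquotient.mk_eq_mk {Z B : Submodule k A} (x y : Z) :
    (Submodule.Quotient.mk x : Subquotient Z B) = Submodule.Quotient.mk y ↔ x.1 - y.1 ∈ B := by
  rw [Submodule.Quotient.eq]; rfl

/-- Two quotients of a module by the same submodule are isomorphic. -/
def equivOfKerEq {P Q R : Type*} [AddCommGroup P] [Module k P] [AddCommGroup Q] [Module k Q]
    [AddCommGroup R] [Module k R] (f : P →ₗ[k] Q) (g : P →ₗ[k] R)
    (hf : Function.Surjective f) (hg : Function.Surjective g) (h : ∀ x, f x = 0 ↔ g x = 0) :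
    Q ≃ₗ[k] R :=
  (f.quotKerEquivOfSurjective hf).symm ≪≫ₗ
    Submodule.quotEquivOfEq _ _ (by ext x; exact h x) ≪≫ₗ g.quotKerEquivOfSurjective hg

/-- A map defined on `Z` which induces an isomorphism of subquotients. -/
def Subquotient.equiv {Z B : Submodule k A} {Z' B' : Submodule k A'} (f : Z →ₗ[k] A')
    (hZ : ∀ x, f x ∈ Z') (hB : ∀ x, f x ∈ B' ↔ x.1 ∈ B)
    (hs : ∀ y ∈ Z', ∃ x, y - f x ∈ B') : Subquotient Z B ≃ₗ[k] Subquotient Z' B' :=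
  equivOfKerEq (B.submoduleOf Z).mkQ ((B'.submoduleOf Z').mkQ ∘ₗ f.codRestrict Z' hZ)
    (Submodule.mkQ_surjective _) (by
      intro y
      obtain ⟨y, rfl⟩ := Submodule.mkQ_surjective _ y
      obtain ⟨x, hx⟩ := hs y.1 y.2
      refine ⟨x, ?_⟩
      symm
      rw [← sub_eq_zero, LinearMap.comp_apply, ← map_sub]
      exact (Subquotient.mk_eq_zero _).2 hx)
    fun x => (Subquotient.mk_eq_zero x).trans
      ((hB x).symm.trans (Subquotient.mk_eq_zero (f.codRestrict Z' hZ x)).symm)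

end Subquotient

/-- A description of the homology of a short complex of vector spaces as a quotient of a space `P`
of representatives. -/
def homologyIsoOfRepresentatives (S : ShortComplex (ModuleCat.{v} k)) {P H : Type v}
    [AddCommGroup P] [Module k P] [AddCommGroup H] [Module k H] (q : P →ₗ[k] S.X₂) (u : P →ₗ[k] H)
    (hu : Function.Surjective u) (hq : ∀ x, S.g (q x) = 0)
    (hs : ∀ x, S.g x = 0 → ∃ p y, x = q p + S.f y)
    (hk : ∀ x, u x = 0 ↔ ∃ y, S.f y = q x) : S.homology ≅ ModuleCat.of k H :=
  S.moduleCatHomologyIso ≪≫ LinearEquiv.toModuleIso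
    (equivOfKerEq ((LinearMap.range S.moduleCatToCycles).mkQ ∘ₗ
      q.codRestrict (LinearMap.ker S.g.hom) hq) u (by
        intro x
        obtain ⟨⟨x, hx⟩, rfl⟩ := Submodule.mkQ_surjective _ x
        obtain ⟨p, y, h⟩ := hs x hx
        refine ⟨p, ?_⟩
        symm
        rw [← sub_eq_zero, LinearMap.comp_apply, ← map_sub, Submodule.mkQ_apply,
          Submodule.Quotient.mk_eq_zero]
        refine ⟨y, Subtype.ext ?_⟩
        change S.f y = x - q p
        rw [h]; abel) hu (by
        intro x
        rw [hk, LinearMap.comp_apply, Submodule.mkQ_apply, Submodule.Quotient.mk_eq_zero]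
        constructor
        · rintro ⟨y, hy⟩
          exact ⟨y, congrArg Subtype.val hy⟩
        · rintro ⟨y, hy⟩
          exact ⟨y, Subtype.ext hy⟩))

/-! ### The spectral sequence of a bounded filtered complex -/

/-- A filtered complex given by subspaces `F p n` of a vector space `A` with a differential: the
`p`-th step of the filtration in degree `n`. The filtration starts at `p = 0` and vanishes
in degree `n` for `p > n`. -/
structure FilteredComplex (k : Type u) [Field k] where
  /-- the ambient space -/
  A : Type v
  [addCommGroup : AddCommGroup A]
  [module : Module k A]
  /-- the differential -/
  D : A →ₗ[k] A
  /-- the filtration -/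
  F : ℤ → ℤ → Submodule k A
  D_D : ∀ x, D (D x) = 0
  D_mem : ∀ {p n : ℤ} {x : A}, x ∈ F p n → D x ∈ F p (n + 1)
  anti : ∀ {p p' : ℤ} (n : ℤ), p ≤ p' → F p' n ≤ F p n
  low : ∀ {p : ℤ} (n : ℤ), p ≤ 0 → F p n ≤ F 0 n
  high : ∀ {p n : ℤ}, n < p → F p n = ⊥

namespace FilteredComplex

attribute [instance] FilteredComplex.addCommGroup FilteredComplex.module

variable (K : FilteredComplex.{u, v} k)

/-- The elements of `F p n` with differential in `F (p + r)`. -/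
def Z (r p n : ℤ) : Submodule k K.A := K.F p n ⊓ (K.F (p + r) (n + 1)).comap K.D

/-- The denominator of the `r`-th page. -/
def B (r p n : ℤ) : Submodule k K.A :=
  K.Z (r - 1) (p + 1) n ⊔ (K.Z (r - 1) (p - r + 1) (n - 1)).map K.D

variable {K}

theorem mem_Z {r p n : ℤ} {x : K.A} : x ∈ K.Z r p n ↔ x ∈ K.F p n ∧ K.D x ∈ K.F (p + r) (n + 1) :=
  Iff.rfl

/-- Moves memberships along equalities of integer indices that are provable by arithmetic but do not
hold by definition. -/
theorem Z_congr {r p n r' p' n' : ℤ} (hr : r = r') (hp : p = p') (hn : n = n') {x : K.A}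
    (hx : x ∈ K.Z r p n) : x ∈ K.Z r' p' n' := by
  subst hr hp hn
  exact hx

theorem F_congr {p n p' n' : ℤ} (hp : p = p') (hn : n = n') {x : K.A}
    (hx : x ∈ K.F p n) : x ∈ K.F p' n' := by
  subst hp hn
  exact hx

theorem mem_B {r p n : ℤ} {x : K.A} : x ∈ K.B r p n ↔
    ∃ y ∈ K.Z (r - 1) (p + 1) n, ∃ z ∈ K.Z (r - 1) (p - r + 1) (n - 1), y + K.D z = x := by
  simp [B, Submodule.mem_sup]

theorem D_mem_Z {r p n p' n' : ℤ} (hp : p + r = p') (hn : n + 1 = n') {x : K.A}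
    (hx : x ∈ K.Z r p n) : K.D x ∈ K.Z r p' n' := by
  subst hp hn
  exact ⟨hx.2, by simp [K.D_D]⟩

/-- `D` kills the second summand of the denominator and sends the first one into the second summand
of the next denominator. -/
theorem D_mem_B {r p n p' n' : ℤ} (hp : p + r = p') (hn : n + 1 = n') {x : K.A}
    (hx : x ∈ K.B r p n) : K.D x ∈ K.B r p' n' := by
  obtain ⟨y, hy, z, hz, rfl⟩ := mem_B.1 hx
  subst hp hn
  rw [map_add, K.D_D, add_zero]
  exact Submodule.mem_sup_right ⟨y, Z_congr rfl (by lia) (by lia) hy, rfl⟩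

/-- The terms of the pages of the spectral sequence. -/
abbrev E (K : FilteredComplex.{u, v} k) (r p n : ℤ) := Subquotient (K.Z r p n) (K.B r p n)

/-- The differentials of the pages of the spectral sequence. -/
def dE (K : FilteredComplex.{u, v} k) (r : ℤ) {p n p' n' : ℤ} (hp : p + r = p') (hn : n + 1 = n') :
    K.E r p n →ₗ[k] K.E r p' n' :=
  Subquotient.map K.D (fun _ => D_mem_Z hp hn) (fun _ => D_mem_B hp hn)

theorem dE_dE (r : ℤ) {p n p' n' p'' n'' : ℤ} (hp : p + r = p') (hn : n + 1 = n')
    (hp' : p' + r = p'') (hn' : n' + 1 = n'') : K.dE r hp' hn' ∘ₗ K.dE r hp hn = 0 := by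
  refine LinearMap.ext fun x => ?_
  obtain ⟨x, rfl⟩ := Submodule.mkQ_surjective _ x
  refine (Subquotient.mk_eq_zero _).2 ?_
  change K.D (K.D x) ∈ _
  rw [K.D_D]
  exact Submodule.zero_mem _

/-- The `r`-th page of the spectral sequence of a filtered complex. -/
def page (K : FilteredComplex.{u, v} k) (r : ℤ) :
    HomologicalComplex (ModuleCat.{v} k) (ComplexShape.spectralSequenceNat ⟨r, 1 - r⟩) where
  X a := ModuleCat.of k (K.E r a.1 (a.1 + a.2))
  d a b := open Classical in
    if h : (ComplexShape.spectralSequenceNat ⟨r, 1 - r⟩).Rel a b then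
      ModuleCat.ofHom (K.dE r h.1 (by have := h.1; have := h.2; simp only at *; lia)) else 0
  shape a b h := dif_neg h
  d_comp_d' a b c h h' := by
    rw [dif_pos h, dif_pos h', ← ModuleCat.ofHom_comp, dE_dE]
    rfl

theorem page_d (r : ℤ) {a b : ℕ × ℕ} (h : (ComplexShape.spectralSequenceNat ⟨r, 1 - r⟩).Rel a b) :
    (K.page r).d a b =
      ModuleCat.ofHom (K.dE r h.1 (by have := h.1; have := h.2; simp only at *; lia)) :=
  dif_pos h

theorem D_eq_zero_of_lt {r p n : ℤ} {x : K.A} (h : n + 1 < p + r) (hx : x ∈ K.Z r p n) :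
    K.D x = 0 := by
  have := (mem_Z.1 hx).2
  rwa [K.high h] at this

/-- A class of `E_r` is a cycle if and only if it has a representative in `Z_{r + 1}`. -/
theorem exists_of_D_mem_B {r p n : ℤ} {x : K.A} (hx : x ∈ K.Z r p n)
    (h : K.D x ∈ K.B r (p + r) (n + 1)) : ∃ y ∈ K.Z (r + 1) p n, x - y ∈ K.B r p n := by
  obtain ⟨z, hz, w, hw, e⟩ := mem_B.1 h
  have hw' : w ∈ K.Z (r - 1) (p + 1) n := Z_congr rfl (by lia) (by lia) hw
  -- The correction `w` has filtration degree `p + 1`, so it does not change the class of `x` in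
  -- `E_r`; the boundary of `x - w` is `z`, which lies one step deeper, in `F (p + r + 1)`.
  refine ⟨x - w, mem_Z.2 ⟨Submodule.sub_mem _ hx.1 (K.anti _ (by lia) hw'.1), ?_⟩, ?_⟩
  · have : K.D (x - w) = z := by rw [map_sub, ← e]; abel
    rw [this]
    exact F_congr (by lia) rfl hz.1
  · rw [sub_sub_cancel]
    exact Submodule.mem_sup_left hw'

theorem D_mem_B_of_mem_Z_succ {r p n : ℤ} {x : K.A} (hx : x ∈ K.Z (r + 1) p n) :
    K.D x ∈ K.B r (p + r) (n + 1) :=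
  Submodule.mem_sup_left (mem_Z.2 ⟨F_congr (by lia) rfl (mem_Z.1 hx).2, by simp [K.D_D]⟩)

/-- For `x = y + D z` the new denominator asks more only of the boundary of `y`, and `D y = D x`
already satisfies it. -/
theorem mem_B_succ_of_mem_B {r p n : ℤ} {x : K.A} (hx : x ∈ K.Z (r + 1) p n) (h : x ∈ K.B r p n) :
    x ∈ K.B (r + 1) p n := by
  obtain ⟨y, hy, z, hz, e⟩ := mem_B.1 h
  refine mem_B.2 ⟨y, mem_Z.2 ⟨hy.1, ?_⟩, z,
    mem_Z.2 ⟨K.anti _ (by lia) hz.1, F_congr (by lia) rfl (mem_Z.1 hz).2⟩, e⟩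
  have : K.D y = K.D x := by rw [← e, map_add, K.D_D, add_zero]
  rw [this]
  exact F_congr (by lia) rfl (mem_Z.1 hx).2

theorem Z_succ_le {r p n : ℤ} : K.Z (r + 1) p n ≤ K.Z r p n := fun _ hx =>
  mem_Z.2 ⟨hx.1, K.anti _ (by lia) (mem_Z.1 hx).2⟩

/-- Modulo `B_r` the denominator of the next page adds exactly the boundaries of `Z_r` from
filtration degree `p - r`, that is, the image of `d_r`. Together with `exists_of_D_mem_B` this is
the identity `H(E_r) = E_{r+1}`. -/
theorem mem_B_succ {r p n : ℤ} {x : K.A} (hx : x ∈ K.Z (r + 1) p n) : x ∈ K.B (r + 1) p n ↔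
    ∃ y ∈ K.Z r (p - r) (n - 1), x - K.D y ∈ K.B r p n := by
  constructor
  · intro h
    obtain ⟨y, hy, z, hz, e⟩ := mem_B.1 h
    refine ⟨z, Z_congr (by lia) (by lia) rfl hz, ?_⟩
    rw [← e, add_sub_cancel_right]
    exact Submodule.mem_sup_left (Z_succ_le (Z_congr (by lia) rfl rfl hy))
  · rintro ⟨y, hy, h⟩
    have hD : K.D y ∈ K.Z (r + 1) p n :=
      mem_Z.2 ⟨F_congr (by lia) (by lia) (mem_Z.1 hy).2, by simp [K.D_D]⟩
    rw [← sub_add_cancel x (K.D y)]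
    exact Submodule.add_mem _ (mem_B_succ_of_mem_B (Submodule.sub_mem _ hx hD) h)
      (Submodule.mem_sup_right ⟨y, Z_congr (by lia) (by lia) rfl hy, rfl⟩)

/-- If `p < r` then no nonzero differential of `E_r` ends in filtration degree `p`. -/
theorem D_mem_B_of_lt {r p n : ℤ} (h : p < r) {z : K.A} (hz : z ∈ K.Z r (p - r) (n - 1)) :
    K.D z ∈ K.B r p n :=
  -- Since `p - r + 1 ≤ 0`, raising the filtration degree of `z` by one costs nothing: below zero
  -- the filtration is constant.
  Submodule.mem_sup_right ⟨z, mem_Z.2 ⟨K.anti _ (by lia) (K.low _ (by lia) hz.1),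
    F_congr (by lia) rfl (mem_Z.1 hz).2⟩, rfl⟩

/-! ### Cycles and boundaries of a page -/

section

variable {r : ℤ} (hr : 1 ≤ r) (a : ℕ × ℕ)
include hr

/-- If `a.2 + 1 < r`, the target of the differential lies below the first quadrant and the arrow of
the page is zero by shape; then `D x` vanishes as well, as its filtration degree exceeds its total
degree. Otherwise the target exists and only its indices need to be matched. -/
theorem page_sc_g_eq_zero (x : K.Z r a.1 (a.1 + a.2)) :
    ((K.page r).sc a).g (Submodule.Quotient.mk x : K.E r a.1 (a.1 + a.2)) = 0 ↔
      K.D x.1 ∈ K.B r (a.1 + r) (a.1 + a.2 + 1) := by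
  by_cases h : a.2 + 1 < r
  · have h0 : ((K.page r).sc a).g = 0 :=
      (K.page r).shape _ _ fun h' => by have := h'.2; simp only at this; lia
    have h1 : K.D x.1 = 0 := D_eq_zero_of_lt (by lia) x.2
    rw [h0, h1]
    exact iff_of_true rfl (Submodule.zero_mem _)
  · obtain ⟨b, hb⟩ : ∃ b : ℕ × ℕ, (ComplexShape.spectralSequenceNat ⟨r, 1 - r⟩).Rel a b :=
      ⟨⟨(a.1 + r).toNat, (a.2 + (1 - r)).toNat⟩, by constructor <;> simp only <;> lia⟩
    change (K.page r).d a _ _ = 0 ↔ _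
    rw [ComplexShape.next_eq' _ hb, page_d _ hb]
    have h1 := hb.1
    have h2 := hb.2
    simp only at h1 h2
    have e : (b.1 : ℤ) + b.2 = a.1 + a.2 + 1 := by lia
    refine (Subquotient.mk_eq_zero (Z := K.Z r b.1 (b.1 + b.2)) (B := K.B r b.1 (b.1 + b.2))
      ⟨K.D x.1, _⟩).trans ?_
    change K.D x.1 ∈ K.B r b.1 (b.1 + b.2) ↔ _
    rw [h1, e]

/-- If `a.1 < r`, the source would lie in a negative column and the arrow is zero by shape; the
boundaries on the right-hand side are then already in `B_r` by `D_mem_B_of_lt`. -/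
theorem page_sc_f_eq (x : K.Z r a.1 (a.1 + a.2)) :
    (∃ y : ((K.page r).sc a).X₁, ((K.page r).sc a).f y =
      (Submodule.Quotient.mk x : K.E r a.1 (a.1 + a.2))) ↔
      ∃ y ∈ K.Z r (a.1 - r) (a.1 + a.2 - 1), x.1 - K.D y ∈ K.B r a.1 (a.1 + a.2) := by
  by_cases h : a.1 < r
  · have h0 : ((K.page r).sc a).f = 0 :=
      (K.page r).shape _ _ fun h' => by have := h'.1; simp only at this; lia
    rw [h0]
    have h1 : (∃ y : ((K.page r).sc a).X₁, (0 : ((K.page r).sc a).X₁ ⟶ ((K.page r).sc a).X₂) y =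
        (Submodule.Quotient.mk x : K.E r a.1 (a.1 + a.2))) ↔ x.1 ∈ K.B r a.1 (a.1 + a.2) := by
      refine Iff.trans ?_ (Subquotient.mk_eq_zero x)
      exact ⟨fun ⟨_, hy⟩ => hy.symm, fun hy => ⟨0, hy.symm⟩⟩
    rw [h1]
    constructor
    · intro hx
      exact ⟨0, Submodule.zero_mem _, by simpa using hx⟩
    · rintro ⟨y, hy, hx⟩
      rw [← sub_add_cancel x.1 (K.D y)]
      exact Submodule.add_mem _ hx (D_mem_B_of_lt h hy)
  · obtain ⟨b, hb⟩ : ∃ b : ℕ × ℕ, (ComplexShape.spectralSequenceNat ⟨r, 1 - r⟩).Rel b a :=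
      ⟨⟨(a.1 - r).toNat, (a.2 - (1 - r)).toNat⟩, by constructor <;> simp only <;> lia⟩
    change (∃ y, (K.page r).d _ a y = _) ↔ _
    rw [ComplexShape.prev_eq' _ hb, page_d _ hb]
    have h1 := hb.1
    have h2 := hb.2
    simp only at h1 h2
    have e1 : (a.1 : ℤ) - r = b.1 := by lia
    have e2 : (a.1 : ℤ) + a.2 - 1 = b.1 + b.2 := by lia
    rw [e1, e2]
    constructor
    · rintro ⟨y, hy⟩
      obtain ⟨y, rfl⟩ := Submodule.mkQ_surjective _ y
      refine ⟨y.1, y.2, ?_⟩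
      exact (Subquotient.mk_eq_mk x ⟨K.D y.1, D_mem_Z hb.1 (by lia) y.2⟩).1 hy.symm
    · rintro ⟨y, hy, hx⟩
      exact ⟨Submodule.Quotient.mk ⟨y, hy⟩,
        ((Subquotient.mk_eq_mk x ⟨K.D y, D_mem_Z hb.1 (by lia) hy⟩).2 hx).symm⟩

end

/-- The homology of the `r`-th page is the next page. -/
def pageIso (r r' : ℤ) (a : ℕ × ℕ) (h : r + 1 = r') (hr : 1 ≤ r) :
    (K.page r).homology a ≅ (K.page r').X a := by
  subst h
  -- Both sides are quotients of `Z_{r+1}`: it maps onto the homology of `E_r` by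
  -- `exists_of_D_mem_B`, and the two kernels agree by `mem_B_succ`.
  refine homologyIsoOfRepresentatives ((K.page r).sc a)
    (P := K.Z (r + 1) a.1 (a.1 + a.2)) (H := K.E (r + 1) a.1 (a.1 + a.2))
    (Submodule.mkQ _ ∘ₗ Submodule.inclusion Z_succ_le) (Submodule.mkQ _)
    (Submodule.mkQ_surjective _) (fun x => ?_) (fun x hx => ?_) (fun x => ?_)
  · exact (page_sc_g_eq_zero hr a (Submodule.inclusion Z_succ_le x)).2 (D_mem_B_of_mem_Z_succ x.2)
  · obtain ⟨x, rfl⟩ := Submodule.mkQ_surjective _ x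
    obtain ⟨y, hy, h⟩ := exists_of_D_mem_B x.2 ((page_sc_g_eq_zero hr a x).1 hx)
    refine ⟨⟨y, hy⟩, 0, ?_⟩
    rw [map_zero, add_zero]
    exact (Submodule.Quotient.eq _).2 h
  · refine (Subquotient.mk_eq_zero x).trans ((mem_B_succ x.2).trans ?_)
    exact (page_sc_f_eq hr a (Submodule.inclusion Z_succ_le x)).symm

variable (K) in
/-- The spectral sequence of a bounded filtered complex. -/
def spectralSequence : CohomologicalSpectralSequenceNat (ModuleCat.{v} k) 1 where
  page r _ := K.page r
  iso r r' a h hr := pageIso r r' a h hr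

end FilteredComplex

/-! ### Convergence of the spectral sequence of a bounded filtered complex -/

namespace FilteredComplex

variable (K : FilteredComplex.{u, v} k)

/-- The spectral sequence of a bounded filtered complex converges to its cohomology. -/
theorem convergesTo (H : ℕ → ModuleCat.{v} k)
    (q : ∀ n : ℕ, (K.F 0 n ⊓ LinearMap.ker K.D : Submodule k K.A) →ₗ[k] H n)
    (hq : ∀ n, Function.Surjective (q n))
    (hk : ∀ n x, q n x = 0 ↔ ∃ z ∈ K.F 0 (n - 1), K.D z = x.1) :
    ConvergesTo K.spectralSequence H := by
  intro n
  -- The filtration on cohomology consists of the classes which have a cocycle representative in `F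
  -- p`.
  let L : ℕ → Submodule k (H n) := fun p =>
    ((K.F p n).comap (Submodule.subtype (K.F 0 n ⊓ LinearMap.ker K.D))).map (q n)
  refine ⟨L, fun p p' h => Submodule.map_mono (Submodule.comap_mono (K.anti _ (by lia))), ?_, ?_,
    ?_⟩
  · refine eq_top_iff.2 fun y _ => ?_
    obtain ⟨x, rfl⟩ := hq n y
    exact ⟨x, x.2.1, rfl⟩
  · refine eq_bot_iff.2 ?_
    rintro _ ⟨x, hx, rfl⟩
    have h : x.1 ∈ K.F ((n + 1 : ℕ) : ℤ) n := hx
    rw [K.high (by lia)] at h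
    have h' : x = 0 := Subtype.ext h
    rw [h', map_zero]
    exact Submodule.zero_mem _
  · intro p j hn r hr
    -- As `r ≥ p + j + 2`, the boundary of an element of `Z_r` has filtration degree above its total
    -- degree, so `Z_r` consists of genuine cocycles.
    have hZ : ∀ x : K.Z r p (p + j), x.1 ∈ (K.F 0 n ⊓ LinearMap.ker K.D : Submodule k K.A) := by
      intro x
      have h := F_congr rfl (by lia : (p : ℤ) + j = n) (mem_Z.1 x.2).1
      exact ⟨K.anti _ (by lia) h, D_eq_zero_of_lt (by lia) x.2⟩
    refine ⟨LinearEquiv.toModuleIso (Subquotient.equiv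
      ((q n) ∘ₗ (K.Z r p (p + j)).subtype.codRestrict _ hZ) (fun x => ?_) (fun x => ?_)
      fun y hy => ?_)⟩
    · exact ⟨⟨x.1, hZ x⟩, F_congr rfl (by lia : (p : ℤ) + j = n) (mem_Z.1 x.2).1, rfl⟩
    · constructor
      · rintro ⟨y, hy, e⟩
        have e' : q n (⟨x.1, hZ x⟩ - y) = 0 := by rw [map_sub, e]; exact sub_self _
        obtain ⟨z, hz, e''⟩ := (hk n _).1 e'
        have e3 : K.D z = x.1 - y.1 := e''
        have hy' : y.1 ∈ K.F (p + 1) (p + j) :=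
          F_congr (by lia) (by lia : (n : ℤ) = p + j) (show y.1 ∈ K.F ((p + 1 : ℕ) : ℤ) n from hy)
        -- Here `p - r + 1 ≤ 0`, so the filtration imposes no condition on `z` beyond `z ∈ F 0`:
        -- every coboundary in `F p` counts in `B_r`.
        refine mem_B.2 ⟨y.1, mem_Z.2 ⟨hy', ?_⟩, z, mem_Z.2 ⟨?_, ?_⟩, by rw [e3]; abel⟩
        · rw [show K.D y.1 = 0 from y.2.2]
          exact Submodule.zero_mem _
        · exact K.anti _ (by lia) (F_congr rfl (by lia) hz)
        · rw [e3]
          exact F_congr (by lia) (by lia : (p : ℤ) + j = _)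
            (Submodule.sub_mem _ x.2.1 (K.anti _ (by lia) hy'))
      · intro hx
        obtain ⟨y, hy, z, hz, e⟩ := mem_B.1 hx
        have hyD : K.D y = 0 := D_eq_zero_of_lt (by lia) hy
        have hy' : y ∈ K.F ((p + 1 : ℕ) : ℤ) n := F_congr (by lia) (by lia) hy.1
        have hy0 : y ∈ (K.F 0 n ⊓ LinearMap.ker K.D : Submodule k K.A) :=
          ⟨K.anti _ (by lia) hy', hyD⟩
        refine ⟨⟨y, hy0⟩, hy', ?_⟩
        change _ = q n ⟨x.1, hZ x⟩
        rw [← sub_eq_zero, ← map_sub, hk]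
        refine ⟨-z, Submodule.neg_mem _ (F_congr rfl (by lia) (K.low _ (by lia) hz.1)), ?_⟩
        rw [map_neg]
        change _ = y - x.1
        rw [← e]; abel
    · obtain ⟨x, hx, rfl⟩ := hy
      have hx' : x.1 ∈ K.F p (p + j) :=
        F_congr rfl (by lia : (n : ℤ) = _) (show x.1 ∈ K.F p n from hx)
      refine ⟨⟨x.1, mem_Z.2 ⟨hx', ?_⟩⟩, ?_⟩
      · rw [show K.D x.1 = 0 from x.2.2]
        exact Submodule.zero_mem _
      · change q n x - q n x ∈ _
        rw [sub_self]
        exact Submodule.zero_mem _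

end FilteredComplex

/-! ### Cohomology of a sequence of linear maps -/

section Coh

variable {X : ℕ → Type v} [∀ n, AddCommGroup (X n)] [∀ n, Module k (X n)]

/-- The coboundaries of a sequence of linear maps. -/
def coboundaries (d : ∀ n, X n →ₗ[k] X (n + 1)) : ∀ n, Submodule k (X n)
  | 0 => ⊥
  | n + 1 => LinearMap.range (d n)

/-- The cohomology of a sequence of linear maps. -/
abbrev Coh (d : ∀ n, X n →ₗ[k] X (n + 1)) (n : ℕ) := Subquotient (LinearMap.ker (d n))
  (coboundaries d n)

/-- The cohomology of a cochain complex of vector spaces. -/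
def homologyIsoCoh (d : ∀ n, X n →ₗ[k] X (n + 1)) (h : ∀ n, ModuleCat.ofHom (d n) ≫
    ModuleCat.ofHom (d (n + 1)) = 0) (n : ℕ) :
    (CochainComplex.of (fun n => ModuleCat.of k (X n)) (fun n => ModuleCat.ofHom (d n)) h).homology
      n ≅ ModuleCat.of k (Coh d n) := by
  have hg : ∀ x : X n, ((CochainComplex.of (fun n => ModuleCat.of k (X n))
      (fun n => ModuleCat.ofHom (d n)) h).sc n).g x = 0 ↔ d n x = 0 := by
    intro x
    change (CochainComplex.of (fun n => ModuleCat.of k (X n))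
      (fun n => ModuleCat.ofHom (d n)) h).d n _ x = 0 ↔ _
    rw [CochainComplex.next]
    change CochainComplex.of.d (fun n => ModuleCat.of k (X n)) (fun n => ModuleCat.ofHom (d n))
      n (n + 1) x = 0 ↔ _
    rw [CochainComplex.of_d]
    rfl
  have hf : ∀ x : X n, (∃ y : ((CochainComplex.of (fun n => ModuleCat.of k (X n))
      (fun n => ModuleCat.ofHom (d n)) h).sc n).X₁, ((CochainComplex.of (fun n => ModuleCat.of k
      (X n)) (fun n => ModuleCat.ofHom (d n)) h).sc n).f y = x) ↔ x ∈ coboundaries d n := by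
    intro x
    change (∃ y : _, (CochainComplex.of (fun n => ModuleCat.of k (X n))
      (fun n => ModuleCat.ofHom (d n)) h).d _ n y = x) ↔ _
    cases n with
    | zero =>
      have h0 : (CochainComplex.of (fun n => ModuleCat.of k (X n))
          (fun n => ModuleCat.ofHom (d n)) h).d ((ComplexShape.up ℕ).prev 0) 0 = 0 :=
        HomologicalComplex.shape _ _ _ (by simp)
      rw [h0]
      exact ⟨fun ⟨_, hy⟩ => hy.symm, fun hy => ⟨0, hy.symm⟩⟩
    | succ n =>
      rw [CochainComplex.prev_nat_succ]
      change (∃ y : X n, CochainComplex.of.d (fun n => ModuleCat.of k (X n))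
        (fun n => ModuleCat.ofHom (d n)) n (n + 1) y = x) ↔ _
      rw [CochainComplex.of_d]
      rfl
  refine homologyIsoOfRepresentatives _ (P := LinearMap.ker (d n)) (H := Coh d n)
    (Submodule.subtype _) (Submodule.mkQ _) (Submodule.mkQ_surjective _) (fun x => (hg _).2 x.2)
    (fun x hx => ⟨⟨x, (hg x).1 hx⟩, 0, ?_⟩) (fun x => ?_)
  · rw [map_zero, add_zero]; rfl
  · exact (Subquotient.mk_eq_zero x).trans (hf _).symm

end Coh

/-! ### Double complexes -/

/-- A first quadrant double complex with anticommuting differentials. -/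
structure DoubleComplex (k : Type u) [Field k] where
  /-- the terms -/
  X : ℕ → ℕ → Type v
  [addCommGroup : ∀ i j, AddCommGroup (X i j)]
  [module : ∀ i j, Module k (X i j)]
  /-- the horizontal differential -/
  dh : ∀ i j, X i j →ₗ[k] X (i + 1) j
  /-- the vertical differential -/
  dv : ∀ i j, X i j →ₗ[k] X i (j + 1)
  dh_dh : ∀ i j x, dh (i + 1) j (dh i j x) = 0
  dv_dv : ∀ i j x, dv i (j + 1) (dv i j x) = 0
  dh_dv : ∀ i j x, dh i (j + 1) (dv i j x) + dv (i + 1) j (dh i j x) = 0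

namespace DoubleComplex

attribute [instance] DoubleComplex.addCommGroup DoubleComplex.module

variable (K : DoubleComplex.{u, v} k)

/-- The transposed double complex. -/
abbrev swap : DoubleComplex.{u, v} k where
  X i j := K.X j i
  dh i j := K.dv j i
  dv i j := K.dh j i
  dh_dh i j := K.dv_dv j i
  dv_dv i j := K.dh_dh j i
  dh_dv i j x := (add_comm _ _).trans (K.dh_dv j i x)

/-- The horizontal differential on all families of elements. -/
def totH : (∀ i j, K.X i j) →ₗ[k] ∀ i j, K.X i j where
  toFun f i j := match i with
    | 0 => 0
    | i + 1 => K.dh i j (f i j)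
  map_add' f g := by ext i j; cases i <;> simp
  map_smul' c f := by ext i j; cases i <;> simp

/-- The vertical differential on all families of elements. -/
def totV : (∀ i j, K.X i j) →ₗ[k] ∀ i j, K.X i j where
  toFun f i j := match j with
    | 0 => 0
    | j + 1 => K.dv i j (f i j)
  map_add' f g := by ext i j; cases j <;> simp
  map_smul' c f := by ext i j; cases j <;> simp

variable {K}

@[simp] theorem totH_zero (f : ∀ i j, K.X i j) (j : ℕ) : K.totH f 0 j = 0 := rfl

@[simp] theorem totH_succ (f : ∀ i j, K.X i j) (i j : ℕ) :
    K.totH f (i + 1) j = K.dh i j (f i j) := rfl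

@[simp] theorem totV_zero (f : ∀ i j, K.X i j) (i : ℕ) : K.totV f i 0 = 0 := rfl

@[simp] theorem totV_succ (f : ∀ i j, K.X i j) (i j : ℕ) :
    K.totV f i (j + 1) = K.dv i j (f i j) := rfl

theorem totH_eq_zero {f : ∀ i j, K.X i j} {i j : ℕ} (h : ∀ i', i' + 1 = i → f i' j = 0) :
    K.totH f i j = 0 := by
  cases i with
  | zero => rfl
  | succ i => rw [totH_succ, h i rfl, map_zero]

theorem totV_eq_zero {f : ∀ i j, K.X i j} {i j : ℕ} (h : ∀ j', j' + 1 = j → f i j' = 0) :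
    K.totV f i j = 0 := by
  cases j with
  | zero => rfl
  | succ j => rw [totV_succ, h j rfl, map_zero]

variable (K)

/-- The differential of the total complex. -/
def totD : (∀ i j, K.X i j) →ₗ[k] ∀ i j, K.X i j := K.totH + K.totV

variable {K}

theorem totD_apply (f : ∀ i j, K.X i j) (i j : ℕ) :
    K.totD f i j = K.totH f i j + K.totV f i j := rfl

theorem totD_totD (f : ∀ i j, K.X i j) : K.totD (K.totD f) = 0 := by
  have h1 : K.totH (K.totH f) = 0 := by
    ext i j
    rcases i with _ | _ | i <;> simp [K.dh_dh]
  have h2 : K.totV (K.totV f) = 0 := by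
    ext i j
    rcases j with _ | _ | j <;> simp [K.dv_dv]
  have h3 : K.totH (K.totV f) + K.totV (K.totH f) = 0 := by
    ext i j
    rcases i with _ | i <;> rcases j with _ | j <;> simp [K.dh_dv]
  simp only [totD, LinearMap.add_apply, map_add, h1, h2]
  rw [zero_add, add_zero, add_comm]
  exact h3

/-- The elements of total degree `n` supported in the columns `i ≥ p`. -/
def totF (K : DoubleComplex.{u, v} k) (p n : ℤ) : Submodule k (∀ i j, K.X i j) where
  carrier := {f | ∀ i j : ℕ, ¬(p ≤ i ∧ (i : ℤ) + j = n) → f i j = 0}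
  add_mem' hf hg i j h := by simp [hf i j h, hg i j h]
  zero_mem' _ _ _ := rfl
  smul_mem' c f hf i j h := by simp [hf i j h]

theorem mem_totF {p n : ℤ} {f : ∀ i j, K.X i j} :
    f ∈ K.totF p n ↔ ∀ i j : ℕ, ¬(p ≤ i ∧ (i : ℤ) + j = n) → f i j = 0 := Iff.rfl

theorem totD_mem {p n : ℤ} {f : ∀ i j, K.X i j} (hf : f ∈ K.totF p n) :
    K.totD f ∈ K.totF p (n + 1) := by
  rw [mem_totF] at hf ⊢
  intro i j h
  rw [totD_apply, totH_eq_zero, totV_eq_zero, add_zero]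
  · exact fun j' h' => hf _ _ (by lia)
  · exact fun j' h' => hf _ _ (by lia)

variable (K) in
/-- The total complex filtered by columns. -/
abbrev filtered : FilteredComplex.{u, v} k where
  -- The ambient space is the full product without grading. Degrees are recovered by `totF`, whose
  -- elements have finite support because `i + j = n` in the first quadrant.
  A := ∀ i j, K.X i j
  D := K.totD
  F := K.totF
  D_D := totD_totD
  D_mem := totD_mem
  anti n h f hf i j h' := hf i j (by lia)
  low n h f hf i j h' := hf i j (by lia)
  high h := eq_bot_iff.2 fun f hf => by
    ext i j
    exact hf i j (by lia)

variable (K) in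
/-- A family with a single nonzero element. -/
def single (i j : ℕ) : K.X i j →ₗ[k] ∀ i j, K.X i j :=
  LinearMap.single k (fun i => ∀ j, K.X i j) i ∘ₗ LinearMap.single k (K.X i) j

@[simp] theorem single_same (i j : ℕ) (x : K.X i j) : K.single i j x i j = x := by
  simp [single]

theorem single_ne {i j i' j' : ℕ} (x : K.X i j) (h : ¬(i' = i ∧ j' = j)) :
    K.single i j x i' j' = 0 := by
  by_cases hi : i' = i
  · subst hi
    have hj : j' ≠ j := by lia
    simp [single, hj]
  · simp [single, hi]

theorem single_mem {i j : ℕ} {p n : ℤ} (hp : p ≤ i) (hn : (i : ℤ) + j = n) (x : K.X i j) :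
    K.single i j x ∈ K.totF p n := fun _ _ h => single_ne x (by lia)

/-- The first page of the spectral sequence of a double complex is the vertical cohomology. -/
def firstPageEquiv (p q : ℕ) : K.filtered.E 1 p (p + q) ≃ₗ[k] Coh (K.dv p) q := by
  have hZ : ∀ {n p' : ℤ} {x : ∀ i j, K.X i j}, x ∈ K.filtered.Z (1 - 1) p' n ↔
      x ∈ K.totF p' n := by
    intro n p' x
    refine ⟨fun h => h.1, fun h => FilteredComplex.mem_Z.2 ⟨h, ?_⟩⟩
    exact FilteredComplex.F_congr (by lia) rfl (totD_mem h)
  -- An element of `F p` has nothing to the left of column `p`, so in column `p` its total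
  -- differential is purely vertical.
  have hH : ∀ {n : ℤ} {x : ∀ i j, K.X i j}, x ∈ K.totF p n → ∀ j, K.totH x p j = 0 :=
    fun hx j => totH_eq_zero fun i' hi' => hx _ _ (by lia)
  refine Subquotient.equiv (((LinearMap.proj q : (∀ j, K.X p j) →ₗ[k] K.X p q) ∘ₗ
    (LinearMap.proj p : (∀ i j, K.X i j) →ₗ[k] ∀ j, K.X p j)) ∘ₗ
      (K.filtered.Z 1 p (p + q)).subtype) (fun x => ?_) (fun x => ?_) (fun y hy => ?_)
  · have h : K.totD x.1 p (q + 1) = 0 := x.2.2 p (q + 1) (by lia)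
    rw [totD_apply, hH x.2.1, zero_add] at h
    exact h
  · change x.1 p q ∈ _ ↔ _
    constructor
    · intro h
      have h' : ∃ z ∈ K.totF p (p + q - 1), K.totD z p q = x.1 p q := by
        cases q with
        | zero =>
          refine ⟨0, Submodule.zero_mem _, ?_⟩
          have h' : x.1 p 0 = 0 := h
          rw [map_zero, h']
          rfl
        | succ q =>
          obtain ⟨z, hz⟩ := h
          have hm : K.single p q z ∈ K.totF p (p + (q + 1 : ℕ) - 1) :=
            single_mem le_rfl (by lia) z
          refine ⟨K.single p q z, hm, ?_⟩
          rw [totD_apply, hH hm, zero_add, totV_succ, single_same, hz]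
      obtain ⟨z, hz, h'⟩ := h'
      -- Subtracting `D z` clears the entry at `(p, q)`, the only one in column `p`, and leaves an
      -- element of `F (p + 1)`.
      refine FilteredComplex.mem_B.2 ⟨x.1 - K.totD z, hZ.2 ?_, z, hZ.2 ?_, sub_add_cancel _ _⟩
      · intro i j hij
        by_cases hi : i = p ∧ j = q
        · obtain ⟨rfl, rfl⟩ := hi
          exact sub_eq_zero.2 h'.symm
        · have h1 : x.1 i j = 0 := x.2.1 i j (by lia)
          have h2 : K.totD z i j = 0 := totD_mem hz i j (by lia)
          change x.1 i j - K.totD z i j = 0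
          rw [h1, h2, sub_zero]
      · exact FilteredComplex.F_congr (K := K.filtered) (by lia) rfl hz
    · intro h
      obtain ⟨y, hy, z, hz, e⟩ := FilteredComplex.mem_B.1 h
      have hz' : z ∈ K.totF p (p + q - 1) :=
        FilteredComplex.F_congr (K := K.filtered) (by lia) rfl (hZ.1 hz)
      have h1 : x.1 p q = y p q + K.totD z p q := by rw [← e]; rfl
      rw [h1, hZ.1 hy p q (by lia), zero_add, totD_apply, hH hz', zero_add]
      cases q with
      | zero => exact Submodule.zero_mem _
      | succ q => exact ⟨z p q, rfl⟩
  · refine ⟨⟨K.single p q y, FilteredComplex.mem_Z.2 ⟨single_mem le_rfl rfl y, ?_⟩⟩, ?_⟩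
    · intro i j hij
      have h0 : K.single p q y ∈ K.totF p (p + q) := single_mem le_rfl rfl y
      by_cases hi : i = p ∧ j = q + 1
      · obtain ⟨rfl, rfl⟩ := hi
        change K.totD _ _ _ = 0
        rw [totD_apply, hH h0, totV_succ, single_same, zero_add]
        exact hy
      · exact totD_mem h0 i j (by lia)
    · change y - K.single p q y p q ∈ _
      rw [single_same, sub_self]
      exact Submodule.zero_mem _

/-- The cocycles of the total complex. -/
abbrev totCycles (K : DoubleComplex.{u, v} k) (n : ℤ) : Submodule k (∀ i j, K.X i j) :=
  K.totF 0 n ⊓ LinearMap.ker K.totD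

/-- The coboundaries of the total complex. -/
abbrev totBoundaries (K : DoubleComplex.{u, v} k) (n : ℤ) : Submodule k (∀ i j, K.X i j) :=
  (K.totF 0 (n - 1)).map K.totD

/-! ### Double complexes with exact augmented rows -/

section Augmented

/-- If the rows are exact, an element of the total complex whose differential is supported in the
first two columns can be moved into the first column by a coboundary. -/
theorem exists_sub_totD (hK : ∀ i j x, K.dh (i + 1) j x = 0 → ∃ y, K.dh i j y = x) (m : ℕ) {n : ℤ}
    (f : ∀ i j, K.X i j) (hf : f ∈ K.totF 0 n) (hm : ∀ i j, m < i → f i j = 0)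
    (hD : ∀ i j, K.totD f (i + 2) j = 0) :
    ∃ g ∈ K.totF 0 (n - 1), ∀ i j, (f - K.totD g) (i + 1) j = 0 := by
  induction m generalizing f with
  | zero => exact ⟨0, Submodule.zero_mem _, fun i j => by simp [hm (i + 1) j (by lia)]⟩
  | succ m ih =>
    -- In the last nonzero column `m + 1` the entries of `f` are horizontal cocycles, since the
    -- entries of `D f` in column `m + 2` receive nothing else. Exactness gives preimages in column
    -- `m`, taken to be zero outside total degree `n - 1` so that the resulting family is
    -- homogeneous; subtracting its total boundary empties column `m + 1`.
    have h1 : ∀ j : ℕ, ∃ y, K.dh m j y = f (m + 1) j ∧ ((m : ℤ) + 1 + j ≠ n → y = 0) := by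
      intro j
      by_cases hj : (m : ℤ) + 1 + j = n
      · have h2 := hD m j
        rw [totD_apply, totH_succ, totV_eq_zero (fun j' _ => hm _ _ (by lia)), add_zero] at h2
        obtain ⟨y, hy⟩ := hK _ _ _ h2
        exact ⟨y, hy, fun h => absurd hj h⟩
      · exact ⟨0, by rw [map_zero, hf _ _ (by lia)], fun _ => rfl⟩
    choose y hy hy0 using h1
    let g : ∀ i j, K.X i j := Pi.single (M := fun i => ∀ j, K.X i j) m y
    have hgm : g m = y := Pi.single_eq_same (M := fun i => ∀ j, K.X i j) m y
    have hgn : ∀ i, i ≠ m → g i = 0 := fun i hi =>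
      Pi.single_eq_of_ne (M := fun i => ∀ j, K.X i j) hi y
    have hg : g ∈ K.totF 0 (n - 1) := by
      intro i j hij
      by_cases hi : i = m
      · subst hi
        rw [hgm]
        exact hy0 j (by lia)
      · rw [hgn i hi]; rfl
    have hDg : K.totD g ∈ K.totF 0 n :=
      FilteredComplex.F_congr (K := K.filtered) rfl (by lia) (totD_mem hg)
    obtain ⟨g', hg', h'⟩ := ih (f - K.totD g) (Submodule.sub_mem _ hf hDg) (by
        intro i j hi
        change f i j - K.totD g i j = 0
        rw [totD_apply, totV_eq_zero (fun j' _ => by rw [hgn i (by lia)]; rfl), add_zero]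
        by_cases hi' : i = m + 1
        · subst hi'
          rw [totH_succ, hgm, hy, sub_self]
        · rw [hm i j (by lia), totH_eq_zero (fun i' _ => by rw [hgn i' (by lia)]; rfl),
            sub_zero]) (by
        intro i j
        rw [map_sub, totD_totD, sub_zero, hD])
    refine ⟨g + g', Submodule.add_mem _ hg hg', fun i j => ?_⟩
    rw [map_add, ← sub_sub]
    exact h' i j

variable {A : ℕ → Type v} [∀ n, AddCommGroup (A n)] [∀ n, Module k (A n)]
  (d : ∀ n, A n →ₗ[k] A (n + 1)) (ε : ∀ n, A n →ₗ[k] K.X 0 n)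

/-- The cohomology of the total complex of a double complex with exact rows is that of the complex
which augments the rows. -/
def totEquiv (hK : ∀ i j x, K.dh (i + 1) j x = 0 → ∃ y, K.dh i j y = x)
    (hε : ∀ n, Function.Injective (ε n)) (hε' : ∀ n x, K.dh 0 n x = 0 ↔ ∃ a, ε n a = x)
    (hd : ∀ n a, K.dv 0 n (ε n a) = ε (n + 1) (d n a)) (n : ℕ) :
    Coh d n ≃ₗ[k] Subquotient (K.totCycles n) (K.totBoundaries n) := by
  have hexists : ∀ {n : ℤ} (f : ∀ i j, K.X i j), f ∈ K.totF 0 n →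
      (∀ i j, K.totD f (i + 2) j = 0) →
      ∃ g ∈ K.totF 0 (n - 1), ∀ i j, (f - K.totD g) (i + 1) j = 0 := fun {n} f hf h =>
    exists_sub_totD hK n.toNat f hf (fun i j _ => hf i j (by lia)) h
  -- The augmentation lands in the horizontal cocycles, so on its image in column `0` the total
  -- differential reduces to `d`.
  have hDs : ∀ (m i j : ℕ) (a : A m), K.totD (K.single 0 m (ε m a)) i j =
      K.single 0 (m + 1) (ε (m + 1) (d m a)) i j := by
    intro m i j a
    rw [← hd]
    rcases i with _ | i
    · rw [totD_apply, totH_zero, zero_add]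
      by_cases hj : j = m + 1
      · subst hj
        simp
      · rw [single_ne _ (by lia), totV_eq_zero fun j' _ => single_ne _ (by lia)]
    · rw [single_ne _ (by lia), totD_apply, totV_eq_zero (fun _ _ => single_ne _ (by lia)),
        add_zero, totH_succ]
      by_cases hj : i = 0 ∧ j = m
      · obtain ⟨rfl, rfl⟩ := hj
        rw [single_same]
        exact (hε' _ _).2 ⟨a, rfl⟩
      · rw [single_ne _ hj, map_zero]
  refine Subquotient.equiv (((K.single 0 n) ∘ₗ ε n) ∘ₗ (LinearMap.ker (d n)).subtype)
    (fun x => ⟨single_mem (by lia) (by lia) _, ?_⟩) (fun x => ?_) (fun y hy => ?_)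
  · have hx : d n x.1 = 0 := x.2
    change K.totD (K.single 0 n (ε n x.1)) = 0
    ext i j
    rw [hDs, hx, map_zero, map_zero]
  · change K.single 0 n (ε n x.1) ∈ _ ↔ _
    constructor
    · rintro ⟨z, hz, hzx⟩
      have hz2 : ∀ i j, K.totD z (i + 2) j = 0 := fun i j => by
        rw [hzx, single_ne _ (by lia)]
      -- The primitive `z` may be moved into column `0`. The vanishing of its boundary in column `1`
      -- then puts it in the image of the augmentation, and it gives a primitive of `x` for `d`.
      obtain ⟨g, hg, hzg⟩ := hexists z hz hz2
      have hDz : K.totD (z - K.totD g) = K.single 0 n (ε n x.1) := by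
        rw [map_sub, totD_totD, sub_zero, hzx]
      have hz' : z - K.totD g ∈ K.totF 0 (n - 1) := Submodule.sub_mem _ hz
        (FilteredComplex.F_congr (K := K.filtered) rfl (by lia) (totD_mem hg))
      generalize z - K.totD g = w at hDz hz' hzg
      cases n with
      | zero =>
        have hw : w = 0 := by
          ext i j
          exact hz' i j (by lia)
        have h0 := congrFun (congrFun hDz 0) 0
        rw [hw, map_zero, single_same] at h0
        exact hε 0 (h0.symm.trans (map_zero _).symm)
      | succ n =>
        have h1 := congrFun (congrFun hDz 1) n
        rw [single_ne _ (by lia), totD_apply, totH_succ,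
          totV_eq_zero (fun j' _ => hzg 0 j'), add_zero] at h1
        obtain ⟨b, hb⟩ := (hε' _ _).1 h1
        have h2 := congrFun (congrFun hDz 0) (n + 1)
        rw [single_same, totD_apply, totH_zero, zero_add, totV_succ, ← hb, hd] at h2
        exact ⟨b, hε _ h2⟩
    · intro hx
      cases n with
      | zero =>
        have hx' : x.1 = 0 := hx
        rw [hx', map_zero, map_zero]
        exact Submodule.zero_mem _
      | succ n =>
        obtain ⟨b, hb⟩ := hx
        refine ⟨K.single 0 n (ε n b), single_mem (by lia) (by lia) _, ?_⟩
        ext i j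
        rw [hDs, hb]
  · obtain ⟨hy, hDy⟩ := hy
    have hDy : K.totD y = 0 := hDy
    -- A total cocycle is cohomologous to one concentrated in column `0`; the entries of its
    -- boundary at `(1, n)` and `(0, n + 1)` say that it comes from some `a` and that `d a = 0`.
    obtain ⟨g, hg, hyg⟩ := hexists y hy (fun i j => by rw [hDy]; rfl)
    have hDw : K.totD (y - K.totD g) = 0 := by
      rw [map_sub, totD_totD, sub_zero, hDy]
    have hw : y - K.totD g ∈ K.totF 0 n := Submodule.sub_mem _ hy
      (FilteredComplex.F_congr (K := K.filtered) rfl (by lia) (totD_mem hg))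
    have hyw : y - (y - K.totD g) = K.totD g := sub_sub_cancel _ _
    generalize y - K.totD g = w at hDw hw hyg hyw
    have h1 := congrFun (congrFun hDw 1) n
    rw [totD_apply, totH_succ, totV_eq_zero (fun j' _ => hyg 0 j'), add_zero] at h1
    obtain ⟨a, ha⟩ := (hε' _ _).1 h1
    have h2 := congrFun (congrFun hDw 0) (n + 1)
    rw [totD_apply, totH_zero, zero_add, totV_succ, ← ha, hd] at h2
    refine ⟨⟨a, hε _ (h2.trans (map_zero _).symm)⟩, g, hg, ?_⟩
    change _ = y - K.single 0 n (ε n a)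
    rw [← hyw, ha]
    congr 1
    ext i j
    rcases i with _ | i
    · by_cases hj : j = n
      · subst hj
        rw [single_same]
      · rw [single_ne _ (by lia), hw _ _ (by lia)]
    · rw [single_ne _ (by lia), hyg]

end Augmented

variable (K) in
/-- The total complexes of a double complex and its transpose have the same cohomology. -/
def totSwapEquiv (n : ℤ) : Subquotient (K.totCycles n) (K.totBoundaries n) ≃ₗ[k]
    Subquotient (K.swap.totCycles n) (K.swap.totBoundaries n) := by
  have hD : ∀ (f : ∀ i j, K.X i j) (i j : ℕ),
      K.swap.totD (fun i j => f j i) i j = K.totD f j i := by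
    intro f i j
    rw [totD_apply, totD_apply, add_comm]
    rcases i with _ | i <;> rcases j with _ | j <;> rfl
  have hF : ∀ {n : ℤ} {f : ∀ i j, K.X i j}, f ∈ K.totF 0 n →
      (fun i j => f j i : ∀ i j, K.swap.X i j) ∈ K.swap.totF 0 n :=
    fun hf i j h => hf j i (by lia)
  have hF' : ∀ {n : ℤ} {f : ∀ i j, K.swap.X i j}, f ∈ K.swap.totF 0 n →
      (fun i j => f j i : ∀ i j, K.X i j) ∈ K.totF 0 n :=
    fun hf i j h => hf j i (by lia)
  let t : (∀ i j, K.X i j) →ₗ[k] ∀ i j, K.swap.X i j :=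
    { toFun := fun f i j => f j i
      map_add' := fun _ _ => rfl
      map_smul' := fun _ _ => rfl }
  refine Subquotient.equiv (t ∘ₗ (K.totCycles n).subtype) (fun x => ⟨hF x.2.1, ?_⟩) (fun x => ?_)
    (fun y hy => ?_)
  · change K.swap.totD (fun i j => x.1 j i) = 0
    ext i j
    rw [hD, show K.totD x.1 = 0 from x.2.2]
    rfl
  · constructor
    · rintro ⟨z, hz, e⟩
      refine ⟨fun i j => z j i, hF' hz, ?_⟩
      ext i j
      rw [← hD]
      exact congrFun (congrFun e j) i
    · rintro ⟨z, hz, e⟩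
      refine ⟨fun i j => z j i, hF hz, ?_⟩
      ext i j
      rw [hD, e]
      rfl
  · refine ⟨⟨fun i j => y j i, hF' hy.1, ?_⟩, ?_⟩
    · change K.totD (fun i j => y j i) = 0
      ext i j
      rw [← hD]
      exact congrFun (congrFun hy.2 j) i
    · have : y - (t ∘ₗ (K.totCycles n).subtype) ⟨fun i j => y j i, ⟨hF' hy.1, by
          change K.totD (fun i j => y j i) = 0
          ext i j
          rw [← hD]
          exact congrFun (congrFun hy.2 j) i⟩⟩ = 0 := by
        ext i j
        exact sub_self (y i j)
      rw [this]
      exact Submodule.zero_mem _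

end DoubleComplex

variable {C : Type v} [AddCommGroup C] [Module k C] [Coalgebra k C]
variable {D : Type v} [AddCommGroup D] [Module k D] [Coalgebra k D]

/-! ### Homomorphisms of bicomodules -/

namespace Bicomodule

/-- A linear map which is a homomorphism of bicomodules. -/
structure IsHom (M N : Bicomodule k C) (f : M.carrier →ₗ[k] N.carrier) : Prop where
  left : N.left ∘ₗ f = f.lTensor C ∘ₗ M.left
  right : N.right ∘ₗ f = f.rTensor C ∘ₗ M.right

theorem IsHom.id (M : Bicomodule k C) : IsHom M M LinearMap.id := by
  constructor <;> simp

theorem IsHom.comp {M N P : Bicomodule k C} {f : M.carrier →ₗ[k] N.carrier}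
    {g : N.carrier →ₗ[k] P.carrier} (hg : IsHom N P g) (hf : IsHom M N f) :
    IsHom M P (g ∘ₗ f) := by
  constructor
  · rw [← LinearMap.comp_assoc, hg.left, LinearMap.comp_assoc, hf.left, LinearMap.lTensor_comp,
      LinearMap.comp_assoc]
  · rw [← LinearMap.comp_assoc, hg.right, LinearMap.comp_assoc, hf.right, LinearMap.rTensor_comp,
      LinearMap.comp_assoc]

theorem IsHom.add {M N : Bicomodule k C} {f g : M.carrier →ₗ[k] N.carrier}
    (hf : IsHom M N f) (hg : IsHom M N g) : IsHom M N (f + g) := by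
  constructor
  · rw [LinearMap.comp_add, hf.left, hg.left, LinearMap.lTensor_add, LinearMap.add_comp]
  · rw [LinearMap.comp_add, hf.right, hg.right, LinearMap.rTensor_add, LinearMap.add_comp]

theorem IsHom.smul {M N : Bicomodule k C} {f : M.carrier →ₗ[k] N.carrier} (s : k)
    (hf : IsHom M N f) : IsHom M N (s • f) := by
  constructor
  · rw [LinearMap.comp_smul, hf.left, LinearMap.lTensor_smul, LinearMap.smul_comp]
  · rw [LinearMap.comp_smul, hf.right, LinearMap.rTensor_smul, LinearMap.smul_comp]

theorem IsHom.sub {M N : Bicomodule k C} {f g : M.carrier →ₗ[k] N.carrier}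
    (hf : IsHom M N f) (hg : IsHom M N g) : IsHom M N (f - g) := by
  have h := hf.add (hg.smul (-1))
  rwa [neg_one_smul, ← sub_eq_add_neg] at h

/-- The inverse of a bijective homomorphism is a homomorphism. -/
theorem IsHom.symm {M N : Bicomodule k C} {e : M.carrier ≃ₗ[k] N.carrier}
    (h : IsHom M N e.toLinearMap) : IsHom N M e.symm.toLinearMap := by
  constructor
  · have := congrArg (fun t => (e.symm.toLinearMap.lTensor C ∘ₗ t) ∘ₗ e.symm.toLinearMap) h.left
    simp only [← LinearMap.comp_assoc, ← LinearMap.lTensor_comp] at this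
    rw [LinearMap.comp_assoc _ e.toLinearMap, LinearEquiv.comp_symm, LinearEquiv.symm_comp,
      LinearMap.lTensor_id, LinearMap.id_comp, LinearMap.comp_id] at this
    exact this.symm
  · have := congrArg (fun t => (e.symm.toLinearMap.rTensor C ∘ₗ t) ∘ₗ e.symm.toLinearMap) h.right
    simp only [← LinearMap.comp_assoc, ← LinearMap.rTensor_comp] at this
    rw [LinearMap.comp_assoc _ e.toLinearMap, LinearEquiv.comp_symm, LinearEquiv.symm_comp,
      LinearMap.rTensor_id, LinearMap.id_comp, LinearMap.comp_id] at this
    exact this.symm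

theorem IsHom.rTensor {M N : Bicomodule k C} {f : M.carrier →ₗ[k] N.carrier} (hf : IsHom M N f)
    (P : Bicomodule k C) : IsHom (M.tensor P) (N.tensor P) (f.rTensor P.carrier) := by
  constructor
  · rw [LinearMap.comp_assoc, ← LinearMap.rTensor_comp, hf.left, LinearMap.rTensor_comp]
    simp only [← LinearMap.comp_assoc]
    congr 1
    exact TensorProduct.ext_threefold fun _ _ _ => rfl
  · rw [LinearMap.comp_assoc, LinearMap.lTensor_comp_rTensor, ← LinearMap.rTensor_comp_lTensor]
    simp only [← LinearMap.comp_assoc]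
    congr 1
    exact TensorProduct.ext (LinearMap.ext fun _ => TensorProduct.ext' fun _ _ => rfl)

theorem IsHom.lTensor {M N : Bicomodule k C} {f : M.carrier →ₗ[k] N.carrier} (hf : IsHom M N f)
    (P : Bicomodule k C) : IsHom (P.tensor M) (P.tensor N) (f.lTensor P.carrier) := by
  constructor
  · rw [LinearMap.comp_assoc, LinearMap.rTensor_comp_lTensor, ← LinearMap.lTensor_comp_rTensor]
    simp only [← LinearMap.comp_assoc]
    congr 1
    exact TensorProduct.ext_threefold fun _ _ _ => rfl
  · rw [LinearMap.comp_assoc, ← LinearMap.lTensor_comp, hf.right, LinearMap.lTensor_comp]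
    simp only [← LinearMap.comp_assoc]
    congr 1
    exact TensorProduct.ext (LinearMap.ext fun _ => TensorProduct.ext' fun _ _ => rfl)

theorem IsHom.corestrict {M N : Bicomodule k C} {f : M.carrier →ₗ[k] N.carrier} (hf : IsHom M N f)
    (π : C →ₗc[k] D) : IsHom (M.corestrict π) (N.corestrict π) f := by
  constructor
  · rw [LinearMap.comp_assoc, hf.left, ← LinearMap.comp_assoc, ← LinearMap.comp_assoc,
      LinearMap.rTensor_comp_lTensor, LinearMap.lTensor_comp_rTensor]
  · rw [LinearMap.comp_assoc, hf.right, ← LinearMap.comp_assoc, ← LinearMap.comp_assoc,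
      LinearMap.rTensor_comp_lTensor, LinearMap.lTensor_comp_rTensor]

end Bicomodule

open Bicomodule

/-! ### Functoriality of the Hochschild complex -/

section CochainsMap

variable {M N P : Bicomodule k C}

/-- The map `f ⊗ id` on Hochschild cochains. -/
def cochainsMap (f : M.carrier →ₗ[k] N.carrier) :
    ∀ n, (cochains M n).carrier →ₗ[k] (cochains N n).carrier
  | 0 => f
  | n + 1 => (cochainsMap f n).rTensor C

theorem cochainsMap_injective {f : M.carrier →ₗ[k] N.carrier} (hf : Function.Injective f) (n : ℕ) :
    Function.Injective (cochainsMap f n) := by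
  induction n with
  | zero => exact hf
  | succ n ih => exact Module.Flat.rTensor_preserves_injective_linearMap _ ih

theorem cochainsMap_surjective {f : M.carrier →ₗ[k] N.carrier} (hf : Function.Surjective f)
    (n : ℕ) : Function.Surjective (cochainsMap f n) := by
  induction n with
  | zero => exact hf
  | succ n ih => exact LinearMap.rTensor_surjective _ ih

theorem cochainsMap_exact {f : M.carrier →ₗ[k] N.carrier} {g : N.carrier →ₗ[k] P.carrier}
    (h : Function.Exact f g) (n : ℕ) : Function.Exact (cochainsMap f n) (cochainsMap g n) := by
  induction n with
  | zero => exact h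
  | succ n ih => exact Module.Flat.rTensor_exact C ih

variable {f : M.carrier →ₗ[k] N.carrier} (hf : IsHom M N f)
include hf

theorem cochainsMap_isHom (n : ℕ) : IsHom (cochains M n) (cochains N n) (cochainsMap f n) := by
  induction n with
  | zero => exact hf
  | succ n ih => exact ih.rTensor _

theorem lastCoface_comp : lastCoface N ∘ₗ f = f.rTensor C ∘ₗ lastCoface M := by
  rw [lastCoface, lastCoface, LinearMap.comp_assoc, hf.left, ← LinearMap.comp_assoc,
    ← LinearMap.comp_assoc]
  congr 1
  exact TensorProduct.ext' fun _ _ => rfl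

-- By `partialD_succ`, statements on cochains are proved by induction on a step for an arbitrary
-- bicomodule, with an arbitrary map `p` in the role of the partial differential. The same pattern
-- recurs in the other lemmas named `step`.
omit hf in
theorem partialD_natural_step {p : M.carrier →ₗ[k] M.carrier ⊗[k] C}
    {p' : N.carrier →ₗ[k] N.carrier ⊗[k] C} (h : p' ∘ₗ f = f.rTensor C ∘ₗ p) (s : k) :
    (p'.rTensor C + s • (N.tensor (regular k C)).right) ∘ₗ f.rTensor C =
      (f.rTensor C).rTensor C ∘ₗ (p.rTensor C + s • (M.tensor (regular k C)).right) := by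
  have h2 := right_tensor_natural (X := M) (Y := N) f
  rw [LinearMap.add_comp, LinearMap.smul_comp, LinearMap.comp_add, LinearMap.comp_smul, h2,
    ← LinearMap.rTensor_comp, h, LinearMap.rTensor_comp]

theorem cochainsMap_partialD (n : ℕ) :
    partialD N n ∘ₗ cochainsMap f n = (cochainsMap f n).rTensor C ∘ₗ partialD M n := by
  induction n with
  | zero =>
    rw [partialD_zero, partialD_zero]
    exact hf.right
  | succ n ih =>
    rw [partialD_succ, partialD_succ]
    exact partialD_natural_step ih _

theorem hochschildD_natural_step {p : M.carrier →ₗ[k] M.carrier ⊗[k] C}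
    {p' : N.carrier →ₗ[k] N.carrier ⊗[k] C} (h : p' ∘ₗ f = f.rTensor C ∘ₗ p) (s : k) :
    (p' + s • lastCoface N) ∘ₗ f = f.rTensor C ∘ₗ (p + s • lastCoface M) := by
  rw [LinearMap.add_comp, LinearMap.smul_comp, LinearMap.comp_add, LinearMap.comp_smul,
    lastCoface_comp hf, h]

theorem cochainsMap_hochschildD (n : ℕ) :
    hochschildD N n ∘ₗ cochainsMap f n = cochainsMap f (n + 1) ∘ₗ hochschildD M n :=
  hochschildD_natural_step (cochainsMap_isHom hf n) (cochainsMap_partialD hf n) _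

end CochainsMap

/-! ### Contractions of cofree bicomodules -/

section Contraction

variable {M N P : Bicomodule k C}

/-- The map `(m ⊗ p) ⊗ c ↦ s (m ⊗ c) ⊗ p`. -/
def tensorContraction {M : Type v} [AddCommGroup M] [Module k M] (s : M ⊗[k] C →ₗ[k] M)
    (P : Type v) [AddCommGroup P] [Module k P] : (M ⊗[k] P) ⊗[k] C →ₗ[k] M ⊗[k] P :=
  s.rTensor P ∘ₗ (TensorProduct.rightComm k M P C).toLinearMap

/-- A map `s` exhibiting a bicomodule as cofree on the left. -/
structure IsContraction (M : Bicomodule k C) (s : M.carrier ⊗[k] C →ₗ[k] M.carrier) : Prop where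
  comp_lastCoface : s ∘ₗ lastCoface M = LinearMap.id
  lastCoface_comp : lastCoface M ∘ₗ s =
    tensorContraction s C ∘ₗ (M.tensor (regular k C)).right

/-- The left coaction of `M ⊗ P` involves `M` only. This formula is what makes the inductions on the
last coface possible. -/
theorem lastCoface_tensor (M P : Bicomodule k C) : lastCoface (M.tensor P) =
    (TensorProduct.rightComm k M.carrier C P.carrier).toLinearMap ∘ₗ
      (lastCoface M).rTensor P.carrier := by
  rw [lastCoface, lastCoface, LinearMap.rTensor_comp]
  simp only [← LinearMap.comp_assoc]
  congr 1
  exact TensorProduct.ext_threefold fun _ _ _ => rfl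

/-- Tensoring on the right with `P` leaves the left coaction unchanged, so the contraction simply
carries `P` along. -/
theorem IsContraction.tensor {s : M.carrier ⊗[k] C →ₗ[k] M.carrier} (hs : IsContraction M s)
    (P : Bicomodule k C) : IsContraction (M.tensor P) (tensorContraction s P.carrier) := by
  constructor
  · rw [lastCoface_tensor, tensorContraction]
    refine LinearMap.ext fun x => ?_
    simp only [LinearMap.comp_apply, LinearEquiv.coe_coe]
    rw [← TensorProduct.rightComm_symm, LinearEquiv.symm_apply_apply, ← LinearMap.comp_apply,
      ← LinearMap.rTensor_comp, hs.comp_lastCoface, LinearMap.rTensor_id]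
  · rw [lastCoface_tensor]
    conv_lhs => rw [tensorContraction]
    rw [LinearMap.comp_assoc, ← LinearMap.comp_assoc _ (s.rTensor _), ← LinearMap.rTensor_comp,
      hs.lastCoface_comp]
    refine TensorProduct.ext_threefold fun m p c => ?_
    simp only [LinearMap.comp_apply, LinearEquiv.coe_coe, TensorProduct.rightComm_tmul,
      LinearMap.rTensor_tmul, LinearMap.lTensor_tmul]
    induction Coalgebra.comul (R := k) c with
    | zero => simp
    | add x y hx hy => simp only [TensorProduct.add_tmul, TensorProduct.tmul_add, map_add, hx, hy]
    | tmul a b => rfl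

/-- The iterated contraction on Hochschild cochains. -/
def cochainsContraction (s : M.carrier ⊗[k] C →ₗ[k] M.carrier) :
    ∀ n, (cochains M n).carrier ⊗[k] C →ₗ[k] (cochains M n).carrier
  | 0 => s
  | n + 1 => tensorContraction (cochainsContraction s n) C

theorem IsContraction.cochains {s : M.carrier ⊗[k] C →ₗ[k] M.carrier} (hs : IsContraction M s)
    (n : ℕ) : IsContraction (cochains M n) (cochainsContraction s n) := by
  induction n with
  | zero => exact hs
  | succ n ih => exact ih.tensor _

omit [Coalgebra k C] in
theorem tensorContraction_rTensor {M N : Type v} [AddCommGroup M] [Module k M] [AddCommGroup N]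
    [Module k N] (s : M ⊗[k] C →ₗ[k] M) (s' : N ⊗[k] C →ₗ[k] N) (p : M →ₗ[k] N)
    (h : s' ∘ₗ p.rTensor C = p ∘ₗ s) :
    tensorContraction s' C ∘ₗ (p.rTensor C).rTensor C = p.rTensor C ∘ₗ tensorContraction s C := by
  rw [tensorContraction, tensorContraction, ← LinearMap.comp_assoc, ← LinearMap.rTensor_comp, ← h,
    LinearMap.rTensor_comp, LinearMap.comp_assoc, LinearMap.comp_assoc]
  congr 1
  exact TensorProduct.ext_threefold fun _ _ _ => rfl

/-- The contraction acts through `M` and the right coaction through `P`. This is the second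
hypothesis of `IsContraction.hochschildD_exact` for bicomodules of the form `M ⊗ P`. -/
theorem tensorContraction_right (s : M.carrier ⊗[k] C →ₗ[k] M.carrier) (P : Bicomodule k C) :
    tensorContraction (tensorContraction s P.carrier) C ∘ₗ
      (M.tensor P).right.rTensor C = (M.tensor P).right ∘ₗ tensorContraction s P.carrier := by
  refine TensorProduct.ext_threefold fun m p c => ?_
  simp only [tensorContraction, LinearMap.comp_apply, LinearEquiv.coe_coe,
    TensorProduct.rightComm_tmul, LinearMap.rTensor_tmul, LinearMap.lTensor_tmul]
  induction P.right p with
  | zero => simp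
  | add x y hx hy => simp only [TensorProduct.add_tmul, TensorProduct.tmul_add, map_add, hx, hy]
  | tmul a b => rfl

theorem contraction_partialD_step (s : M.carrier ⊗[k] C →ₗ[k] M.carrier)
    (p : M.carrier →ₗ[k] M.carrier ⊗[k] C) (t : k)
    (h : tensorContraction s C ∘ₗ p.rTensor C = p ∘ₗ s) :
    tensorContraction (tensorContraction s C) C ∘ₗ
      (p.rTensor C + t • (M.tensor (regular k C)).right).rTensor C =
    (p.rTensor C + t • (M.tensor (regular k C)).right) ∘ₗ tensorContraction s C := by
  rw [LinearMap.rTensor_add, LinearMap.rTensor_smul, LinearMap.comp_add, LinearMap.comp_smul,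
    tensorContraction_rTensor _ _ _ h, LinearMap.add_comp, LinearMap.smul_comp]
  exact congrArg (fun x => _ + t • x) (tensorContraction_right s (regular k C))

theorem contraction_partialD {s : M.carrier ⊗[k] C →ₗ[k] M.carrier}
    (hs : tensorContraction s C ∘ₗ M.right.rTensor C = M.right ∘ₗ s) (n : ℕ) :
    cochainsContraction s (n + 1) ∘ₗ (partialD M n).rTensor C =
      partialD M n ∘ₗ cochainsContraction s n := by
  induction n with
  | zero =>
    rw [partialD_zero]
    exact hs
  | succ n ih =>
    rw [partialD_succ]
    exact contraction_partialD_step _ _ _ ih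

/-- The contraction commutes with the part `p`, turns the comultiplication of the last factor into
the last coface after `s`, and turns the last coface into the identity. The outcome is the relation
of a contracting homotopy, up to the sign `t`. -/
theorem IsContraction.hochschildD_step {s : M.carrier ⊗[k] C →ₗ[k] M.carrier}
    (hs : IsContraction M s) (p : M.carrier →ₗ[k] M.carrier ⊗[k] C) (t : k)
    (h : tensorContraction s C ∘ₗ p.rTensor C = p ∘ₗ s) :
    tensorContraction s C ∘ₗ (p.rTensor C + t • (M.tensor (regular k C)).right +
      (-t) • lastCoface (M.tensor (regular k C))) = (p + t • lastCoface M) ∘ₗ s - t • .id := by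
  have h1 := (hs.tensor (regular k C)).comp_lastCoface
  rw [LinearMap.comp_add, LinearMap.comp_smul, h1, LinearMap.comp_add, LinearMap.comp_smul, h,
    ← hs.lastCoface_comp, LinearMap.add_comp, LinearMap.smul_comp]
  module

/-- The Hochschild cohomology of a bicomodule which is cofree on the left vanishes in positive
degrees. -/
theorem IsContraction.hochschildD_exact {s : M.carrier ⊗[k] C →ₗ[k] M.carrier}
    (hs : IsContraction M s)
    (hs' : tensorContraction s C ∘ₗ M.right.rTensor C = M.right ∘ₗ s) (n : ℕ)
    (x : (Coalg.cochains M (n + 1)).carrier) (hx : hochschildD M (n + 1) x = 0) :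
    ∃ y, hochschildD M n y = x := by
  have h := (hs.cochains n).hochschildD_step (partialD M n) ((-1 : k) ^ (n + 1))
    (contraction_partialD hs' n)
  have e : hochschildD M (n + 1) = (partialD M n).rTensor C + (-1 : k) ^ (n + 1) •
      ((Coalg.cochains M n).tensor (regular k C)).right +
      (-(-1 : k) ^ (n + 1)) • lastCoface ((Coalg.cochains M n).tensor (regular k C)) := by
    rw [← partialD_succ, ← mul_neg_one, ← pow_succ]
    rfl
  rw [e] at hx
  have h' := LinearMap.congr_fun h x
  have h2 : hochschildD M n (cochainsContraction s n x) - (-1 : k) ^ (n + 1) • x = 0 :=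
    h'.symm.trans
      ((congrArg (tensorContraction (cochainsContraction s n) C) hx).trans (map_zero _))
  refine ⟨(-1 : k) ^ (n + 1) • cochainsContraction s n x, ?_⟩
  rw [map_smul, sub_eq_zero.1 h2, smul_smul, ← mul_pow]
  simp

variable (M) in
/-- The contraction of the bicomodule `C ⊗ M`. -/
def cofreeContraction : (C ⊗[k] M.carrier) ⊗[k] C →ₗ[k] C ⊗[k] M.carrier :=
  ((TensorProduct.lid k M.carrier).toLinearMap ∘ₗ
    (Coalgebra.counit (R := k) (A := C)).rTensor M.carrier).lTensor C ∘ₗ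
      (TensorProduct.comm k (C ⊗[k] M.carrier) C).toLinearMap

-- The contraction is `(c ⊗ m) ⊗ e ↦ ε(c) e ⊗ m`. It puts the trailing factor back in front, so
-- counitality makes it a left inverse of the last coface `c ⊗ m ↦ (c₍₂₎ ⊗ m) ⊗ c₍₁₎`.
variable (M) in
theorem isContraction_cofree : IsContraction ((regular k C).tensor M) (cofreeContraction M) := by
  constructor
  · refine TensorProduct.ext' fun c m => ?_
    have h : ∀ t : C ⊗[k] C, cofreeContraction M (TensorProduct.comm k C (C ⊗[k] M.carrier)
        (TensorProduct.assoc k C C M.carrier (t ⊗ₜ m))) = TensorProduct.rid k C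
          ((Coalgebra.counit (R := k) (A := C)).lTensor C t) ⊗ₜ m := by
      intro t
      induction t with
      | zero => simp
      | add x y hx hy => simp only [TensorProduct.add_tmul, map_add, hx, hy]
      | tmul a b => simp [cofreeContraction, TensorProduct.smul_tmul]
    refine (h _).trans ?_
    rw [Coalgebra.lTensor_counit_comul]
    simp
  · refine TensorProduct.ext_threefold fun c m e => ?_
    simp only [tensorContraction, cofreeContraction, lastCoface, LinearMap.comp_apply,
      LinearEquiv.coe_coe, TensorProduct.comm_tmul, LinearMap.rTensor_tmul, LinearMap.lTensor_tmul,
      TensorProduct.lid_tmul]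
    induction Coalgebra.comul (R := k) e with
    | zero => simp
    | add x y hx hy => simp only [TensorProduct.add_tmul, TensorProduct.tmul_add, map_add, hx, hy]
    | tmul a b => simp [TensorProduct.smul_tmul']

/-- The bicomodule `(C ⊗ M) ⊗ P` has no Hochschild cohomology in positive degrees. -/
theorem hochschildD_exact_cofree (M P : Bicomodule k C) (n : ℕ)
    (x : (cochains (((regular k C).tensor M).tensor P) (n + 1)).carrier)
    (hx : hochschildD (((regular k C).tensor M).tensor P) (n + 1) x = 0) :
    ∃ y, hochschildD (((regular k C).tensor M).tensor P) n y = x :=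
  ((isContraction_cofree M).tensor P).hochschildD_exact (tensorContraction_right _ _) n x hx

end Contraction

/-! ### Images and cofree bicomodules -/

section Range

variable {M N : Bicomodule k C} {f : M.carrier →ₗ[k] N.carrier}

/-- The restricted coactions of a subspace make the inclusion a homomorphism. -/
theorem Bicomodule.isHom_restrict_iff (M : Bicomodule k C) (K : Submodule k N.carrier)
    (hl : ∀ x : K, (N.left ∘ₗ K.subtype) x ∈ LinearMap.range (K.subtype.lTensor C))
    (hr : ∀ x : K, (N.right ∘ₗ K.subtype) x ∈ LinearMap.range (K.subtype.rTensor C))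
    (f : M.carrier →ₗ[k] K) : IsHom M (N.restrict K hl hr) f ↔ IsHom M N (K.subtype ∘ₗ f) := by
  have h1 := N.lTensor_restrictLeft K hl
  have h2 := N.rTensor_restrictRight K hr
  constructor
  · intro h
    refine IsHom.comp (N := N.restrict K hl hr) ⟨h1.symm, h2.symm⟩ h
  · intro h
    constructor
    · rw [← LinearMap.cancel_left (lTensor_subtype_injective K), ← LinearMap.comp_assoc, h1,
        LinearMap.comp_assoc, h.left, LinearMap.lTensor_comp, LinearMap.comp_assoc]
    · rw [← LinearMap.cancel_left (rTensor_subtype_injective K), ← LinearMap.comp_assoc, h2,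
        LinearMap.comp_assoc, h.right, LinearMap.rTensor_comp, LinearMap.comp_assoc]

/-- The image of a homomorphism of bicomodules. -/
abbrev Bicomodule.IsHom.range (hf : IsHom M N f) : Bicomodule k C :=
  N.restrict (LinearMap.range f)
    (by
      rintro ⟨_, x, rfl⟩
      refine ⟨f.rangeRestrict.lTensor C (M.left x), ?_⟩
      rw [← LinearMap.comp_apply, ← LinearMap.lTensor_comp, LinearMap.subtype_comp_codRestrict]
      exact (LinearMap.congr_fun hf.left x).symm)
    (by
      rintro ⟨_, x, rfl⟩
      refine ⟨f.rangeRestrict.rTensor C (M.right x), ?_⟩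
      rw [← LinearMap.comp_apply, ← LinearMap.rTensor_comp, LinearMap.subtype_comp_codRestrict]
      exact (LinearMap.congr_fun hf.right x).symm)

theorem Bicomodule.IsHom.isHom_rangeRestrict (hf : IsHom M N f) :
    IsHom M hf.range f.rangeRestrict :=
  (isHom_restrict_iff M _ _ _ _).2 hf

variable (M) in
/-- The left coaction is a homomorphism to the cofree bicomodule. -/
theorem Bicomodule.isHom_left : IsHom M ((regular k C).tensor M) M.left := by
  constructor
  · exact M.left_coassoc
  · rw [LinearMap.comp_assoc, ← M.comm, ← LinearMap.comp_assoc, LinearEquiv.symm_comp,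
      LinearMap.id_comp]

theorem Bicomodule.lid_counit_left (M : Bicomodule k C) (x : M.carrier) :
    TensorProduct.lid k M.carrier
      ((Coalgebra.counit (R := k) (A := C)).rTensor M.carrier (M.left x)) = x := by
  have h := LinearMap.congr_fun M.left_counit x
  rw [LinearMap.comp_apply] at h
  rw [h]
  simp

theorem Bicomodule.left_injective (M : Bicomodule k C) : Function.Injective M.left :=
  Function.LeftInverse.injective (g := fun t => TensorProduct.lid k M.carrier
    ((Coalgebra.counit (R := k) (A := C)).rTensor M.carrier t)) M.lid_counit_left

variable (M) in
theorem Bicomodule.isHom_left_sub_lTensor : IsHom ((regular k C).tensor M)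
    ((regular k C).tensor ((regular k C).tensor M))
    (((regular k C).tensor M).left - M.left.lTensor C) :=
  ((regular k C).tensor M).isHom_left.sub (M.isHom_left.lTensor (regular k C))

-- Applying the counit to the leading factor of `(Δ ⊗ id) x = (id ⊗ left) x` exhibits `x` as a
-- coaction. Hence the image of the second map is a model of the quotient of `C ⊗ M` by `M`, and it
-- is a bicomodule as the image of a homomorphism.
variable (M) in
theorem Bicomodule.exact_left : Function.Exact M.left
    (((regular k C).tensor M).left - M.left.lTensor C) := by
  intro x
  constructor
  · intro h
    have h1 : ((regular k C).tensor M).left x = M.left.lTensor C x := sub_eq_zero.1 h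
    have h2 := ((regular k C).tensor M).lid_counit_left x
    rw [h1] at h2
    refine ⟨TensorProduct.lid k M.carrier
      ((Coalgebra.counit (R := k) (A := C)).rTensor M.carrier x), ?_⟩
    refine Eq.trans ?_ h2
    clear h h1 h2
    induction x with
    | zero => simp
    | add x y hx hy => simp only [map_add, hx, hy]
    | tmul c m => simp
  · rintro ⟨m, rfl⟩
    exact sub_eq_zero.2 (LinearMap.congr_fun M.left_coassoc m)

end Range

/-! ### Vanishing of Hochschild cohomology -/

section Vanishing

variable {N₁ N₂ N₃ : Bicomodule k D} {f : N₁.carrier →ₗ[k] N₂.carrier}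
  {g : N₂.carrier →ₗ[k] N₃.carrier}

/-- Dimension shifting for Hochschild cohomology. -/
theorem hochschildD_exact_of_shortExact (hf : IsHom N₁ N₂ f) (hg : IsHom N₂ N₃ g)
    (hi : Function.Injective f) (he : Function.Exact f g) (n : ℕ)
    (h₂ : ∀ x, hochschildD N₂ (n + 1) x = 0 → ∃ y, hochschildD N₂ n y = x)
    (h₃ : ∀ z, hochschildD N₃ n z = 0 → ∃ y, hochschildD N₂ n y = 0 ∧ cochainsMap g n y = z)
    (x : (cochains N₁ (n + 1)).carrier) (hx : hochschildD N₁ (n + 1) x = 0) :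
    ∃ y, hochschildD N₁ n y = x := by
  have hfd : ∀ n x, hochschildD N₂ n (cochainsMap f n x) =
      cochainsMap f (n + 1) (hochschildD N₁ n x) :=
    fun n => LinearMap.congr_fun (cochainsMap_hochschildD hf n)
  have hgd : ∀ n x, hochschildD N₃ n (cochainsMap g n x) =
      cochainsMap g (n + 1) (hochschildD N₂ n x) :=
    fun n => LinearMap.congr_fun (cochainsMap_hochschildD hg n)
  -- If `f x = b y`, then `g y` is a cocycle; subtracting from `y` a cocycle with the same image
  -- makes it come from `N₁` without changing `b y`.
  obtain ⟨y, hy⟩ := h₂ (cochainsMap f (n + 1) x) (by rw [hfd, hx, map_zero])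
  obtain ⟨y', hy', e⟩ := h₃ (cochainsMap g n y) (by
    rw [hgd, hy]
    exact (cochainsMap_exact he (n + 1)).apply_apply_eq_zero x)
  obtain ⟨z, hz⟩ := (cochainsMap_exact he n (y - y')).1 (by rw [map_sub, e, sub_self])
  refine ⟨z, cochainsMap_injective hi (n + 1) ?_⟩
  rw [← hfd, hz, map_sub, hy, hy', sub_zero]

variable (M P : Bicomodule k D)

/-- The equivalence `p ⊗ (d ⊗ m) ↦ (m ⊗ p) ⊗ d`. -/
def cotensorPerm (P M : Type v) [AddCommGroup P] [Module k P] [AddCommGroup M] [Module k M] :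
    P ⊗[k] (D ⊗[k] M) ≃ₗ[k] (M ⊗[k] P) ⊗[k] D :=
  (TensorProduct.assoc k P D M).symm ≪≫ₗ TensorProduct.rightComm k P D M ≪≫ₗ
    TensorProduct.congr (TensorProduct.comm k P M) (LinearEquiv.refl k D)

omit P in
theorem hochschildD_zero : (hochschildD M 0 : M.carrier →ₗ[k] M.carrier ⊗[k] D) =
    M.right - lastCoface M :=
  (congrArg (fun p : M.carrier →ₗ[k] M.carrier ⊗[k] D => p + (-1 : k) ^ (0 + 1) • lastCoface M)
    (partialD_zero M)).trans (by rw [zero_add, pow_one]; module)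

theorem right_comp_comm : (M.tensor P).right ∘ₗ
    (TensorProduct.comm k P.carrier M.carrier).toLinearMap =
      (cotensorPerm P.carrier M.carrier).toLinearMap ∘ₗ
        (TensorProduct.assoc k P.carrier D M.carrier).toLinearMap ∘ₗ P.right.rTensor M.carrier := by
  refine TensorProduct.ext' fun p m => ?_
  simp only [LinearMap.comp_apply, LinearEquiv.coe_coe, TensorProduct.comm_tmul,
    LinearMap.rTensor_tmul, LinearMap.lTensor_tmul]
  induction P.right p with
  | zero => simp
  | add x y hx hy => simp only [TensorProduct.add_tmul, TensorProduct.tmul_add, map_add, hx, hy]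
  | tmul a b => rfl

theorem lastCoface_comp_comm : lastCoface (M.tensor P) ∘ₗ
    (TensorProduct.comm k P.carrier M.carrier).toLinearMap =
      (cotensorPerm P.carrier M.carrier).toLinearMap ∘ₗ M.left.lTensor P.carrier := by
  refine TensorProduct.ext' fun p m => ?_
  simp only [lastCoface, LinearMap.comp_apply, LinearEquiv.coe_coe, TensorProduct.comm_tmul,
    LinearMap.rTensor_tmul, LinearMap.lTensor_tmul]
  induction M.left m with
  | zero => simp
  | add x y hx hy => simp only [TensorProduct.add_tmul, TensorProduct.tmul_add, map_add, hx, hy]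
  | tmul a b => rfl

/-- Up to permuting factors, the degree zero Hochschild differential of `M ⊗ P` is the map that
defines `P □ M`. So `HH^0(M ⊗ P)` is `P □ M`, which is where coflatness enters. -/
theorem right_sub_lastCoface_comp_comm : ((M.tensor P).right - lastCoface (M.tensor P)) ∘ₗ
    (TensorProduct.comm k P.carrier M.carrier).toLinearMap =
      (cotensorPerm P.carrier M.carrier).toLinearMap ∘ₗ cotensorDiff P.right M.left := by
  rw [cotensorDiff, LinearMap.comp_sub, LinearMap.sub_comp, right_comp_comm, lastCoface_comp_comm]

theorem hochschildD_zero_comm (x : P.carrier ⊗[k] M.carrier) :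
    hochschildD (M.tensor P) 0 (TensorProduct.comm k P.carrier M.carrier x) =
      cotensorPerm P.carrier M.carrier (cotensorDiff P.right M.left x) :=
  (LinearMap.congr_fun (hochschildD_zero (M.tensor P)) _).trans
    (LinearMap.congr_fun (right_sub_lastCoface_comp_comm M P) x)

theorem hochschildD_zero_comm_eq_zero (x : P.carrier ⊗[k] M.carrier) :
    hochschildD (M.tensor P) 0 (TensorProduct.comm k P.carrier M.carrier x) = 0 ↔
      x ∈ cotensor P.right M.left := by
  rw [cotensor, LinearMap.mem_ker, ← (cotensorPerm P.carrier M.carrier).map_eq_zero_iff]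
  exact Eq.congr_left (hochschildD_zero_comm M P x)

/-- If `P` is a coflat right comodule then the Hochschild cohomology of `M ⊗ P` vanishes in
positive degrees. -/
theorem hochschildD_exact_of_isCoflat (hP : P.toRightComodule.IsCoflat) (n : ℕ)
    (x : (cochains (M.tensor P) (n + 1)).carrier) (hx : hochschildD (M.tensor P) (n + 1) x = 0) :
    ∃ y, hochschildD (M.tensor P) n y = x := by
  induction n generalizing M with
  | zero =>
    -- The sequence is `0 → M → D ⊗ M → Q → 0` tensored with `P`, where `Q` is the image of `left -
    -- id ⊗ left`. The middle term `(D ⊗ M) ⊗ P` is cofree on the left and has no higher cohomology.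
    have hg := M.isHom_left_sub_lTensor
    refine hochschildD_exact_of_shortExact (M.isHom_left.rTensor P)
      (hg.isHom_rangeRestrict.rTensor P)
      (Module.Flat.rTensor_preserves_injective_linearMap _ M.left_injective)
      (Module.Flat.rTensor_exact _ fun x => ?_) 0 (hochschildD_exact_cofree M P 0) ?_ x hx
    · rw [← M.exact_left x]
      exact Subtype.ext_iff
    · intro z hz
      -- Coflatness of `P` makes `P □ (D ⊗ M) → P □ Q` surjective, that is, degree zero cocycles of
      -- `Q ⊗ P` lift to cocycles.
      have hs := (hP M.toLeftComodule ((regular k D).tensor M).toLeftComodule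
        hg.range.toLeftComodule M.left _ M.isHom_left.left hg.isHom_rangeRestrict.left
        M.left_injective (fun x => by rw [← M.exact_left x]; exact Subtype.ext_iff)
        (LinearMap.surjective_rangeRestrict _)).2.2
      obtain ⟨z, rfl⟩ := (TensorProduct.comm k P.carrier hg.range.carrier).surjective z
      obtain ⟨⟨y, hy⟩, hyz⟩ := hs ⟨z, (hochschildD_zero_comm_eq_zero _ _ z).1 hz⟩
      refine ⟨TensorProduct.comm k P.carrier _ y, (hochschildD_zero_comm_eq_zero _ _ y).2 hy, ?_⟩
      have hyz' := congrArg Subtype.val hyz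
      refine Eq.trans ?_ (congrArg (TensorProduct.comm k P.carrier hg.range.carrier) hyz')
      exact LinearMap.congr_fun (f := (LinearMap.rangeRestrict _).rTensor P.carrier ∘ₗ
        (TensorProduct.comm k P.carrier (D ⊗[k] M.carrier)).toLinearMap)
        (g := (TensorProduct.comm k P.carrier hg.range.carrier).toLinearMap ∘ₗ
          (LinearMap.rangeRestrict _).lTensor P.carrier) (TensorProduct.ext' fun _ _ => rfl) y
  | succ n ih =>
    have hg := M.isHom_left_sub_lTensor
    refine hochschildD_exact_of_shortExact (M.isHom_left.rTensor P)
      (hg.isHom_rangeRestrict.rTensor P)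
      (Module.Flat.rTensor_preserves_injective_linearMap _ M.left_injective)
      (Module.Flat.rTensor_exact _ fun x => ?_) (n + 1) (hochschildD_exact_cofree M P (n + 1)) ?_
      x hx
    · rw [← M.exact_left x]
      exact Subtype.ext_iff
    · intro z hz
      -- In positive degree the induction hypothesis, for `Q` in place of `M`, makes the cocycle a
      -- coboundary; the coboundary of any lift of its primitive is then a lifting cocycle.
      obtain ⟨w, hw⟩ := ih _ z hz
      obtain ⟨w', rfl⟩ := cochainsMap_surjective
        (M := ((regular k D).tensor M).tensor P) (N := hg.range.tensor P)
        (LinearMap.rTensor_surjective P.carrier (LinearMap.surjective_rangeRestrict _)) n w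
      refine ⟨hochschildD _ n w', LinearMap.congr_fun (hochschildD_hochschildD _ n) w', ?_⟩
      rw [← hw]
      exact (LinearMap.congr_fun (cochainsMap_hochschildD (hg.isHom_rangeRestrict.rTensor P) n)
        w').symm

end Vanishing

/-! ### The cobar resolution of the right coaction -/

section PartialD

variable (M : Bicomodule k C)

theorem isHom_partialD_right_step (p : M.carrier →ₗ[k] M.carrier ⊗[k] C) (s : k) :
    ((M.tensor (regular k C)).tensor (regular k C)).right ∘ₗ
      (p.rTensor C + s • (M.tensor (regular k C)).right) =
    (p.rTensor C + s • (M.tensor (regular k C)).right).rTensor C ∘ₗ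
      (M.tensor (regular k C)).right := by
  have h1 := right_tensor_natural (X := M) (Y := M.tensor (regular k C)) p
  have h2 := right_tensor_right M
  rw [LinearMap.comp_add, LinearMap.comp_smul, h1, h2, LinearMap.rTensor_add,
    LinearMap.rTensor_smul, LinearMap.add_comp, LinearMap.smul_comp]

theorem isHom_partialD (n : ℕ) :
    IsHom (cochains M n) ((cochains M n).tensor (regular k C)) (partialD M n) := by
  refine ⟨left_partialD M n, ?_⟩
  cases n with
  | zero =>
    rw [partialD_zero]
    have h : (M.tensor (regular k C)).right ∘ₗ M.right = M.right.rTensor C ∘ₗ M.right := by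
      rw [LinearMap.comp_assoc]
      refine (congrArg _ M.right_coassoc.symm).trans ?_
      rw [← LinearMap.comp_assoc, LinearEquiv.symm_comp, LinearMap.id_comp]
    exact h
  | succ n =>
    rw [partialD_succ]
    exact isHom_partialD_right_step _ _ _

/-- The contraction `m ⊗ c ↦ ε(c) m`. -/
def counitRight (M : Type v) [AddCommGroup M] [Module k M] : M ⊗[k] C →ₗ[k] M :=
  (TensorProduct.rid k M).toLinearMap ∘ₗ (Coalgebra.counit (R := k) (A := C)).lTensor M

theorem counitRight_right : counitRight M.carrier ∘ₗ M.right = LinearMap.id := by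
  rw [counitRight, LinearMap.comp_assoc, M.right_counit]
  ext x
  simp

theorem counitRight_rTensor {M N : Type v} [AddCommGroup M] [Module k M] [AddCommGroup N]
    [Module k N] (p : M →ₗ[k] N) :
    counitRight N ∘ₗ p.rTensor C = p ∘ₗ counitRight M := by
  refine TensorProduct.ext' fun m c => ?_
  simp [counitRight]

/-- The counit on the last factor commutes with the cofaces of the earlier factors and splits the
comultiplication of the last one, so up to sign it is a contracting homotopy of the cobar complex.
-/
theorem counitRight_partialD_step (p : M.carrier →ₗ[k] M.carrier ⊗[k] C) (s : k) :
    counitRight (M.carrier ⊗[k] C) ∘ₗ (p.rTensor C + s • (M.tensor (regular k C)).right) =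
      p ∘ₗ counitRight M.carrier + s • LinearMap.id := by
  have h := counitRight_right (M.tensor (regular k C))
  rw [LinearMap.comp_add, LinearMap.comp_smul, counitRight_rTensor, h]

theorem eq_of_partialD_step_eq_zero {p : M.carrier →ₗ[k] M.carrier ⊗[k] C} {s : k}
    (hs : s * s = 1) {x : M.carrier ⊗[k] C}
    (hx : (p.rTensor C + s • (M.tensor (regular k C)).right) x = 0) :
    p (-s • counitRight M.carrier x) = x := by
  have h := LinearMap.congr_fun (counitRight_partialD_step M p s) x
  rw [LinearMap.comp_apply, hx, map_zero, LinearMap.add_apply, LinearMap.comp_apply,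
    LinearMap.smul_apply, LinearMap.id_apply] at h
  rw [map_smul, eq_neg_of_add_eq_zero_left h.symm, smul_neg, neg_smul, neg_neg, smul_smul, hs,
    one_smul]

theorem partialD_zero_injective :
    Function.Injective (partialD M 0 : M.carrier →ₗ[k] M.carrier ⊗[k] C) := by
  rw [partialD_zero]
  exact Function.LeftInverse.injective (g := counitRight M.carrier)
    (LinearMap.congr_fun (counitRight_right M))

theorem partialD_exact (n : ℕ) : Function.Exact (partialD M n) (partialD M (n + 1)) := by
  intro x
  constructor
  · intro hx
    rw [partialD_succ] at hx
    exact ⟨_, eq_of_partialD_step_eq_zero (cochains M n) (by rw [← mul_pow]; simp) hx⟩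
  · rintro ⟨y, rfl⟩
    exact LinearMap.congr_fun (partialD_partialD M n) y

end PartialD

/-! ### Coinduction along a coalgebra homomorphism -/

section Coinduction

variable (π : C →ₗc[k] D)

theorem Bicomodule.mk_congr {X : Type v} [AddCommGroup X] [Module k X]
    {l l' : X →ₗ[k] D ⊗[k] X} {r r' : X →ₗ[k] X ⊗[k] D} (hl : l = l') (hr : r = r')
    (h₁ h₂ h₃ h₄ h₅ h₁' h₂' h₃' h₄' h₅') :
    (⟨⟨X, l, h₁, h₂⟩, r, h₃, h₄, h₅⟩ : Bicomodule k D) =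
      ⟨⟨X, l', h₁', h₂'⟩, r', h₃', h₄', h₅'⟩ := by
  subst hl hr
  rfl

theorem Bicomodule.corestrict_tensor_left (M N : Bicomodule k C) :
    ((M.tensor N).corestrict π).left = ((M.corestrict π).tensor (N.corestrict π)).left := by
  change π.toLinearMap.rTensor (M.carrier ⊗[k] N.carrier) ∘ₗ
      (TensorProduct.assoc k C M.carrier N.carrier).toLinearMap ∘ₗ M.left.rTensor N.carrier =
      (TensorProduct.assoc k D M.carrier N.carrier).toLinearMap ∘ₗ
        (π.toLinearMap.rTensor M.carrier ∘ₗ M.left).rTensor N.carrier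
  rw [LinearMap.rTensor_comp, ← LinearMap.comp_assoc, ← LinearMap.comp_assoc]
  congr 1
  exact TensorProduct.ext_threefold fun _ _ _ => rfl

theorem Bicomodule.corestrict_tensor_right (M N : Bicomodule k C) :
    ((M.tensor N).corestrict π).right = ((M.corestrict π).tensor (N.corestrict π)).right := by
  change π.toLinearMap.lTensor (M.carrier ⊗[k] N.carrier) ∘ₗ
      (TensorProduct.assoc k M.carrier N.carrier C).symm.toLinearMap ∘ₗ N.right.lTensor M.carrier =
      (TensorProduct.assoc k M.carrier N.carrier D).symm.toLinearMap ∘ₗ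
        (π.toLinearMap.lTensor N.carrier ∘ₗ N.right).lTensor M.carrier
  rw [LinearMap.lTensor_comp, ← LinearMap.comp_assoc, ← LinearMap.comp_assoc]
  congr 1
  exact TensorProduct.ext (LinearMap.ext fun _ => TensorProduct.ext' fun _ _ => rfl)

/-- Both sides have the same carrier and only the coactions need comparing, so this is an equality
of structures; it lets the vanishing theorem be transported by rewriting in `coindEquiv`. -/
theorem Bicomodule.corestrict_tensor (M N : Bicomodule k C) :
    (M.tensor N).corestrict π = (M.corestrict π).tensor (N.corestrict π) :=
  mk_congr (corestrict_tensor_left π M N) (corestrict_tensor_right π M N) _ _ _ _ _ _ _ _ _ _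

theorem Bicomodule.isHom_corestrict_tensor (M N : Bicomodule k C) :
    IsHom ((M.tensor N).corestrict π) ((M.corestrict π).tensor (N.corestrict π))
      LinearMap.id := by
  constructor
  · rw [LinearMap.lTensor_id]
    exact (corestrict_tensor_left π M N).symm
  · rw [LinearMap.rTensor_id]
    exact (corestrict_tensor_right π M N).symm

/-- A subspace on which a map vanishes is stable under the left coaction if the map is compatible
with the left coaction. -/
theorem left_mem_ker (M : Bicomodule k C) {Y : Type v} [AddCommGroup Y] [Module k Y]
    (g : M.carrier →ₗ[k] Y) (l : Y →ₗ[k] C ⊗[k] Y) (h : g.lTensor C ∘ₗ M.left = l ∘ₗ g)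
    (x : LinearMap.ker g) : (M.left ∘ₗ (LinearMap.ker g).subtype) x ∈
      LinearMap.range ((LinearMap.ker g).subtype.lTensor C) := by
  have he : Function.Exact (LinearMap.ker g).subtype g := by
    rw [LinearMap.exact_iff, Submodule.range_subtype]
  refine (Module.Flat.lTensor_exact C he _).mp ?_
  refine (LinearMap.congr_fun h x.1).trans ?_
  rw [LinearMap.comp_apply, show g x.1 = 0 from x.2, map_zero]

/-- A subspace on which a map vanishes is stable under the right coaction if the map is compatible
with the right coaction. -/
theorem right_mem_ker (M : Bicomodule k C) {Y : Type v} [AddCommGroup Y] [Module k Y]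
    (g : M.carrier →ₗ[k] Y) (r : Y →ₗ[k] Y ⊗[k] C) (h : g.rTensor C ∘ₗ M.right = r ∘ₗ g)
    (x : LinearMap.ker g) : (M.right ∘ₗ (LinearMap.ker g).subtype) x ∈
      LinearMap.range ((LinearMap.ker g).subtype.rTensor C) := by
  have he : Function.Exact (LinearMap.ker g).subtype g := by
    rw [LinearMap.exact_iff, Submodule.range_subtype]
  refine (Module.Flat.rTensor_exact C he _).mp ?_
  refine (LinearMap.congr_fun h x.1).trans ?_
  rw [LinearMap.comp_apply, show g x.1 = 0 from x.2, map_zero]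

/-- A mixed form of commutation: one coaction is kept over `C`, the other is pushed to `D`. It makes
a cotensor product over `D` stable under the coactions of `C`. -/
theorem comm_corestrict_right (M : Bicomodule k C) :
    (TensorProduct.assoc k C M.carrier D).toLinearMap ∘ₗ M.left.rTensor D ∘ₗ
      (M.corestrict π).right = (M.corestrict π).right.lTensor C ∘ₗ M.left := by
  have h := congrArg (fun t => (π.toLinearMap.lTensor M.carrier).lTensor C ∘ₗ t) M.comm
  simp only [← LinearMap.comp_assoc, ← LinearMap.lTensor_comp] at h ⊢
  rw [← h]
  congr 1
  refine TensorProduct.ext' fun m c => ?_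
  simp only [LinearMap.comp_apply, LinearMap.rTensor_tmul, LinearMap.lTensor_tmul]
  induction M.left m with
  | zero => simp
  | add x y hx hy => simp only [TensorProduct.add_tmul, map_add, hx, hy]
  | tmul a b => rfl

theorem comm_corestrict_left (M : Bicomodule k C) :
    (TensorProduct.assoc k D M.carrier C).toLinearMap ∘ₗ (M.corestrict π).left.rTensor C ∘ₗ
      M.right = M.right.lTensor D ∘ₗ (M.corestrict π).left := by
  have h := congrArg (fun t => (π.toLinearMap.rTensor (M.carrier ⊗[k] C)) ∘ₗ t) M.comm
  rw [LinearMap.rTensor_comp]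
  rw [← LinearMap.comp_assoc _ _ (M.right.lTensor D), LinearMap.lTensor_comp_rTensor,
    ← LinearMap.rTensor_comp_lTensor, LinearMap.comp_assoc (M.left), ← h]
  simp only [← LinearMap.comp_assoc]
  congr 2
  exact TensorProduct.ext_threefold fun _ _ _ => rfl

/-- The cotensor difference is compatible with the left coaction. -/
theorem lTensor_cotensorDiff_left (M W : Bicomodule k C) :
    (cotensorDiff (M.corestrict π).right (W.corestrict π).left).lTensor C ∘ₗ (M.tensor W).left =
      ((TensorProduct.assoc k C M.carrier (D ⊗[k] W.carrier)).toLinearMap ∘ₗ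
        M.left.rTensor (D ⊗[k] W.carrier)) ∘ₗ
          cotensorDiff (M.corestrict π).right (W.corestrict π).left := by
  have hc := comm_corestrict_right π M
  generalize (M.corestrict π).right = ρ at hc ⊢
  generalize (W.corestrict π).left = lam
  let F : (C ⊗[k] (M.carrier ⊗[k] D)) ⊗[k] W.carrier →ₗ[k]
      C ⊗[k] (M.carrier ⊗[k] (D ⊗[k] W.carrier)) :=
    (TensorProduct.assoc k M.carrier D W.carrier).toLinearMap.lTensor C ∘ₗ
      (TensorProduct.assoc k C (M.carrier ⊗[k] D) W.carrier).toLinearMap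
  rw [cotensorDiff, LinearMap.lTensor_sub, LinearMap.comp_sub, LinearMap.sub_comp]
  congr 1
  · refine TensorProduct.ext' fun m n => ?_
    have h1 : ∀ t : C ⊗[k] M.carrier,
        ((TensorProduct.assoc k M.carrier D W.carrier).toLinearMap ∘ₗ
          ρ.rTensor W.carrier).lTensor C
            (TensorProduct.assoc k C M.carrier W.carrier (t ⊗ₜ n)) =
        F (ρ.lTensor C t ⊗ₜ n) := by
      intro t
      induction t with
      | zero => simp
      | add x y hx hy => simp only [TensorProduct.add_tmul, map_add, hx, hy]
      | tmul d m => rfl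
    have h2 : ∀ t : M.carrier ⊗[k] D,
        TensorProduct.assoc k C M.carrier (D ⊗[k] W.carrier)
          (M.left.rTensor (D ⊗[k] W.carrier)
            (TensorProduct.assoc k M.carrier D W.carrier (t ⊗ₜ n))) =
        F (TensorProduct.assoc k C M.carrier D (M.left.rTensor D t) ⊗ₜ n) := by
      intro t
      induction t with
      | zero => simp
      | add x y hx hy => simp only [TensorProduct.add_tmul, map_add, hx, hy]
      | tmul m d =>
        simp only [TensorProduct.assoc_tmul, LinearMap.rTensor_tmul]
        induction M.left m with
        | zero => simp
        | add x y hx hy => simp only [TensorProduct.add_tmul, map_add, hx, hy]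
        | tmul a b => rfl
    exact (h1 _).trans ((congrArg (fun t => F (t ⊗ₜ n))
      (LinearMap.congr_fun hc m).symm).trans (h2 _).symm)
  · refine TensorProduct.ext' fun m n => ?_
    simp only [LinearMap.comp_apply, LinearMap.rTensor_tmul, LinearMap.lTensor_tmul]
    induction M.left m with
    | zero => simp
    | add x y hx hy => simp only [TensorProduct.add_tmul, map_add, hx, hy]
    | tmul a b => rfl

/-- The cotensor difference is compatible with the right coaction. -/
theorem rTensor_cotensorDiff_right (M W : Bicomodule k C) :
    (cotensorDiff (M.corestrict π).right (W.corestrict π).left).rTensor C ∘ₗ (M.tensor W).right =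
      ((TensorProduct.assoc k M.carrier (D ⊗[k] W.carrier) C).symm.toLinearMap ∘ₗ
        ((TensorProduct.assoc k D W.carrier C).symm.toLinearMap ∘ₗ
          W.right.lTensor D).lTensor M.carrier) ∘ₗ
            cotensorDiff (M.corestrict π).right (W.corestrict π).left := by
  have hc := comm_corestrict_left π W
  generalize (M.corestrict π).right = ρ
  generalize (W.corestrict π).left = lam at hc ⊢
  let F : M.carrier ⊗[k] (D ⊗[k] (W.carrier ⊗[k] C)) →ₗ[k]
      (M.carrier ⊗[k] (D ⊗[k] W.carrier)) ⊗[k] C :=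
    (TensorProduct.assoc k M.carrier (D ⊗[k] W.carrier) C).symm.toLinearMap ∘ₗ
      (TensorProduct.assoc k D W.carrier C).symm.toLinearMap.lTensor M.carrier
  rw [cotensorDiff, LinearMap.rTensor_sub, LinearMap.comp_sub, LinearMap.sub_comp]
  congr 1
  · refine TensorProduct.ext' fun m n => ?_
    have h1 : ∀ t : W.carrier ⊗[k] C,
        ((TensorProduct.assoc k M.carrier D W.carrier).toLinearMap ∘ₗ
          ρ.rTensor W.carrier).rTensor C
            ((TensorProduct.assoc k M.carrier W.carrier C).symm (m ⊗ₜ t)) =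
        F (TensorProduct.assoc k M.carrier D (W.carrier ⊗[k] C) (ρ m ⊗ₜ t)) := by
      intro t
      induction t with
      | zero => simp
      | add x y hx hy => simp only [TensorProduct.tmul_add, map_add, hx, hy]
      | tmul n d =>
        simp only [TensorProduct.assoc_symm_tmul, LinearMap.rTensor_tmul, LinearMap.comp_apply]
        induction ρ m with
        | zero => simp
        | add x y hx hy => simp only [TensorProduct.add_tmul, map_add, hx, hy]
        | tmul a b => rfl
    refine (h1 _).trans ?_
    simp only [LinearMap.comp_apply, LinearMap.rTensor_tmul]
    induction ρ m with
    | zero => simp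
    | add x y hx hy => simp only [TensorProduct.add_tmul, map_add, hx, hy]
    | tmul a b => rfl
  · refine TensorProduct.ext' fun m n => ?_
    have h1 : ∀ t : W.carrier ⊗[k] C,
        (lam.lTensor M.carrier).rTensor C
            ((TensorProduct.assoc k M.carrier W.carrier C).symm (m ⊗ₜ t)) =
        F (m ⊗ₜ TensorProduct.assoc k D W.carrier C (lam.rTensor C t)) := by
      intro t
      induction t with
      | zero => simp
      | add x y hx hy => simp only [TensorProduct.tmul_add, map_add, hx, hy]
      | tmul n d =>
        simp only [TensorProduct.assoc_symm_tmul, LinearMap.rTensor_tmul, LinearMap.lTensor_tmul]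
        induction lam n with
        | zero => simp
        | add x y hx hy =>
          simp only [TensorProduct.add_tmul, TensorProduct.tmul_add, map_add, hx, hy]
        | tmul a b => rfl
    refine (h1 _).trans ((congrArg (fun t => F (m ⊗ₜ t)) (LinearMap.congr_fun hc n)).trans ?_)
    simp only [LinearMap.comp_apply, LinearMap.lTensor_tmul]
    induction lam n with
    | zero => simp
    | add x y hx hy => simp only [TensorProduct.tmul_add, map_add, hx, hy]
    | tmul a b => rfl

/-- The `C`-bicomodule `C □_D W` for a `C`-bicomodule `W`. -/
abbrev Bicomodule.coind (W : Bicomodule k C) : Bicomodule k C :=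
  ((regular k C).tensor W).restrict
    (Coalg.cotensor ((regular k C).corestrict π).right (W.corestrict π).left)
    (left_mem_ker _ _ _ (lTensor_cotensorDiff_left π (regular k C) W))
    (right_mem_ker _ _ _ (rTensor_cotensorDiff_right π (regular k C) W))

theorem Bicomodule.coind_corestrict (W : Bicomodule k C) :
    IsHom ((W.coind π).corestrict π) (((regular k C).corestrict π).cotensor (W.corestrict π))
      LinearMap.id := by
  have h : IsHom (W.coind π) ((regular k C).tensor W) (Submodule.subtype _) :=
    (isHom_restrict_iff (N := (regular k C).tensor W) (W.coind π) _ _ _ LinearMap.id).1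
      (IsHom.id _)
  refine (isHom_restrict_iff _ _ _ _ _).2 ?_
  exact (isHom_corestrict_tensor π (regular k C) W).comp (h.corestrict π)

end Coinduction

/-! ### The double complex of a resolution -/

section Resolution

variable (R : ℕ → Bicomodule k C) (δ : ∀ i, (R i).carrier →ₗ[k] (R (i + 1)).carrier)
  (hδ : ∀ i, IsHom (R i) (R (i + 1)) (δ i)) (hδδ : ∀ i, Function.Exact (δ i) (δ (i + 1)))

/-- The Hochschild double complex of a sequence of bicomodules. -/
def resolutionComplex : DoubleComplex.{u, v} k where
  X i j := (cochains (R i) j).carrier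
  dh i j := cochainsMap (δ i) j
  -- The sign makes the commuting squares of the Hochschild complexes anticommute.
  dv i j := (-1 : k) ^ i • hochschildD (R i) j
  dh_dh i j x := (cochainsMap_exact (hδδ i) j).apply_apply_eq_zero x
  dv_dv i j x := by
    have h : hochschildD (R i) (j + 1) (hochschildD (R i) j x) = 0 :=
      LinearMap.congr_fun (hochschildD_hochschildD (R i) j) x
    rw [LinearMap.smul_apply, LinearMap.smul_apply, map_smul, h, smul_zero, smul_zero]
  dh_dv i j x := by
    have h : hochschildD (R (i + 1)) j (cochainsMap (δ i) j x) =
      cochainsMap (δ i) (j + 1) (hochschildD (R i) j x) :=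
      LinearMap.congr_fun (cochainsMap_hochschildD (hδ i) j) x
    rw [LinearMap.smul_apply, LinearMap.smul_apply, map_smul, h, pow_succ, mul_neg_one, neg_smul,
      add_neg_cancel]

variable {A : Bicomodule k C} (ε : A.carrier →ₗ[k] (R 0).carrier) (hε : IsHom A (R 0) ε)
  (hi : Function.Injective ε) (he : Function.Exact ε (δ 0))

/-- The Hochschild cohomology of a bicomodule computed by a resolution. -/
def resolutionEquiv (n : ℕ) : Coh (hochschildD A) n ≃ₗ[k]
    Subquotient ((resolutionComplex R δ hδ hδδ).totCycles n)
      ((resolutionComplex R δ hδ hδδ).totBoundaries n) :=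
  DoubleComplex.totEquiv (hochschildD A) (fun n => cochainsMap ε n)
    (fun i j x hx => (cochainsMap_exact (hδδ i) j x).1 hx)
    (fun n => cochainsMap_injective hi n)
    (fun n x => cochainsMap_exact he n x)
    (fun n a => by
      refine Eq.trans ?_ (LinearMap.congr_fun (cochainsMap_hochschildD hε n) a)
      change ((-1 : k) ^ 0 • hochschildD (R 0) n) (cochainsMap ε n a) = _
      rw [pow_zero, one_smul]
      rfl) n

end Resolution

/-! ### Rotation of cochains -/

section Rotation

variable {M N : Bicomodule k C}

/-- The map `m ⊗ c ↦ n ⊗ c ⊗ e` for `φ m = n ⊗ e`. -/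
def rotationStep {M N : Type v} [AddCommGroup M] [Module k M] [AddCommGroup N] [Module k N]
    (φ : M →ₗ[k] N ⊗[k] C) : M ⊗[k] C →ₗ[k] (N ⊗[k] C) ⊗[k] C :=
  (TensorProduct.rightComm k N C C).toLinearMap ∘ₗ φ.rTensor C

/-- The compatibility of a rotation with the last coface. -/
def IsRotation (M N : Bicomodule k C) (φ : M.carrier →ₗ[k] N.carrier ⊗[k] C) : Prop :=
  rotationStep φ ∘ₗ lastCoface M = (N.tensor (regular k C)).right ∘ₗ φ

/-- Both composites treat the additional factor `C` as a spectator and differ from those one degree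
lower by the same permutation `G`. -/
theorem IsRotation.step {φ : M.carrier →ₗ[k] N.carrier ⊗[k] C} (h : IsRotation M N φ) :
    IsRotation (M.tensor (regular k C)) (N.tensor (regular k C)) (rotationStep φ) := by
  let G : ((N.carrier ⊗[k] C) ⊗[k] C) ⊗[k] C →ₗ[k] ((N.carrier ⊗[k] C) ⊗[k] C) ⊗[k] C :=
    (TensorProduct.rightComm k N.carrier C C).toLinearMap.rTensor C ∘ₗ
      (TensorProduct.rightComm k (N.carrier ⊗[k] C) C C).toLinearMap
  have h1 : rotationStep (rotationStep φ) ∘ₗ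
      (TensorProduct.rightComm k M.carrier C C).toLinearMap =
        G ∘ₗ (rotationStep φ).rTensor C := by
    refine TensorProduct.ext_threefold fun m c e => ?_
    simp only [rotationStep, LinearMap.comp_apply, LinearEquiv.coe_coe,
      TensorProduct.rightComm_tmul, LinearMap.rTensor_tmul]
    induction φ m with
    | zero => simp
    | add x y hx hy => simp only [TensorProduct.add_tmul, map_add, hx, hy]
    | tmul a b => rfl
  have h2 : ((N.tensor (regular k C)).tensor (regular k C)).right ∘ₗ
      (TensorProduct.rightComm k N.carrier C C).toLinearMap =
        G ∘ₗ (N.tensor (regular k C)).right.rTensor C := by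
    refine TensorProduct.ext_threefold fun m c e => ?_
    simp only [LinearMap.comp_apply, LinearEquiv.coe_coe,
      TensorProduct.rightComm_tmul, LinearMap.rTensor_tmul, LinearMap.lTensor_tmul]
    induction Coalgebra.comul (R := k) c with
    | zero => simp
    | add x y hx hy => simp only [TensorProduct.add_tmul, TensorProduct.tmul_add, map_add, hx, hy]
    | tmul a b => rfl
  have h3 := congrArg (LinearMap.rTensor C) h
  rw [LinearMap.rTensor_comp, LinearMap.rTensor_comp] at h3
  rw [IsRotation, lastCoface_tensor, ← LinearMap.comp_assoc, h1, LinearMap.comp_assoc, h3,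
    ← LinearMap.comp_assoc, ← h2]
  rfl

/-- The iterated rotation. -/
def rotation (φ : M.carrier →ₗ[k] N.carrier ⊗[k] C) :
    ∀ n, (cochains M n).carrier →ₗ[k] (cochains N n).carrier ⊗[k] C
  | 0 => φ
  | n + 1 => rotationStep (rotation φ n)

theorem IsRotation.rotation {φ : M.carrier →ₗ[k] N.carrier ⊗[k] C} (h : IsRotation M N φ) (n : ℕ) :
    IsRotation (cochains M n) (cochains N n) (rotation φ n) := by
  induction n with
  | zero => exact h
  | succ n ih => exact ih.step

theorem rotation_partialD_step {φ : M.carrier →ₗ[k] N.carrier ⊗[k] C}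
    {p : M.carrier →ₗ[k] M.carrier ⊗[k] C} {p' : N.carrier →ₗ[k] N.carrier ⊗[k] C}
    (h : rotationStep φ ∘ₗ p = p'.rTensor C ∘ₗ φ) (s : k) :
    rotationStep (rotationStep φ) ∘ₗ (p.rTensor C + s • (M.tensor (regular k C)).right) =
      (p'.rTensor C + s • (N.tensor (regular k C)).right).rTensor C ∘ₗ rotationStep φ := by
  have h1 : rotationStep (rotationStep φ) ∘ₗ p.rTensor C =
      (p'.rTensor C).rTensor C ∘ₗ rotationStep φ := by
    conv_lhs => rw [rotationStep]
    rw [LinearMap.comp_assoc, ← LinearMap.rTensor_comp, h, LinearMap.rTensor_comp, rotationStep,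
      ← LinearMap.comp_assoc, ← LinearMap.comp_assoc]
    congr 1
    exact TensorProduct.ext_threefold fun _ _ _ => rfl
  have h2 : rotationStep (rotationStep φ) ∘ₗ (M.tensor (regular k C)).right =
      (N.tensor (regular k C)).right.rTensor C ∘ₗ rotationStep φ := by
    refine TensorProduct.ext' fun m c => ?_
    have h3 : ∀ (t : N.carrier ⊗[k] C) (u : C ⊗[k] C),
        (TensorProduct.rightComm k (N.carrier ⊗[k] C) C C)
          ((TensorProduct.rightComm k N.carrier C C).toLinearMap.rTensor C
            ((TensorProduct.assoc k (N.carrier ⊗[k] C) C C).symm (t ⊗ₜ u))) =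
        ((TensorProduct.assoc k N.carrier C C).symm.toLinearMap.rTensor C
          (TensorProduct.rightComm k N.carrier C (C ⊗[k] C) (t ⊗ₜ u))) := by
      intro t u
      induction u with
      | zero => simp
      | add x y hx hy => simp only [TensorProduct.tmul_add, map_add, hx, hy]
      | tmul a b =>
        induction t with
        | zero => simp
        | add x y hx hy => simp only [TensorProduct.add_tmul, map_add, hx, hy]
        | tmul n e => rfl
    have h4 : ∀ u : C ⊗[k] C, rotationStep (rotationStep φ)
        ((TensorProduct.assoc k M.carrier C C).symm (m ⊗ₜ u)) =
        (TensorProduct.rightComm k (N.carrier ⊗[k] C) C C)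
          ((TensorProduct.rightComm k N.carrier C C).toLinearMap.rTensor C
            ((TensorProduct.assoc k (N.carrier ⊗[k] C) C C).symm (φ m ⊗ₜ u))) := by
      intro u
      induction u with
      | zero => simp
      | add x y hx hy => simp only [TensorProduct.tmul_add, map_add, hx, hy]
      | tmul a b => rfl
    refine (h4 _).trans ((h3 _ _).trans ?_)
    simp only [rotationStep, LinearMap.comp_apply, LinearMap.rTensor_tmul]
    induction φ m with
    | zero => simp
    | add x y hx hy => simp only [TensorProduct.add_tmul, map_add, hx, hy]
    | tmul n e => rfl
  rw [LinearMap.comp_add, LinearMap.comp_smul, h1, h2, LinearMap.rTensor_add,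
    LinearMap.rTensor_smul, LinearMap.add_comp, LinearMap.smul_comp]

theorem rotation_partialD {φ : M.carrier →ₗ[k] N.carrier ⊗[k] C}
    (h : rotationStep φ ∘ₗ M.right = N.right.rTensor C ∘ₗ φ) (n : ℕ) :
    rotationStep (rotation φ n) ∘ₗ partialD M n = (partialD N n).rTensor C ∘ₗ rotation φ n := by
  induction n with
  | zero =>
    rw [partialD_zero, partialD_zero]
    exact h
  | succ n ih =>
    rw [partialD_succ, partialD_succ]
    exact rotation_partialD_step ih _

theorem IsRotation.comp_hochschildD_step {φ : M.carrier →ₗ[k] N.carrier ⊗[k] C}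
    (hφ : IsRotation M N φ) {p : M.carrier →ₗ[k] M.carrier ⊗[k] C}
    {p' : N.carrier →ₗ[k] N.carrier ⊗[k] C} (h : rotationStep φ ∘ₗ p = p'.rTensor C ∘ₗ φ) (s : k) :
    rotationStep φ ∘ₗ (p + s • lastCoface M) =
      (p'.rTensor C + s • (N.tensor (regular k C)).right) ∘ₗ φ := by
  have hφ' : rotationStep φ ∘ₗ lastCoface M = (N.tensor (regular k C)).right ∘ₗ φ := hφ
  rw [LinearMap.comp_add, LinearMap.comp_smul, h, hφ', LinearMap.add_comp, LinearMap.smul_comp]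

/-- Moving the leading factor to the end turns the last coface into the comultiplication of the
final factor and preserves the other cofaces. So the Hochschild differential of `M` becomes the
cobar differential of `N`, one degree higher and without the cyclic term. -/
theorem IsRotation.comp_hochschildD {φ : M.carrier →ₗ[k] N.carrier ⊗[k] C}
    (hφ : IsRotation M N φ) (h : rotationStep φ ∘ₗ M.right = N.right.rTensor C ∘ₗ φ) (n : ℕ) :
    Coalg.rotation φ (n + 1) ∘ₗ hochschildD M n = partialD N (n + 1) ∘ₗ Coalg.rotation φ n := by
  rw [partialD_succ]
  exact (hφ.rotation n).comp_hochschildD_step (rotation_partialD h n) _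

variable (π : C →ₗc[k] D)

/-- The Hochschild differential of the `D`-bicomodule `M ⊗ C` in degree zero. -/
def zeroD (M : Bicomodule k C) : M.carrier ⊗[k] C →ₗ[k] (M.carrier ⊗[k] C) ⊗[k] D :=
  ((M.tensor (regular k C)).corestrict π).right -
    lastCoface ((M.tensor (regular k C)).corestrict π)

theorem zeroD_eq (M : Bicomodule k C) : zeroD π M =
    ((M.corestrict π).tensor ((regular k C).corestrict π)).right -
      lastCoface ((M.corestrict π).tensor ((regular k C).corestrict π)) :=
  congrArg₂ (fun r l => r - (TensorProduct.comm k D (M.carrier ⊗[k] C)).toLinearMap ∘ₗ l)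
    (corestrict_tensor_right π M (regular k C)) (corestrict_tensor_left π M (regular k C))

omit [Coalgebra k C] [Coalgebra k D] in
theorem rTensor_sub_comp_comp {X Y Z Z' : Type v} [AddCommGroup X] [Module k X] [AddCommGroup Y]
    [Module k Y] [AddCommGroup Z] [Module k Z] [AddCommGroup Z'] [Module k Z'] (r l : X →ₗ[k] Y)
    (f : Z →ₗ[k] X ⊗[k] C) (g : Y ⊗[k] C →ₗ[k] Z') :
    g ∘ₗ (r - l).rTensor C ∘ₗ f = g ∘ₗ r.rTensor C ∘ₗ f - g ∘ₗ l.rTensor C ∘ₗ f := by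
  rw [LinearMap.rTensor_sub, LinearMap.sub_comp, LinearMap.comp_sub]

/-- The interchange of the two factors `C` of `((M ⊗ C) ⊗ D) ⊗ C`. -/
def zeroPerm (M : Type v) [AddCommGroup M] [Module k M] :
    ((M ⊗[k] C) ⊗[k] D) ⊗[k] C →ₗ[k] ((M ⊗[k] C) ⊗[k] C) ⊗[k] D :=
  (TensorProduct.rightComm k M C C).toLinearMap.rTensor D ∘ₗ
    (TensorProduct.rightComm k (M ⊗[k] C) D C).toLinearMap

/-- The map uses only the left coaction of `M` and the final factor `C`; a new factor inserted
between them is a spectator. -/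
theorem zeroD_tensor (M : Bicomodule k C) : zeroD π (M.tensor (regular k C)) =
    zeroPerm M.carrier ∘ₗ
      (zeroD π M).rTensor C ∘ₗ (TensorProduct.rightComm k M.carrier C C).toLinearMap := by
  have hr : (((M.tensor (regular k C)).corestrict π).tensor ((regular k C).corestrict π)).right =
      zeroPerm M.carrier ∘ₗ
        ((M.corestrict π).tensor ((regular k C).corestrict π)).right.rTensor C ∘ₗ
          (TensorProduct.rightComm k M.carrier C C).toLinearMap := by
    refine TensorProduct.ext_threefold fun m c e => ?_
    simp only [LinearMap.comp_apply, LinearEquiv.coe_coe,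
      TensorProduct.rightComm_tmul, LinearMap.rTensor_tmul, LinearMap.lTensor_tmul]
    induction Coalgebra.comul (R := k) e with
    | zero => simp
    | add x y hx hy => simp only [TensorProduct.add_tmul, TensorProduct.tmul_add, map_add, hx, hy]
    | tmul a b => rfl
  have hl : lastCoface (((M.tensor (regular k C)).corestrict π).tensor
        ((regular k C).corestrict π)) =
      zeroPerm M.carrier ∘ₗ
        (lastCoface ((M.corestrict π).tensor ((regular k C).corestrict π))).rTensor C ∘ₗ
          (TensorProduct.rightComm k M.carrier C C).toLinearMap := by
    refine TensorProduct.ext_threefold fun m c e => ?_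
    simp only [lastCoface, LinearMap.comp_apply, LinearEquiv.coe_coe,
      TensorProduct.rightComm_tmul, LinearMap.rTensor_tmul]
    induction M.left m with
    | zero => simp
    | add x y hx hy => simp only [TensorProduct.add_tmul, map_add, hx, hy]
    | tmul a b => rfl
  rw [zeroD_eq, zeroD_eq]
  exact (congrArg₂ (· - ·) hr hl).trans (rTensor_sub_comp_comp _ _ _ _).symm

/-- Each degree is obtained from the previous one by tensoring with `C`, which is exact over a
field, and by permuting factors. -/
theorem rotation_exact {φ : M.carrier →ₗ[k] N.carrier ⊗[k] C} (h : Function.Exact φ (zeroD π N))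
    (n : ℕ) : Function.Exact (rotation φ n) (zeroD π (cochains N n)) := by
  induction n with
  | zero => exact h
  | succ n ih =>
    have h1 := Module.Flat.rTensor_exact C ih
    have h2 := zeroD_tensor π (cochains N n)
    have h3 : Function.Injective (zeroPerm (k := k) (C := C) (D := D) (cochains N n).carrier) := by
      have h := Module.Flat.rTensor_preserves_injective_linearMap (M := D)
        (TensorProduct.rightComm k (cochains N n).carrier C C).toLinearMap
        (TensorProduct.rightComm k (cochains N n).carrier C C).injective
      exact h.comp (TensorProduct.rightComm k ((cochains N n).carrier ⊗[k] C) D C).injective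
    intro x
    have h4 : zeroD π (cochains N (n + 1)) x = 0 ↔
        (zeroD π (cochains N n)).rTensor C
          (TensorProduct.rightComm k (cochains N n).carrier C C x) = 0 := by
      refine Iff.trans ?_ (map_eq_zero_iff _ h3)
      exact Eq.congr_left (LinearMap.congr_fun h2 x)
    rw [h4, h1]
    constructor
    · rintro ⟨y, hy⟩
      exact ⟨y, (congrArg (TensorProduct.rightComm k (cochains N n).carrier C C) hy).trans
        ((TensorProduct.rightComm k (cochains N n).carrier C C).symm_apply_apply x)⟩
    · rintro ⟨y, rfl⟩
      exact ⟨y, ((TensorProduct.rightComm k (cochains N n).carrier C C).symm_apply_apply _).symm⟩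

theorem rotation_injective {φ : M.carrier →ₗ[k] N.carrier ⊗[k] C} (h : Function.Injective φ)
    (n : ℕ) : Function.Injective (rotation φ n) := by
  induction n with
  | zero => exact h
  | succ n ih =>
    exact (TensorProduct.rightComm k (cochains N n).carrier C C).injective.comp
      (Module.Flat.rTensor_preserves_injective_linearMap _ ih)

end Rotation

/-! ### Shapiro's lemma for coinduced bicomodules -/

section Coinduction

variable (π : C →ₗc[k] D) (W : Bicomodule k C)

/-- The map `C □_D W → W ⊗ C`, `c ⊗ w ↦ w ⊗ c`. -/
def coindRotation : (W.coind π).carrier →ₗ[k] W.carrier ⊗[k] C :=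
  (TensorProduct.comm k C W.carrier).toLinearMap ∘ₗ Submodule.subtype _

theorem Bicomodule.isHom_coind_subtype : IsHom (W.coind π) ((regular k C).tensor W)
    (Submodule.subtype _) :=
  (isHom_restrict_iff (N := (regular k C).tensor W) (W.coind π) _ _ _ LinearMap.id).1 (IsHom.id _)

theorem rotationStep_comm_right :
    rotationStep (TensorProduct.comm k C W.carrier).toLinearMap ∘ₗ
      ((regular k C).tensor W).right =
        W.right.rTensor C ∘ₗ (TensorProduct.comm k C W.carrier).toLinearMap := by
  refine TensorProduct.ext' fun c w => ?_
  simp only [rotationStep, LinearMap.comp_apply, LinearEquiv.coe_coe, TensorProduct.comm_tmul,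
    LinearMap.rTensor_tmul, LinearMap.lTensor_tmul]
  induction W.right w with
  | zero => simp
  | add x y hx hy => simp only [TensorProduct.add_tmul, TensorProduct.tmul_add, map_add, hx, hy]
  | tmul a b => rfl

/-- The left coaction of `C ⊗ W` is the comultiplication of its leading factor, which is the final
one after the exchange. -/
theorem isRotation_comm : IsRotation ((regular k C).tensor W) W
    (TensorProduct.comm k C W.carrier).toLinearMap := by
  refine TensorProduct.ext' fun c w => ?_
  simp only [rotationStep, lastCoface, LinearMap.comp_apply, LinearEquiv.coe_coe,
    TensorProduct.comm_tmul, LinearMap.rTensor_tmul, LinearMap.lTensor_tmul]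
  induction Coalgebra.comul (R := k) c with
  | zero => simp
  | add x y hx hy => simp only [TensorProduct.add_tmul, TensorProduct.tmul_add, map_add, hx, hy]
  | tmul a b => rfl

omit [Coalgebra k C] in
theorem rotationStep_comp {M N P : Type v} [AddCommGroup M] [Module k M] [AddCommGroup N]
    [Module k N] [AddCommGroup P] [Module k P] (φ : N →ₗ[k] P ⊗[k] C) (f : M →ₗ[k] N) :
    rotationStep (φ ∘ₗ f) = rotationStep φ ∘ₗ f.rTensor C := by
  rw [rotationStep, rotationStep, LinearMap.rTensor_comp, LinearMap.comp_assoc]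

theorem rotationStep_coindRotation_right :
    rotationStep (coindRotation π W) ∘ₗ (W.coind π).right =
      W.right.rTensor C ∘ₗ coindRotation π W := by
  rw [coindRotation, rotationStep_comp, LinearMap.comp_assoc, ← (isHom_coind_subtype π W).right,
    ← LinearMap.comp_assoc, rotationStep_comm_right, LinearMap.comp_assoc]

theorem isRotation_coindRotation : IsRotation (W.coind π) W (coindRotation π W) := by
  have h : rotationStep (TensorProduct.comm k C W.carrier).toLinearMap ∘ₗ
    lastCoface ((regular k C).tensor W) = _ := isRotation_comm W
  rw [IsRotation, coindRotation, rotationStep_comp, LinearMap.comp_assoc,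
    ← lastCoface_comp (isHom_coind_subtype π W), ← LinearMap.comp_assoc, h, LinearMap.comp_assoc]

theorem coindRotation_injective : Function.Injective (coindRotation π W) :=
  (TensorProduct.comm k C W.carrier).injective.comp Subtype.val_injective

/-- In degree zero the cocycles of the `D`-bicomodule `W ⊗ C` are the elements of `C □_D W` with the
two factors exchanged. -/
theorem coindRotation_exact : Function.Exact (coindRotation π W) (zeroD π W) := by
  intro x
  obtain ⟨z, rfl⟩ := (TensorProduct.comm k C W.carrier).surjective x
  have h : zeroD π W (TensorProduct.comm k C W.carrier z) = 0 ↔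
      z ∈ Coalg.cotensor ((regular k C).corestrict π).right (W.corestrict π).left := by
    rw [Coalg.cotensor, LinearMap.mem_ker,
      ← (cotensorPerm ((regular k C).corestrict π).carrier W.carrier).map_eq_zero_iff]
    refine Eq.congr_left ?_
    rw [zeroD_eq]
    exact LinearMap.congr_fun
      (right_sub_lastCoface_comp_comm (W.corestrict π) ((regular k C).corestrict π)) z
  rw [h]
  constructor
  · intro hz
    exact ⟨⟨z, hz⟩, rfl⟩
  · rintro ⟨y, hy⟩
    have : y.1 = z := (TensorProduct.comm k C W.carrier).injective hy
    exact this ▸ y.2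

/-- The resolution of `W` by the `D`-bicomodules `W ⊗ C^{⊗ (a + 1)}`. -/
def cobarComplex : DoubleComplex.{u, v} k :=
  resolutionComplex (fun a => (cochains W (a + 1)).corestrict π) (fun a => partialD W (a + 1))
    (fun a => (isHom_partialD W (a + 1)).corestrict π) (fun a => partialD_exact W (a + 1))

omit [Coalgebra k C] in
theorem smul_apply_smul_of_mul_self {X Y : Type v} [AddCommGroup X] [Module k X] [AddCommGroup Y]
    [Module k Y] (f : X →ₗ[k] Y) {s : k} (hs : s * s = 1) {x : X} {y : Y} (h : f x = y) :
    s • f (s • x) = y := by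
  rw [map_smul, smul_smul, hs, one_smul, h]

/-- The Hochschild cohomology of `C □_D W` over `C` is that of `W` over `D`. -/
def coindEquiv (hr : ((regular k C).corestrict π).toRightComodule.IsCoflat) (n : ℕ) :
    Coh (hochschildD (W.coind π)) n ≃ₗ[k] Coh (hochschildD (W.corestrict π)) n :=
  -- The columns of the double complex resolve `CH^*(C, C □_D W)` through the rotation, its rows
  -- resolve `CH^*(D, W)`, and transposition links the two total complexes.
  (DoubleComplex.totEquiv (K := (cobarComplex π W).swap) (hochschildD (W.coind π))
    (fun n => rotation (coindRotation π W) n)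
    (fun i j x hx => by
      -- A column is the Hochschild complex over `D` of `(W ⊗ C^{⊗ j}) ⊗ C`, whose last factor is
      -- coflat; the sign of the vertical differential is absorbed in the primitive.
      have h := hochschildD_exact_of_isCoflat ((cochains W j).corestrict π)
        ((regular k C).corestrict π) hr i
      rw [← corestrict_tensor] at h
      have hx' : (-1 : k) ^ j • hochschildD ((cochains W (j + 1)).corestrict π) (i + 1) x = 0 := hx
      obtain ⟨y, hy⟩ := h x ((smul_eq_zero_iff_right (by simp)).1 hx')
      exact ⟨(-1 : k) ^ j • y, smul_apply_smul_of_mul_self _ (by simp [← mul_pow]) hy⟩)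
    (fun n => rotation_injective (coindRotation_injective π W) n)
    (fun n x => by
      refine Iff.trans ?_ (rotation_exact π (coindRotation_exact π W) n x)
      change (-1 : k) ^ n • hochschildD ((cochains W (n + 1)).corestrict π) 0 x = 0 ↔ _
      rw [smul_eq_zero_iff_right (by simp)]
      exact Eq.congr_left (LinearMap.congr_fun (hochschildD_zero _) x))
    (fun n a => (LinearMap.congr_fun ((isRotation_coindRotation π W).comp_hochschildD
      (rotationStep_coindRotation_right π W) n) a).symm) n) ≪≫ₗ
  ((cobarComplex π W).totSwapEquiv n).symm ≪≫ₗ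
  -- The cobar resolution starts at `a + 1` because its degree zero term `W` is the augmentation.
  (resolutionEquiv (fun a => (cochains W (a + 1)).corestrict π) (fun a => partialD W (a + 1))
    (fun a => (isHom_partialD W (a + 1)).corestrict π) (fun a => partialD_exact W (a + 1))
    (A := W.corestrict π) (partialD W 0) ((isHom_partialD W 0).corestrict π)
    (partialD_zero_injective W) (partialD_exact W 0) n).symm

end Coinduction

/-! ### Isomorphisms of bicomodules -/

section CohEquiv

variable {X Y : ℕ → Type v} [∀ n, AddCommGroup (X n)] [∀ n, Module k (X n)]
  [∀ n, AddCommGroup (Y n)] [∀ n, Module k (Y n)]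

/-- The isomorphism in cohomology induced by isomorphisms which commute with the differentials up to
a nonzero scalar. -/
def cohEquiv {d : ∀ n, X n →ₗ[k] X (n + 1)} {d' : ∀ n, Y n →ₗ[k] Y (n + 1)}
    (e : ∀ n, X n ≃ₗ[k] Y n) {s : k} (hs : s ≠ 0)
    (h : ∀ n x, d' n (e n x) = s • e (n + 1) (d n x)) (n : ℕ) : Coh d n ≃ₗ[k] Coh d' n :=
  Subquotient.equiv ((e n).toLinearMap ∘ₗ Submodule.subtype _)
    (fun x => by
      have hx : d n x.1 = 0 := x.2
      refine (h n x.1).trans ?_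
      rw [hx, map_zero, smul_zero])
    (fun x => by
      cases n with
      | zero => exact (e 0).map_eq_zero_iff
      | succ n =>
        constructor
        · rintro ⟨y, hy⟩
          refine ⟨s • (e n).symm y, (e (n + 1)).injective ?_⟩
          refine Eq.trans ?_ hy
          rw [map_smul, map_smul, ← h, LinearEquiv.apply_symm_apply]
        · rintro ⟨y, hy⟩
          refine ⟨s⁻¹ • e n y, ?_⟩
          rw [map_smul, h, smul_smul, inv_mul_cancel₀ hs, one_smul, hy]
          rfl)
    (fun y hy => by
      have hy' : d' n y = 0 := hy
      have h' : d n ((e n).symm y) = 0 := by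
        refine (e (n + 1)).injective ((smul_right_inj hs).1 ?_)
        rw [← h, LinearEquiv.apply_symm_apply, hy', map_zero, smul_zero]
      refine ⟨⟨(e n).symm y, h'⟩, ?_⟩
      rw [LinearMap.comp_apply, Submodule.subtype_apply, LinearEquiv.coe_coe,
        LinearEquiv.apply_symm_apply, sub_self]
      exact Submodule.zero_mem _)

end CohEquiv

/-- Two bicomodules are isomorphic. -/
def Bicomodule.Isomorphic (M N : Bicomodule k D) : Prop :=
  ∃ e : M.carrier ≃ₗ[k] N.carrier, IsHom M N e.toLinearMap

theorem Bicomodule.Isomorphic.trans {M N P : Bicomodule k D} (h : M.Isomorphic N)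
    (h' : N.Isomorphic P) : M.Isomorphic P := by
  obtain ⟨e, he⟩ := h
  obtain ⟨e', he'⟩ := h'
  exact ⟨e ≪≫ₗ e', he'.comp he⟩

theorem Bicomodule.Isomorphic.symm {M N : Bicomodule k D} (h : M.Isomorphic N) :
    N.Isomorphic M := by
  obtain ⟨e, he⟩ := h
  exact ⟨e.symm, he.symm⟩

/-- Isomorphic bicomodules have the same Hochschild cohomology. -/
theorem Bicomodule.Isomorphic.nonempty_cohEquiv {M N : Bicomodule k D} (h : M.Isomorphic N)
    (n : ℕ) : Nonempty (Coh (hochschildD M) n ≃ₗ[k] Coh (hochschildD N) n) := by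
  obtain ⟨e, he⟩ := h
  refine ⟨cohEquiv (fun n => LinearEquiv.ofBijective (cochainsMap e.toLinearMap n)
    ⟨cochainsMap_injective e.injective n, cochainsMap_surjective e.surjective n⟩) one_ne_zero
    (fun n x => ?_) n⟩
  rw [one_smul]
  exact LinearMap.congr_fun (cochainsMap_hochschildD he n) x

/-- Two bicomodules embedded with the same image in a third one are isomorphic. -/
theorem Bicomodule.isomorphic_of_range_eq {M N X : Bicomodule k D}
    {i : M.carrier →ₗ[k] X.carrier} {j : N.carrier →ₗ[k] X.carrier} (hi : IsHom M X i)
    (hj : IsHom N X j) (hi' : Function.Injective i) (hj' : Function.Injective j)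
    (h : ∀ x, (∃ m, i m = x) ↔ ∃ n, j n = x) : M.Isomorphic N := by
  have h' : LinearMap.range i = LinearMap.range j := SetLike.ext h
  have e1 : M.Isomorphic hi.range :=
    ⟨LinearEquiv.ofInjective i hi', hi.isHom_rangeRestrict⟩
  have e2 : hj.range.Isomorphic N :=
    Isomorphic.symm ⟨LinearEquiv.ofInjective j hj', hj.isHom_rangeRestrict⟩
  refine e1.trans (Isomorphic.trans ?_ e2)
  refine ⟨LinearEquiv.ofEq _ _ h', ?_⟩
  refine (isHom_restrict_iff _ _ _ _ _).2 ?_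
  exact (isHom_restrict_iff (N := X) hi.range _ _ _ LinearMap.id).1 (IsHom.id _)

/-! ### Properties of the cotensor product -/

section Cotensor

variable (M N P : Bicomodule k D)

theorem Bicomodule.isHom_cotensor_subtype : IsHom (M.cotensor N) (M.tensor N)
    (Submodule.subtype _) :=
  (isHom_restrict_iff (N := M.tensor N) (M.cotensor N) _ _ _ LinearMap.id).1 (IsHom.id _)

variable {M N P}

-- Since everything is flat over a field, the cotensor product with a subcomodule is the
-- intersection with the ambient cotensor product.
omit [Coalgebra k D] in
theorem mem_cotensor_lTensor_iff {M : Type v} [AddCommGroup M] [Module k M]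
    (ρ : M →ₗ[k] M ⊗[k] D) {N N' : Type v} [AddCommGroup N] [Module k N] [AddCommGroup N']
    [Module k N'] {lam : N →ₗ[k] D ⊗[k] N} {lam' : N' →ₗ[k] D ⊗[k] N'} (f : N →ₗ[k] N')
    (hf : lam' ∘ₗ f = f.lTensor D ∘ₗ lam) (hi : Function.Injective f) (x : M ⊗[k] N) :
    f.lTensor M x ∈ Coalg.cotensor ρ lam' ↔ x ∈ Coalg.cotensor ρ lam := by
  have h : cotensorDiff ρ lam' ∘ₗ f.lTensor M =
      (f.lTensor D).lTensor M ∘ₗ cotensorDiff ρ lam := by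
    rw [cotensorDiff, cotensorDiff, LinearMap.comp_sub, LinearMap.sub_comp, LinearMap.comp_assoc,
      ← LinearMap.lTensor_comp, hf, LinearMap.rTensor_comp_lTensor,
      ← LinearMap.lTensor_comp_rTensor, LinearMap.lTensor_comp]
    congr 1
    rw [← LinearMap.comp_assoc, ← LinearMap.comp_assoc]
    congr 1
    exact TensorProduct.ext_threefold fun _ _ _ => rfl
  have hi' : Function.Injective ((f.lTensor D).lTensor M) :=
    Module.Flat.lTensor_preserves_injective_linearMap _
      (Module.Flat.lTensor_preserves_injective_linearMap _ hi)
  refine Iff.trans (Eq.congr_left (LinearMap.congr_fun h x)) ?_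
  exact map_eq_zero_iff _ hi'

omit [Coalgebra k D] in
theorem mem_cotensor_rTensor_iff {N : Type v} [AddCommGroup N] [Module k N]
    (lam : N →ₗ[k] D ⊗[k] N) {M M' : Type v} [AddCommGroup M] [Module k M] [AddCommGroup M']
    [Module k M'] {ρ : M →ₗ[k] M ⊗[k] D} {ρ' : M' →ₗ[k] M' ⊗[k] D} (f : M →ₗ[k] M')
    (hf : ρ' ∘ₗ f = f.rTensor D ∘ₗ ρ) (hi : Function.Injective f) (x : M ⊗[k] N) :
    f.rTensor N x ∈ Coalg.cotensor ρ' lam ↔ x ∈ Coalg.cotensor ρ lam := by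
  have h : cotensorDiff ρ' lam ∘ₗ f.rTensor N =
      f.rTensor (D ⊗[k] N) ∘ₗ cotensorDiff ρ lam := by
    rw [cotensorDiff, cotensorDiff, LinearMap.comp_sub, LinearMap.sub_comp, LinearMap.comp_assoc,
      ← LinearMap.rTensor_comp, hf, LinearMap.rTensor_comp_lTensor,
      LinearMap.lTensor_comp_rTensor, LinearMap.rTensor_comp]
    congr 1
    rw [← LinearMap.comp_assoc, ← LinearMap.comp_assoc]
    congr 1
    exact TensorProduct.ext_threefold fun _ _ _ => rfl
  have hi' : Function.Injective (f.rTensor (D ⊗[k] N)) :=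
    Module.Flat.rTensor_preserves_injective_linearMap _ hi
  refine Iff.trans (Eq.congr_left (LinearMap.congr_fun h x)) ?_
  exact map_eq_zero_iff _ hi'

/-- The cotensor product preserves isomorphisms in the second variable. -/
theorem Bicomodule.Isomorphic.cotensor_left (h : N.Isomorphic P) :
    (M.cotensor N).Isomorphic (M.cotensor P) := by
  obtain ⟨e, he⟩ := h
  have hi : Function.Injective (e.toLinearMap.lTensor M.carrier) :=
    Module.Flat.lTensor_preserves_injective_linearMap _ e.injective
  refine isomorphic_of_range_eq ((he.lTensor M).comp (isHom_cotensor_subtype M N))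
    (isHom_cotensor_subtype M P) (hi.comp Subtype.val_injective) Subtype.val_injective fun x => ?_
  constructor
  · rintro ⟨m, rfl⟩
    exact ⟨⟨_, (mem_cotensor_lTensor_iff M.right e.toLinearMap he.left e.injective m.1).2 m.2⟩, rfl⟩
  · rintro ⟨n, rfl⟩
    obtain ⟨y, hy⟩ := LinearMap.lTensor_surjective M.carrier (g := e.toLinearMap) e.surjective n.1
    refine ⟨⟨y, (mem_cotensor_lTensor_iff M.right e.toLinearMap he.left e.injective y).1 ?_⟩, hy⟩
    rw [hy]
    exact n.2

variable (M) in
/-- The coalgebra is a unit for the cotensor product. -/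
theorem Bicomodule.regular_cotensor : ((regular k D).cotensor M).Isomorphic M := by
  refine isomorphic_of_range_eq (isHom_cotensor_subtype (regular k D) M) (isHom_left M)
    Subtype.val_injective M.left_injective fun x => ?_
  -- The cotensor condition for `D` and `M` is, by definition, the vanishing of the difference in
  -- `exact_left`; both spaces thus have the same image in `D ⊗ M`.
  refine Iff.trans ?_ (exact_left M x)
  exact ⟨fun ⟨m, hm⟩ => hm ▸ m.2, fun h => ⟨⟨x, h⟩, rfl⟩⟩

theorem Bicomodule.isHom_assoc : IsHom ((M.tensor N).tensor P) (M.tensor (N.tensor P))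
    (TensorProduct.assoc k M.carrier N.carrier P.carrier).toLinearMap := by
  constructor
  · refine TensorProduct.ext_threefold fun m n p => ?_
    simp only [LinearMap.comp_apply, LinearEquiv.coe_coe, TensorProduct.assoc_tmul,
      LinearMap.rTensor_tmul]
    induction M.left m with
    | zero => simp
    | add x y hx hy => simp only [TensorProduct.add_tmul, map_add, hx, hy]
    | tmul a b => rfl
  · refine TensorProduct.ext_threefold fun m n p => ?_
    simp only [LinearMap.comp_apply, LinearEquiv.coe_coe, TensorProduct.assoc_tmul,
      LinearMap.lTensor_tmul]
    induction P.right p with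
    | zero => simp
    | add x y hx hy => simp only [TensorProduct.tmul_add, map_add, hx, hy]
    | tmul a b => rfl

variable (M N P)

/-- The factor `M` is a spectator, as the right coaction of `M ⊗ N` is that of `N`. With its mirror
image below, this expresses both conditions for the triple cotensor product inside `M ⊗ N ⊗ P`. -/
theorem cotensorDiff_tensor_left :
    (TensorProduct.assoc k M.carrier N.carrier (D ⊗[k] P.carrier)).toLinearMap ∘ₗ
      cotensorDiff (M.tensor N).right P.left =
    (cotensorDiff N.right P.left).lTensor M.carrier ∘ₗ
      (TensorProduct.assoc k M.carrier N.carrier P.carrier).toLinearMap := by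
  rw [cotensorDiff, cotensorDiff, LinearMap.comp_sub, LinearMap.lTensor_sub, LinearMap.sub_comp]
  congr 1
  · refine TensorProduct.ext_threefold fun m n p => ?_
    simp only [LinearMap.comp_apply, LinearEquiv.coe_coe, TensorProduct.assoc_tmul,
      LinearMap.lTensor_tmul, LinearMap.rTensor_tmul]
    induction N.right n with
    | zero => simp
    | add x y hx hy => simp only [TensorProduct.tmul_add, TensorProduct.add_tmul, map_add, hx, hy]
    | tmul a b => rfl
  · exact TensorProduct.ext_threefold fun m n p => rfl

theorem cotensorDiff_tensor_right :
    cotensorDiff M.right (N.tensor P).left ∘ₗ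
      (TensorProduct.assoc k M.carrier N.carrier P.carrier).toLinearMap =
    ((TensorProduct.assoc k D N.carrier P.carrier).toLinearMap.lTensor M.carrier ∘ₗ
      (TensorProduct.assoc k M.carrier (D ⊗[k] N.carrier) P.carrier).toLinearMap) ∘ₗ
        (cotensorDiff M.right N.left).rTensor P.carrier := by
  rw [cotensorDiff, cotensorDiff, LinearMap.sub_comp, LinearMap.rTensor_sub, LinearMap.comp_sub]
  congr 1
  · refine TensorProduct.ext_threefold fun m n p => ?_
    simp only [LinearMap.comp_apply, LinearEquiv.coe_coe, TensorProduct.assoc_tmul,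
      LinearMap.rTensor_tmul]
    induction M.right m with
    | zero => simp
    | add x y hx hy => simp only [TensorProduct.add_tmul, map_add, hx, hy]
    | tmul a b => rfl
  · exact TensorProduct.ext_threefold fun m n p => rfl

theorem mem_cotensor_tensor_left (x : (M.carrier ⊗[k] N.carrier) ⊗[k] P.carrier) :
    x ∈ Coalg.cotensor (M.tensor N).right P.left ↔
      (cotensorDiff N.right P.left).lTensor M.carrier
        (TensorProduct.assoc k M.carrier N.carrier P.carrier x) = 0 := by
  refine Iff.trans ?_ (Eq.congr_left (LinearMap.congr_fun (cotensorDiff_tensor_left M N P) x))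
  exact (TensorProduct.assoc k M.carrier N.carrier (D ⊗[k] P.carrier)).map_eq_zero_iff.symm

theorem mem_cotensor_tensor_right (x : (M.carrier ⊗[k] N.carrier) ⊗[k] P.carrier) :
    TensorProduct.assoc k M.carrier N.carrier P.carrier x ∈
      Coalg.cotensor M.right (N.tensor P).left ↔
        (cotensorDiff M.right N.left).rTensor P.carrier x = 0 := by
  refine Iff.trans (Eq.congr_left (LinearMap.congr_fun (cotensorDiff_tensor_right M N P) x)) ?_
  have h : Function.Injective
      ((TensorProduct.assoc k D N.carrier P.carrier).toLinearMap.lTensor M.carrier) :=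
    Module.Flat.lTensor_preserves_injective_linearMap _
      (TensorProduct.assoc k D N.carrier P.carrier).injective
  have h' : Function.Injective
      ((TensorProduct.assoc k D N.carrier P.carrier).toLinearMap.lTensor M.carrier ∘ₗ
        (TensorProduct.assoc k M.carrier (D ⊗[k] N.carrier) P.carrier).toLinearMap) :=
    h.comp (TensorProduct.assoc k M.carrier (D ⊗[k] N.carrier) P.carrier).injective
  exact map_eq_zero_iff _ h'

/-- The cotensor product is associative. -/
theorem Bicomodule.cotensor_assoc :
    ((M.cotensor N).cotensor P).Isomorphic (M.cotensor (N.cotensor P)) := by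
  have h1 := isHom_cotensor_subtype M N
  have h2 := isHom_cotensor_subtype N P
  let i := (Submodule.subtype (Coalg.cotensor M.right N.left)).rTensor P.carrier
  let j := (Submodule.subtype (Coalg.cotensor N.right P.left)).lTensor M.carrier
  have hi : Function.Injective i :=
    Module.Flat.rTensor_preserves_injective_linearMap _ (Submodule.injective_subtype _)
  have hj : Function.Injective j :=
    Module.Flat.lTensor_preserves_injective_linearMap _ (Submodule.injective_subtype _)
  let a := TensorProduct.assoc k M.carrier N.carrier P.carrier
  have hie := Module.Flat.rTensor_exact P.carrier (exact_cotensorDiff M.right N.left)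
  have hje := Module.Flat.lTensor_exact M.carrier (exact_cotensorDiff N.right P.left)
  refine isomorphic_of_range_eq
    (isHom_assoc.comp ((h1.rTensor P).comp (isHom_cotensor_subtype (M.cotensor N) P)))
    ((h2.lTensor M).comp (isHom_cotensor_subtype M (N.cotensor P)))
    (a.injective.comp (hi.comp Subtype.val_injective)) (hj.comp Subtype.val_injective) fun x => ?_
  obtain ⟨x, rfl⟩ := a.surjective x
  -- Both bracketings have as image in `M ⊗ N ⊗ P` the subspace where the condition between `M` and
  -- `N` and that between `N` and `P` hold simultaneously.
  have hl : (∃ m : ((M.cotensor N).cotensor P).carrier, a (i m.1) = a x) ↔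
      (cotensorDiff M.right N.left).rTensor P.carrier x = 0 ∧
        (cotensorDiff N.right P.left).lTensor M.carrier (a x) = 0 := by
    rw [← mem_cotensor_tensor_left, hie x]
    constructor
    · rintro ⟨m, hm⟩
      obtain rfl := a.injective hm
      exact ⟨⟨m.1, rfl⟩, (mem_cotensor_rTensor_iff P.left _ h1.right
        (Submodule.injective_subtype _) m.1).2 m.2⟩
    · rintro ⟨⟨y, rfl⟩, hy⟩
      exact ⟨⟨y, (mem_cotensor_rTensor_iff P.left _ h1.right
        (Submodule.injective_subtype _) y).1 hy⟩, rfl⟩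
  have hr : (∃ n : (M.cotensor (N.cotensor P)).carrier, j n.1 = a x) ↔
      (cotensorDiff M.right N.left).rTensor P.carrier x = 0 ∧
        (cotensorDiff N.right P.left).lTensor M.carrier (a x) = 0 := by
    rw [← mem_cotensor_tensor_right, hje]
    constructor
    · rintro ⟨n, hn⟩
      exact ⟨hn ▸ (mem_cotensor_lTensor_iff M.right _ h2.left
        (Submodule.injective_subtype _) n.1).2 n.2, ⟨n.1, hn⟩⟩
    · rintro ⟨hy, ⟨y, hy'⟩⟩
      exact ⟨⟨y, (mem_cotensor_lTensor_iff M.right _ h2.left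
        (Submodule.injective_subtype _) y).1 (hy' ▸ hy)⟩, hy'⟩
  exact hl.trans hr.symm

end Cotensor

/-! ### The relative cobar resolution -/

section Tower

variable (π : C →ₗc[k] D)

/-- The map `C □_D A → C □_D B` induced by a homomorphism of `C`-bicomodules. -/
def coindMap {A B : Bicomodule k C} (f : A.carrier →ₗ[k] B.carrier) (hf : IsHom A B f) :
    (A.coind π).carrier →ₗ[k] (B.coind π).carrier :=
  cotensorMapRight ((regular k C).corestrict π).right f (hf.corestrict π).left

theorem isHom_coindMap {A B : Bicomodule k C} {f : A.carrier →ₗ[k] B.carrier} (hf : IsHom A B f) :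
    IsHom (A.coind π) (B.coind π) (coindMap π f hf) :=
  (isHom_restrict_iff _ _ _ _ _).2 ((hf.lTensor (regular k C)).comp (isHom_coind_subtype π A))

/-- The cotensor condition over `D` is the coassociativity condition over `C` composed with `π` on
the middle factor. -/
theorem left_mem_coind (A : Bicomodule k C) (a : A.carrier) :
    A.left a ∈ Coalg.cotensor ((regular k C).corestrict π).right (A.corestrict π).left := by
  have h : cotensorDiff ((regular k C).corestrict π).right (A.corestrict π).left =
      (π.toLinearMap.rTensor A.carrier).lTensor C ∘ₗ
        (((regular k C).tensor A).left - A.left.lTensor C) := by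
    rw [cotensorDiff, LinearMap.comp_sub, ← LinearMap.lTensor_comp, LinearMap.rTensor_comp]
    congr 1
    rw [← LinearMap.comp_assoc, ← LinearMap.comp_assoc]
    congr 1
    exact TensorProduct.ext_threefold fun _ _ _ => rfl
  refine (LinearMap.congr_fun h _).trans ?_
  rw [LinearMap.comp_apply, (exact_left A).apply_apply_eq_zero, map_zero]

/-- The unit `A → C □_D A`, given by the left coaction. -/
def coindUnit (A : Bicomodule k C) : A.carrier →ₗ[k] (A.coind π).carrier :=
  A.left.codRestrict _ (left_mem_coind π A)

theorem isHom_coindUnit (A : Bicomodule k C) : IsHom A (A.coind π) (coindUnit π A) :=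
  (isHom_restrict_iff _ _ _ _ _).2 (isHom_left A)

theorem coindUnit_natural {A B : Bicomodule k C} {f : A.carrier →ₗ[k] B.carrier}
    (hf : IsHom A B f) : coindUnit π B ∘ₗ f = coindMap π f hf ∘ₗ coindUnit π A :=
  LinearMap.ext fun a => Subtype.ext (LinearMap.congr_fun hf.left a)

/-- The map `C □_D A → A`, `c ⊗ a ↦ ε(c) a`. -/
def coindCounit (A : Bicomodule k C) : (A.coind π).carrier →ₗ[k] A.carrier :=
  (TensorProduct.lid k A.carrier).toLinearMap ∘ₗ
    (Coalgebra.counit (R := k) (A := C)).rTensor A.carrier ∘ₗ Submodule.subtype _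

theorem coindCounit_unit (A : Bicomodule k C) (a : A.carrier) :
    coindCounit π A (coindUnit π A a) = a :=
  lid_counit_left A a

theorem coindCounit_map {A B : Bicomodule k C} {f : A.carrier →ₗ[k] B.carrier}
    (hf : IsHom A B f) (x : (A.coind π).carrier) :
    coindCounit π B (coindMap π f hf x) = f (coindCounit π A x) := by
  have h : (TensorProduct.lid k B.carrier).toLinearMap ∘ₗ
      (Coalgebra.counit (R := k) (A := C)).rTensor B.carrier ∘ₗ f.lTensor C =
      f ∘ₗ (TensorProduct.lid k A.carrier).toLinearMap ∘ₗ
        (Coalgebra.counit (R := k) (A := C)).rTensor A.carrier :=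
    TensorProduct.ext' fun c a => by simp
  exact LinearMap.congr_fun h x.1

theorem coindMap_comp_eq_zero {A B B' : Bicomodule k C} {f : A.carrier →ₗ[k] B.carrier}
    {g : B.carrier →ₗ[k] B'.carrier} (hf : IsHom A B f) (hg : IsHom B B' g) (h : g ∘ₗ f = 0) :
    coindMap π g hg ∘ₗ coindMap π f hf = 0 := by
  refine LinearMap.ext fun x => Subtype.ext ?_
  change g.lTensor C (f.lTensor C x.1) = 0
  rw [← LinearMap.comp_apply, ← LinearMap.lTensor_comp, h, LinearMap.lTensor_zero,
    LinearMap.zero_apply]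

/-- A bicomodule `A` together with a homomorphism `A → C □_D A`. -/
structure CoindStage where
  /-- the bicomodule -/
  obj : Bicomodule k C
  /-- the homomorphism -/
  hom : obj.carrier →ₗ[k] (obj.coind π).carrier
  isHom : IsHom obj (obj.coind π) hom

variable {π}

/-- The passage from `f : A → C □_D A` to `η - C □_D f : C □_D A → C □_D C □_D A`. -/
def CoindStage.next (S : CoindStage π) : CoindStage π where
  obj := S.obj.coind π
  hom := coindUnit π (S.obj.coind π) - coindMap π S.hom S.isHom
  isHom := (isHom_coindUnit π _).sub (isHom_coindMap π S.isHom)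

variable (π)

/-- The terms and the differentials of the relative cobar resolution of `V`. -/
def coindStage (V : Bicomodule k C) : ℕ → CoindStage π
  | 0 => ⟨V, coindUnit π V, isHom_coindUnit π V⟩
  | n + 1 => (coindStage V n).next

/-- The stages grow by a new outermost factor. This equality reads the same term as the resolution
of `V.coind π`, with the new factor next to `V`, as the induction on cotensor powers needs. -/
theorem coindStage_coind (V : Bicomodule k C) (n : ℕ) :
    (coindStage π (V.coind π) n).obj = (coindStage π V (n + 1)).obj := by
  induction n with
  | zero => rfl
  | succ n ih => exact congrArg (Bicomodule.coind π) ih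

variable (V : Bicomodule k C)

theorem coindStage_zero_injective : Function.Injective (coindStage π V 0).hom :=
  Function.LeftInverse.injective (g := coindCounit π V) (coindCounit_unit π V)

variable {π}

/-- The counit on the leftmost factor is a linear contraction: applied to `η x = (C □ f) x` it gives
`x = f (ε x)`. -/
theorem CoindStage.exact_of_comp (S : CoindStage π) (h : S.next.hom ∘ₗ S.hom = 0) :
    Function.Exact S.hom S.next.hom := by
  intro x
  constructor
  · intro hx
    have hx' : coindUnit π (S.obj.coind π) x = coindMap π S.hom S.isHom x := sub_eq_zero.1 hx
    have h := congrArg (coindCounit π (S.obj.coind π)) hx'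
    rw [coindCounit_unit, coindCounit_map] at h
    exact ⟨_, h.symm⟩
  · rintro ⟨y, rfl⟩
    exact LinearMap.congr_fun h y

/-- With `f' = η - C □ f` and `f'' = η - C □ f'`, naturality of `η` gives `f'' f' = (C □ f')(η - f')
= (C □ f')(C □ f) = C □ (f' f)`. -/
theorem CoindStage.next_comp (S : CoindStage π) (h : S.next.hom ∘ₗ S.hom = 0) :
    S.next.next.hom ∘ₗ S.next.hom = 0 := by
  have h1 := coindUnit_natural π S.next.isHom
  have h2 : coindMap π S.next.hom S.next.isHom ∘ₗ coindMap π S.hom S.isHom = 0 :=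
    coindMap_comp_eq_zero π S.isHom S.next.isHom h
  have h3 : S.next.next.hom ∘ₗ S.next.hom =
      coindMap π S.next.hom S.next.isHom ∘ₗ (coindUnit π S.next.obj - S.next.hom) := by
    rw [LinearMap.comp_sub]
    exact (LinearMap.sub_comp _ _ _).trans (congrArg (· - _) h1)
  have h4 : coindUnit π S.next.obj - S.next.hom = coindMap π S.hom S.isHom := sub_sub_cancel _ _
  rw [h3, h4]
  exact h2

variable (π)

theorem coindStage_comp (n : ℕ) :
    (coindStage π V n).next.hom ∘ₗ (coindStage π V n).hom = 0 := by
  induction n with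
  | zero =>
    exact LinearMap.ext fun x => sub_eq_zero.2
      (LinearMap.congr_fun (coindUnit_natural π (isHom_coindUnit π V)) x)
  | succ n ih => exact (coindStage π V n).next_comp ih

theorem coindStage_exact (n : ℕ) :
    Function.Exact (coindStage π V n).hom (coindStage π V (n + 1)).hom :=
  (coindStage π V n).exact_of_comp (coindStage_comp π V n)

theorem coind_corestrict_isomorphic : ((V.coind π).corestrict π).Isomorphic
    (((regular k C).corestrict π).cotensor (V.corestrict π)) :=
  ⟨LinearEquiv.refl k _, coind_corestrict π V⟩

/-- The terms of the relative cobar resolution are the cotensor products with the powers of `C`. -/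
theorem cotensorPower_cotensor_isomorphic (i : ℕ) :
    ((((regular k C).corestrict π).cotensorPower i).cotensor (V.corestrict π)).Isomorphic
      ((coindStage π V i).obj.corestrict π) := by
  induction i generalizing V with
  | zero => exact regular_cotensor _
  | succ i ih =>
    -- The last factor of the power is absorbed into the coefficients, and the induction hypothesis
    -- applies to `C □_D V`.
    refine (cotensor_assoc _ _ _).trans ?_
    rw [← coindStage_coind]
    exact Isomorphic.trans (Isomorphic.cotensor_left
      (coind_corestrict_isomorphic π V).symm) (ih (V.coind π))

end Tower

/-! ### The spectral sequence -/

section SpectralSequence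

variable (π : C →ₗc[k] D) (V : Bicomodule k C)

/-- The Hochschild cohomology as a subquotient of the cochains. -/
def HHIso (n : ℕ) : HH V n ≅ ModuleCat.of k (Coh (hochschildD V) n) :=
  homologyIsoCoh (hochschildD V) (fun n => by
    rw [← ModuleCat.ofHom_comp, hochschildD_hochschildD]; rfl) n

/-- The Hochschild double complex of the relative cobar resolution. -/
def coindComplex : DoubleComplex.{u, v} k :=
  resolutionComplex (fun i => (coindStage π V (i + 1)).obj) (fun i => (coindStage π V (i + 1)).hom)
    (fun i => (coindStage π V (i + 1)).isHom) (fun i => coindStage_exact π V (i + 1))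

/-- The Hochschild cohomology of `V` is that of the total complex of the relative cobar
resolution. -/
def coindComplexEquiv (n : ℕ) : Coh (hochschildD V) n ≃ₗ[k]
    Subquotient ((coindComplex π V).totCycles n) ((coindComplex π V).totBoundaries n) :=
  resolutionEquiv (fun i => (coindStage π V (i + 1)).obj) (fun i => (coindStage π V (i + 1)).hom)
    (fun i => (coindStage π V (i + 1)).isHom) (fun i => coindStage_exact π V (i + 1)) (A := V)
    (coindStage π V 0).hom (coindStage π V 0).isHom (coindStage_zero_injective π V)
    (coindStage_exact π V 0) n

/-- Column `i` carries stage `i + 1` of the resolution, stage `0` being the augmentation `V`. That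
stage is coinduced from stage `i`, so Shapiro's lemma lowers the index by one and replaces `C` by
`D`. -/
theorem nonempty_firstPage_iso (hr : ((regular k C).corestrict π).toRightComodule.IsCoflat)
    (i j : ℕ) : Nonempty (firstPage (coindComplex π V).filtered.spectralSequence i j ≅
      HH ((((regular k C).corestrict π).cotensorPower i).cotensor (V.corestrict π)) j) := by
  obtain ⟨e⟩ := (cotensorPower_cotensor_isomorphic π V i).nonempty_cohEquiv j
  have e₁ : Coh (hochschildD (coindStage π V (i + 1)).obj) j ≃ₗ[k]
      Coh (hochschildD ((coindStage π V i).obj.corestrict π)) j :=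
    coindEquiv π ((coindStage π V i).obj) hr j
  have e₂ : Coh (hochschildD (coindStage π V (i + 1)).obj) j ≃ₗ[k]
      Coh ((coindComplex π V).dv i) j :=
    -- The vertical differential differs from the Hochschild differential only by the sign `(-1)^i`.
    cohEquiv (fun n => LinearEquiv.refl k (cochains (coindStage π V (i + 1)).obj n).carrier)
      (s := (-1 : k) ^ i) (by simp) (fun n x => rfl) j
  exact ⟨((coindComplex π V).firstPageEquiv i j ≪≫ₗ e₂.symm ≪≫ₗ e₁ ≪≫ₗ e.symm).toModuleIso ≪≫
    (HHIso _ j).symm⟩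

theorem convergesTo_coindComplex :
    ConvergesTo (coindComplex π V).filtered.spectralSequence (fun n => HH V n) := by
  let e (n : ℕ) : Subquotient ((coindComplex π V).totCycles n)
      ((coindComplex π V).totBoundaries n) ≃ₗ[k] HH V n :=
    (coindComplexEquiv π V n).symm ≪≫ₗ (HHIso V n).symm.toLinearEquiv
  refine FilteredComplex.convergesTo _ _
    (fun n => (e n).toLinearMap ∘ₗ Submodule.mkQ _)
    (fun n => (e n).surjective.comp (Submodule.mkQ_surjective _)) fun n x => ?_
  refine (e n).map_eq_zero_iff.trans ?_
  exact Subquotient.mk_eq_zero x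

end SpectralSequence

end Coalg

end

theorem mainTheorem3 {k : Type u} [Field k]
    {C : Type v} [AddCommGroup C] [Module k C] [Coalgebra k C]
    {D : Type v} [AddCommGroup D] [Module k D] [Coalgebra k D]
    (π : C →ₗc[k] D) (hπ : Function.Surjective π)
    (V : Coalg.Bicomodule k C)
    (hl : ((Coalg.Bicomodule.regular k C).corestrict π).toLeftComodule.IsCoflat)
    (hr : ((Coalg.Bicomodule.regular k C).corestrict π).toRightComodule.IsCoflat) :
    ∃ E : CohomologicalSpectralSequenceNat (ModuleCat.{v} k) 1,
      (∀ i j : ℕ, Nonempty (Coalg.firstPage E i j ≅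
        Coalg.HH ((((Coalg.Bicomodule.regular k C).corestrict π).cotensorPower i).cotensor
          (V.corestrict π)) j)) ∧
      Coalg.ConvergesTo E (fun n => Coalg.HH V n) :=
  ⟨(Coalg.coindComplex π V).filtered.spectralSequence, Coalg.nonempty_firstPage_iso π V hr,
    Coalg.convergesTo_coindComplex π V⟩
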